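/- **Hybrid systems.** A hybrid system $\mathcal H=(C,F,D,G)$ on $\mathbb R^m$ is written $x\in C,\ \dot x\in F(x)$; $x\in D,\ x^+\in G(x)$, where $F,G$ are set-valued. A compact hybrid time domain is a set $\bigcup_{j=0}^{J-1}[t_j,t_{j+1}]\times\{j\}$ with $0=t_0\le t_1\le\dots\le t_J$; a hybrid time domain is a set $E\subset\mathbb R_{\ge0}\times\mathbb Z_{\ge0}$ such that $E\cap([0,T]\times\{0,\dots,J\})$ is a compact hybrid time domain for every $(T,J)\in E$. A solution of $\mathcal H$ is a function $x$ on a nonempty hybrid time domain $\operatorname{dom}x$ with $x(0,0)\in C\cup D$ such that, writing $I_j=\{t:(t,j)\in\operatorname{dom}x\}$: for each $j$ for which $I_j$ has nonempty interior, $x(\cdot,j)$ is locally absolutely continuous on $I_j$, $x(t,j)\in C$ for all $t\in I_j$ and $\dot x(t,j)\in F(x(t,j))$ for almost all $t\in I_j$; and whenever $(t,j),(t,j+1)\in\operatorname{dom}x$, $x(t,j)\in D$ and $x(t,j+1)\in G(x(t,j))$. **Stability.** A function $\beta:\mathbb R_{\ge0}^2\to\mathbb R_{\ge0}$ is of class $\mathcal{KL}$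 if it is nondecreasing in its first and nonincreasing in its second argument, $\lim_{r\to0^+}\beta(r,s)=0$ for each $s$ and $\lim_{s\to\infty}\beta(r,s)=0$ for each $r$. For a compact set $\mathcal A$ contained in an open set $\mathcal B$, a proper indicator of $\mathcal A$ on $\mathcal B$ is a continuous $\omega:\mathcal B\to\mathbb R_{\ge0}$ that vanishes exactly on $\mathcal A$ and is unbounded along every sequence in $\mathcal B$ that approaches the boundary of $\mathcal B$ or is unbounded. $\mathcal A$ is *uniformly asymptotically stable (UAS) with basin of attraction $\mathcal B$* for $\mathcal H$ if for every proper indicator $\omega$ of $\mathcal A$ on $\mathcal B$ there is $\beta\in\mathcal{KL}$ such that every solution $x$ of $\mathcal H$ with $x(0,0)\in\mathcal B$ stays in $\mathcal B$ and satisfies $\omega(x(t,j))\le\beta(\omega(x(0,0)),t+j)$ for all $(t,j)\in\operatorname{dom}x$. **The oscillatory system.** Let $n=n_1+n_2$, $C,D\subset\mathbb R^{n}$, $\Phi:\mathbb R^{n_2}\rightrightarrows\mathbb R^{n_2}$, $G:\mathbb R^n\rightrightarrows\mathbb R^n$, and let $\phi_1,\phi_2$ be $\mathbb R^{n_1}$-valued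 functions of $(x,z,\tau_1,\tau_2)\in\mathbb R^{n_1}\times\mathbb R^{n_2}\times\mathbb R_{\ge0}^2$. Write $\theta=(x,z)$, $\tau=(\tau_1,\tau_2)$. For $\varepsilon>0$ let $\mathcal H_\varepsilon$ be the hybrid system with state $(\theta,\tau)$ that flows for $(\theta,\tau)\in C\times\mathbb R_{\ge0}^2$ by $$\dot x=\varepsilon^{-1}\phi_1(x,z,\tau)+\phi_2(x,z,\tau),\quad \dot z\in\Phi(z),\quad \dot\tau_1=\varepsilon^{-1},\quad \dot\tau_2=\varepsilon^{-2},$$ and jumps for $(\theta,\tau)\in D\times\mathbb R_{\ge0}^2$ by $\theta^+\in G(\theta)$, $\tau^+=\tau$. **Assumptions.** 1. $C$ and $D$ are closed; relative to $C$, the map $(x,z)\mapsto\Phi(z)$ is outer semicontinuous and locally bounded, with nonempty convex values on $C$; relative to $D$, $G$ is outer semicontinuous and locally bounded, with nonempty values on $D$. 2. There are $\delta^*,T_1,T_2>0$ such that on $C_{\delta^*}\times\mathbb R^2_{\ge0}$, where $C_{\delta^*}$ is the set of points whose closed Euclidean ball of radius $\delta^*$ meets $C$: (a) $\phi_1$ and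 $\phi_2$ are continuous and locally Lipschitz with respect to $z$; $\phi_2$ is locally Lipschitz with respect to $(x,\tau_1)$; $\phi_1$ is continuously differentiable with respect to $(x,\tau_1)$, with differential continuous in all variables and locally Lipschitz with respect to $(x,\tau_1)$ (all Lipschitz constants being locally uniform in the remaining variables); (b) $\phi_1,\phi_2$ are $T_1$-periodic in $\tau_1$ and $T_2$-periodic in $\tau_2$; (c) $\int_0^{T_2}\phi_1(x,z,\tau_1,s)\,ds=0$. **The average.** Let $u_1(\theta,\tau)=\int_0^{\tau_2}\phi_1(\theta,\tau_1,s)\,ds$, $[u_1,\phi_1]_x=\partial_x\phi_1\cdot u_1-\partial_xu_1\cdot\phi_1$, and $$\bar f(\theta)=\frac1{T_1T_2}\int_0^{T_1}\!\!\int_0^{T_2}\Big(\phi_2+\tfrac12[u_1,\phi_1]_x\Big)(\theta,\tau)\,d\tau_2\,d\tau_1 .$$ The second-order average system $\mathcal H_2^{\rm ave}$ is the hybrid system $\theta\in C,\ \dot\theta\in\{\bar f(\theta)\}\times\Phi(z)$; $\theta\in D,\ \theta^+\in G(\theta)$. **Theorem.** Under Assumptions 1 and 2, let $\mathcal A\subset\mathbb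 R^n$ be compact. If $\mathcal A$ is UAS with basin of attraction $\mathcal B_{\mathcal A}$ (an open set containing $\mathcal A$) for $\mathcal H_2^{\rm ave}$, then $\mathcal A$ is semi-globally practically asymptotically stable as $\varepsilon\to0^+$ with respect to $\mathcal B_{\mathcal A}$ for $\mathcal H_\varepsilon$: for each proper indicator $\omega$ of $\mathcal A$ on $\mathcal B_{\mathcal A}$ there is $\beta\in\mathcal{KL}$ such that for each compact $K\subset\mathcal B_{\mathcal A}$ and each $\nu>0$ there is $\varepsilon^*>0$ such that for all $\varepsilon\in(0,\varepsilon^*]$, every solution $(\theta,\tau)$ of $\mathcal H_\varepsilon$ with $\theta(0,0)\in K$ satisfies $\theta(t,j)\in\mathcal B_{\mathcal A}$ and $$\omega(\theta(t,j))\le\beta(\omega(\theta(0,0)),t+j)+\nu\qquad\text{for all }(t,j)\in\operatorname{dom}(\theta,\tau).$$ -/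

import Mathlib

open Set Filter Topology MeasureTheory

/-! ### Hybrid dynamical systems and their solutions -/

/-- The data `(C, F, D, G)` of a hybrid system
`x ∈ C, ẋ ∈ F(x)`; `x ∈ D, x⁺ ∈ G(x)`. -/
structure HybridSystem (E : Type*) where
  /-- flow set -/
  C : Set E
  /-- flow map -/
  F : E → Set E
  /-- jump set -/
  D : Set E
  /-- jump map -/
  G : E → Set E

/-- `E = ⋃_{j=0}^{J-1} [t_j, t_{j+1}] × {j}` with `0 = t_0 ≤ t_1 ≤ ⋯ ≤ t_J`. -/
def IsCompactHybridTimeDomain (E : Set (ℝ × ℕ)) : Prop :=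
  ∃ (J : ℕ) (t : ℕ → ℝ), t 0 = 0 ∧ (∀ j < J, t j ≤ t (j + 1)) ∧
    E = {p | p.2 < J ∧ p.1 ∈ Icc (t p.2) (t (p.2 + 1))}

/-- A subset `E` of `[0,∞) × ℕ` all of whose truncations `E ∩ ([0,T] × {0,…,J})`,
`(T,J) ∈ E`, are compact hybrid time domains. -/
def IsHybridTimeDomain (E : Set (ℝ × ℕ)) : Prop :=
  (∀ p ∈ E, 0 ≤ p.1) ∧
    ∀ p ∈ E, IsCompactHybridTimeDomain (E ∩ {q | q.1 ∈ Icc 0 p.1 ∧ q.2 ≤ p.2})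

/-- A hybrid arc. Only the values of `val` on `dom` carry meaning. -/
structure HybridArc (E : Type*) [NormedAddCommGroup E] where
  dom : Set (ℝ × ℕ)
  dom_nonempty : dom.Nonempty
  isHybridTimeDomain : IsHybridTimeDomain dom
  val : ℝ → ℕ → E
  /-- local absolute continuity on each `I_j` with nonempty interior -/
  locallyAbsolutelyContinuous :
    ∀ j : ℕ, (interior {t : ℝ | (t, j) ∈ dom}).Nonempty →
      ∀ a b : ℝ, a ≤ b → Icc a b ⊆ {t : ℝ | (t, j) ∈ dom} →
        AbsolutelyContinuousOnInterval (fun t => val t j) a b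

/-- The interval `I_j = {t : (t,j) ∈ dom x}`. -/
def HybridArc.flowInterval {E : Type*} [NormedAddCommGroup E] (x : HybridArc E) (j : ℕ) :
    Set ℝ :=
  {t | (t, j) ∈ x.dom}

/-- The hybrid arc `x` is a solution of the hybrid system `H` (not necessarily maximal). -/
def HybridSystem.IsSolution {E : Type*} [NormedAddCommGroup E] [NormedSpace ℝ E]
    (H : HybridSystem E) (x : HybridArc E) : Prop :=
  x.val 0 0 ∈ H.C ∪ H.D ∧
  (∀ j : ℕ, (interior (x.flowInterval j)).Nonempty →
    (∀ t ∈ x.flowInterval j, x.val t j ∈ H.C) ∧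
    (∀ᵐ t : ℝ, t ∈ x.flowInterval j →
      ∃ v ∈ H.F (x.val t j),
        HasDerivWithinAt (fun s => x.val s j) v (x.flowInterval j) t)) ∧
  (∀ (t : ℝ) (j : ℕ), (t, j) ∈ x.dom → (t, j + 1) ∈ x.dom →
    x.val t j ∈ H.D ∧ x.val t (j + 1) ∈ H.G (x.val t j))

/-! ### Regularity of set-valued maps, relative to a set -/

/-- `M` is outer semicontinuous relative to `K`. -/
def OuterSemicontinuousRel {X Y : Type*} [TopologicalSpace X] [TopologicalSpace Y]
    (M : X → Set Y) (K : Set X) : Prop :=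
  ∀ (u : ℕ → X) (s : ℕ → Y) (p : X) (y : Y), (∀ i, u i ∈ K) → p ∈ K →
    Tendsto u atTop (𝓝 p) → (∀ i, s i ∈ M (u i)) → Tendsto s atTop (𝓝 y) → y ∈ M p

/-- `M` is locally bounded relative to `K`. -/
def LocallyBoundedRel {X Y : Type*} [TopologicalSpace X] [Bornology Y]
    (M : X → Set Y) (K : Set X) : Prop :=
  ∀ p ∈ K, ∃ N ∈ 𝓝 p, Bornology.IsBounded (⋃ q ∈ N ∩ K, M q)

/-! ### Stability notions -/

/-- Class `KL` functions; only the values at nonnegative arguments matter. -/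
def IsClassKL (β : ℝ → ℝ → ℝ) : Prop :=
  (∀ r s, 0 ≤ r → 0 ≤ s → 0 ≤ β r s) ∧
  (∀ r r' s, 0 ≤ r → r ≤ r' → 0 ≤ s → β r s ≤ β r' s) ∧
  (∀ r s s', 0 ≤ r → 0 ≤ s → s ≤ s' → β r s' ≤ β r s) ∧
  (∀ s, 0 ≤ s → Tendsto (fun r => β r s) (𝓝[>] 0) (𝓝 0)) ∧
  (∀ r, 0 ≤ r → Tendsto (fun s => β r s) atTop (𝓝 0))

/-- `ω` is a proper indicator function for `A` on `B`; only the values of `ω` on `B` matter.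
(`Metric.infEDist y ∅ = ∞`, so no sequence approaches an empty boundary.) -/
def IsProperIndicator {E : Type*} [NormedAddCommGroup E] (A B : Set E) (ω : E → ℝ) : Prop :=
  ContinuousOn ω B ∧ (∀ x ∈ B, 0 ≤ ω x) ∧ (∀ x ∈ B, ω x = 0 ↔ x ∈ A) ∧
  ∀ u : ℕ → E, (∀ i, u i ∈ B) →
    (Tendsto (fun i => Metric.infEDist (u i) (frontier B)) atTop (𝓝 0) ∨
      ¬ Bornology.IsBounded (range u)) →
    ¬ BddAbove (range fun i => ω (u i))

/-- `A` is uniformly asymptotically stable with basin of attraction `B` for `H`.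
Since `ω` lives on `B`, the bound includes that solutions starting in `B` stay in `B`. -/
def HybridSystem.IsUAS {E : Type*} [NormedAddCommGroup E] [NormedSpace ℝ E]
    (H : HybridSystem E) (A B : Set E) : Prop :=
  IsCompact A ∧ IsOpen B ∧ A ⊆ B ∧
  ∀ ω : E → ℝ, IsProperIndicator A B ω →
    ∃ β : ℝ → ℝ → ℝ, IsClassKL β ∧
      ∀ x : HybridArc E, H.IsSolution x → x.val 0 0 ∈ B →
        ∀ (t : ℝ) (j : ℕ), (t, j) ∈ x.dom →
          x.val t j ∈ B ∧ ω (x.val t j) ≤ β (ω (x.val 0 0)) (t + j)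

/-- For a family `H ε` of hybrid systems with state `(θ, τ) ∈ E × P`, the set `A ⊆ E` is
semi-globally practically asymptotically stable as `ε → 0⁺` with respect to the basin `B`. -/
def IsSGPAS {E P : Type*} [NormedAddCommGroup E] [NormedSpace ℝ E]
    [NormedAddCommGroup P] [NormedSpace ℝ P]
    (H : ℝ → HybridSystem (E × P)) (A B : Set E) : Prop :=
  IsCompact A ∧ IsOpen B ∧ A ⊆ B ∧
  ∀ ω : E → ℝ, IsProperIndicator A B ω →
    ∃ β : ℝ → ℝ → ℝ, IsClassKL β ∧
      ∀ K : Set E, IsCompact K → K ⊆ B → ∀ ν : ℝ, 0 < ν →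
        ∃ ε₀ : ℝ, 0 < ε₀ ∧ ∀ ε : ℝ, 0 < ε → ε ≤ ε₀ →
          ∀ y : HybridArc (E × P), (H ε).IsSolution y → (y.val 0 0).1 ∈ K →
            ∀ (t : ℝ) (j : ℕ), (t, j) ∈ y.dom →
              (y.val t j).1 ∈ B ∧
                ω (y.val t j).1 ≤ β (ω (y.val 0 0).1) (t + j) + ν

/-! ### The oscillatory hybrid system and its second-order average -/

/-- `θ = (x, z) ∈ ℝ^{n₁} × ℝ^{n₂}`. -/
abbrev OscState (n₁ n₂ : ℕ) : Type :=
  EuclideanSpace ℝ (Fin n₁) × EuclideanSpace ℝ (Fin n₂)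

/-- The data of the oscillatory hybrid system: flow set `C`, jump set `D`, the flow map `Φ` of
`z`, the jump map `G`, and the functions `φ₁, φ₂` of `(x, z, τ₁, τ₂)`. -/
structure OscillatoryData (n₁ n₂ : ℕ) where
  C : Set (OscState n₁ n₂)
  D : Set (OscState n₁ n₂)
  Φ : EuclideanSpace ℝ (Fin n₂) → Set (EuclideanSpace ℝ (Fin n₂))
  G : OscState n₁ n₂ → Set (OscState n₁ n₂)
  φ₁ : EuclideanSpace ℝ (Fin n₁) → EuclideanSpace ℝ (Fin n₂) → ℝ → ℝ →
    EuclideanSpace ℝ (Fin n₁)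
  φ₂ : EuclideanSpace ℝ (Fin n₁) → EuclideanSpace ℝ (Fin n₂) → ℝ → ℝ →
    EuclideanSpace ℝ (Fin n₁)

/-- `C_δ`: the points whose closed Euclidean `δ`-ball meets `C`. -/
def euclideanInflation {n₁ n₂ : ℕ} (C : Set (OscState n₁ n₂)) (δ : ℝ) :
    Set (OscState n₁ n₂) :=
  {θ | ∃ θ' ∈ C, ‖θ'.1 - θ.1‖ ^ 2 + ‖θ'.2 - θ.2‖ ^ 2 ≤ δ ^ 2}

/-- `S × [0,∞)²`. -/
def withPhases {E : Type*} (S : Set E) : Set (E × (ℝ × ℝ)) :=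
  S ×ˢ (Ici 0 ×ˢ Ici 0)

/-- `g(x, z, τ₁, τ₂)` is locally Lipschitz with respect to `(x, τ₁)` on `S`: near each point of
`S` there is one constant that serves all nearby frozen `(z, τ₂)`. -/
def LocallyLipschitzInXTau {n₁ n₂ : ℕ} {V : Type*} [NormedAddCommGroup V]
    (g : EuclideanSpace ℝ (Fin n₁) → EuclideanSpace ℝ (Fin n₂) → ℝ → ℝ → V)
    (S : Set (OscState n₁ n₂ × (ℝ × ℝ))) : Prop :=
  ∀ p ∈ S, ∃ U ∈ 𝓝 p, ∃ L : ℝ, ∀ x x' z τ₁ τ₁' τ₂,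
    ((x, z), (τ₁, τ₂)) ∈ U ∩ S → ((x', z), (τ₁', τ₂)) ∈ U ∩ S →
      ‖g x z τ₁ τ₂ - g x' z τ₁' τ₂‖ ≤ L * (‖x - x'‖ + |τ₁ - τ₁'|)

/-- `g(x, z, τ₁, τ₂)` is locally Lipschitz with respect to `z` on `S`: near each point of
`S` there is one constant that serves all nearby frozen `(x, τ₁, τ₂)`. -/
def LocallyLipschitzInZ {n₁ n₂ : ℕ} {V : Type*} [NormedAddCommGroup V]
    (g : EuclideanSpace ℝ (Fin n₁) → EuclideanSpace ℝ (Fin n₂) → ℝ → ℝ → V)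
    (S : Set (OscState n₁ n₂ × (ℝ × ℝ))) : Prop :=
  ∀ p ∈ S, ∃ U ∈ 𝓝 p, ∃ L : ℝ, ∀ x z z' τ₁ τ₂,
    ((x, z), (τ₁, τ₂)) ∈ U ∩ S → ((x, z'), (τ₁, τ₂)) ∈ U ∩ S →
      ‖g x z τ₁ τ₂ - g x z' τ₁ τ₂‖ ≤ L * ‖z - z'‖

/-- `g` is differentiable with respect to `(x, τ₁)` on `S`, and the differential is continuous
and locally Lipschitz with respect to `(x, τ₁)`. -/
def IsC1InXTau {n₁ n₂ : ℕ} {V : Type*} [NormedAddCommGroup V] [NormedSpace ℝ V]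
    (g : EuclideanSpace ℝ (Fin n₁) → EuclideanSpace ℝ (Fin n₂) → ℝ → ℝ → V)
    (S : Set (OscState n₁ n₂ × (ℝ × ℝ))) : Prop :=
  ∃ g' : EuclideanSpace ℝ (Fin n₁) → EuclideanSpace ℝ (Fin n₂) → ℝ → ℝ →
      (EuclideanSpace ℝ (Fin n₁) × ℝ →L[ℝ] V),
    (∀ x z τ₁ τ₂, ((x, z), (τ₁, τ₂)) ∈ S →
      HasFDerivWithinAt (fun q : EuclideanSpace ℝ (Fin n₁) × ℝ => g q.1 z q.2 τ₂)
        (g' x z τ₁ τ₂) {q | ((q.1, z), (q.2, τ₂)) ∈ S} (x, τ₁)) ∧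
    ContinuousOn (fun p : OscState n₁ n₂ × (ℝ × ℝ) => g' p.1.1 p.1.2 p.2.1 p.2.2) S ∧
    LocallyLipschitzInXTau g' S

namespace OscillatoryData

variable {n₁ n₂ : ℕ} (S : OscillatoryData n₁ n₂)

/-- The regularity assumption on `C, D, Φ, G`. -/
structure BasicAssumption : Prop where
  isClosed_C : IsClosed S.C
  isClosed_D : IsClosed S.D
  osc_Φ : OuterSemicontinuousRel (fun θ : OscState n₁ n₂ => S.Φ θ.2) S.C
  locallyBounded_Φ : LocallyBoundedRel (fun θ : OscState n₁ n₂ => S.Φ θ.2) S.C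
  convex_Φ : ∀ θ ∈ S.C, Convex ℝ (S.Φ θ.2)
  nonempty_Φ : ∀ θ ∈ S.C, (S.Φ θ.2).Nonempty
  osc_G : OuterSemicontinuousRel S.G S.D
  locallyBounded_G : LocallyBoundedRel S.G S.D
  nonempty_G : ∀ θ ∈ S.D, (S.G θ).Nonempty

/-- The smoothness, periodicity and zero-average assumption on `φ₁, φ₂` over `C_δ × [0,∞)²`.
The conditions at `δ` contain those at every smaller radius. -/
structure OscillationAssumption (δ T₁ T₂ : ℝ) : Prop where
  δ_pos : 0 < δ
  T₁_pos : 0 < T₁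
  T₂_pos : 0 < T₂
  continuous_φ₁ : ContinuousOn
    (fun p : OscState n₁ n₂ × (ℝ × ℝ) => S.φ₁ p.1.1 p.1.2 p.2.1 p.2.2)
    (withPhases (euclideanInflation S.C δ))
  continuous_φ₂ : ContinuousOn
    (fun p : OscState n₁ n₂ × (ℝ × ℝ) => S.φ₂ p.1.1 p.1.2 p.2.1 p.2.2)
    (withPhases (euclideanInflation S.C δ))
  c1_φ₁ : IsC1InXTau S.φ₁ (withPhases (euclideanInflation S.C δ))
  c0_φ₂ : LocallyLipschitzInXTau S.φ₂ (withPhases (euclideanInflation S.C δ))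
  c0_z_φ₁ : LocallyLipschitzInZ S.φ₁ (withPhases (euclideanInflation S.C δ))
  c0_z_φ₂ : LocallyLipschitzInZ S.φ₂ (withPhases (euclideanInflation S.C δ))
  periodic₁_φ₁ : ∀ x z τ₁ τ₂, (x, z) ∈ euclideanInflation S.C δ → 0 ≤ τ₁ → 0 ≤ τ₂ →
    S.φ₁ x z (τ₁ + T₁) τ₂ = S.φ₁ x z τ₁ τ₂
  periodic₂_φ₁ : ∀ x z τ₁ τ₂, (x, z) ∈ euclideanInflation S.C δ → 0 ≤ τ₁ → 0 ≤ τ₂ →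
    S.φ₁ x z τ₁ (τ₂ + T₂) = S.φ₁ x z τ₁ τ₂
  periodic₁_φ₂ : ∀ x z τ₁ τ₂, (x, z) ∈ euclideanInflation S.C δ → 0 ≤ τ₁ → 0 ≤ τ₂ →
    S.φ₂ x z (τ₁ + T₁) τ₂ = S.φ₂ x z τ₁ τ₂
  periodic₂_φ₂ : ∀ x z τ₁ τ₂, (x, z) ∈ euclideanInflation S.C δ → 0 ≤ τ₁ → 0 ≤ τ₂ →
    S.φ₂ x z τ₁ (τ₂ + T₂) = S.φ₂ x z τ₁ τ₂
  zeroAverage : ∀ x z τ₁, (x, z) ∈ euclideanInflation S.C δ → 0 ≤ τ₁ →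
    ∫ s in (0 : ℝ)..T₂, S.φ₁ x z τ₁ s = 0

/-- `f_ε = ε⁻¹ φ₁ + φ₂`. -/
noncomputable def vectorField (ε : ℝ) (x : EuclideanSpace ℝ (Fin n₁))
    (z : EuclideanSpace ℝ (Fin n₂)) (τ₁ τ₂ : ℝ) : EuclideanSpace ℝ (Fin n₁) :=
  ε⁻¹ • S.φ₁ x z τ₁ τ₂ + S.φ₂ x z τ₁ τ₂

/-- The original oscillatory hybrid system with parameter `ε`, with state `((x, z), (τ₁, τ₂))`. -/
noncomputable def original (ε : ℝ) : HybridSystem (OscState n₁ n₂ × (ℝ × ℝ)) where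
  C := withPhases S.C
  F := fun p => (({S.vectorField ε p.1.1 p.1.2 p.2.1 p.2.2} : Set (EuclideanSpace ℝ (Fin n₁))) ×ˢ
    S.Φ p.1.2) ×ˢ {(ε⁻¹, (ε ^ 2)⁻¹)}
  D := withPhases S.D
  G := fun p => S.G p.1 ×ˢ {p.2}

/-- `u₁(x, z, τ₁, τ₂) = ∫_0^{τ₂} φ₁(x, z, τ₁, s) ds`. -/
noncomputable def u₁ (x : EuclideanSpace ℝ (Fin n₁)) (z : EuclideanSpace ℝ (Fin n₂))
    (τ₁ τ₂ : ℝ) : EuclideanSpace ℝ (Fin n₁) :=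
  ∫ s in (0 : ℝ)..τ₂, S.φ₁ x z τ₁ s

/-- The Lie bracket `[u₁, φ₁]_x = ∂ₓφ₁ · u₁ - ∂ₓu₁ · φ₁`. -/
noncomputable def lieBracket (x : EuclideanSpace ℝ (Fin n₁)) (z : EuclideanSpace ℝ (Fin n₂))
    (τ₁ τ₂ : ℝ) : EuclideanSpace ℝ (Fin n₁) :=
  fderiv ℝ (fun y => S.φ₁ y z τ₁ τ₂) x (S.u₁ x z τ₁ τ₂) -
    fderiv ℝ (fun y => S.u₁ y z τ₁ τ₂) x (S.φ₁ x z τ₁ τ₂)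

/-- The second-order average mapping
`f̄ = (T₁T₂)⁻¹ ∫_0^{T₁} ∫_0^{T₂} (φ₂ + ½ [u₁, φ₁]_x) dτ₂ dτ₁`. It is used only on `C`, which
lies in the interior of `C_δ`, so the derivatives in the bracket exist there. -/
noncomputable def averageMap (T₁ T₂ : ℝ) (θ : OscState n₁ n₂) : EuclideanSpace ℝ (Fin n₁) :=
  (T₁ * T₂)⁻¹ • ∫ τ₁ in (0 : ℝ)..T₁, ∫ τ₂ in (0 : ℝ)..T₂,
    (S.φ₂ θ.1 θ.2 τ₁ τ₂ + (1 / 2 : ℝ) • S.lieBracket θ.1 θ.2 τ₁ τ₂)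

/-- The second-order average hybrid system. -/
noncomputable def average (T₁ T₂ : ℝ) : HybridSystem (OscState n₁ n₂) where
  C := S.C
  F := fun θ => ({S.averageMap T₁ T₂ θ} : Set (EuclideanSpace ℝ (Fin n₁))) ×ˢ S.Φ θ.2
  D := S.D
  G := S.G

end OscillatoryData

/-!
As `ε → 0`, bounded solutions of the oscillatory system converge, along any ultrafilter, to
solutions of the average system. Indeed, over one period of the second phase, which takes time
`ε² T₂`, the field `ε⁻¹ φ₁` has mean zero to leading order; its Taylor expansion along the
`O(ε)` displacement that it causes itself leaves a drift of the same order as that of `φ₂`.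
Averaging this drift over the first phase, whose period takes time `ε T₁`, and integrating by parts
gives the Lie bracket formula for the averaged field. The `z`-component and the jumps pass to the
limit by outer semicontinuity and convexity.

Practical stability follows by compactness: if it failed on a bounded range of hybrid time for
arbitrarily small `ε`, a limit of offending solutions would violate the uniform asymptotic stability
of the average system. For long times, a neighbourhood of `A` to which all solutions starting in it
return within bounded hybrid time traps them.
-/

/-! ### Absolutely continuous functions -/

theorem absolutelyContinuousOnInterval_lipschitzWith_comp {X Y : Type*} [PseudoMetricSpace X]
    [PseudoMetricSpace Y] {f : ℝ → X} {g : X → Y} {K : NNReal} {a b : ℝ}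
    (hg : LipschitzWith K g) (hf : AbsolutelyContinuousOnInterval f a b) :
    AbsolutelyContinuousOnInterval (fun t => g (f t)) a b := by
  refine squeeze_zero (fun t => Finset.sum_nonneg fun i _ => dist_nonneg) (fun t => ?_)
    (by simpa using Tendsto.const_mul (K : ℝ) hf)
  rw [Finset.mul_sum]
  exact Finset.sum_le_sum fun i _ => hg.dist_le_mul _ _

theorem absolutelyContinuousOnInterval_comp_add_right {X : Type*} [PseudoMetricSpace X]
    {f : ℝ → X} {a b c : ℝ} (hf : AbsolutelyContinuousOnInterval f (a + c) (b + c)) :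
    AbsolutelyContinuousOnInterval (fun t => f (t + c)) a b := by
  rw [absolutelyContinuousOnInterval_iff] at hf ⊢
  intro ε hε
  obtain ⟨δ, hδ, h⟩ := hf ε hε
  have image_uIoc : ∀ u v : ℝ, uIoc (u + c) (v + c) = (· + c) '' uIoc u v := by
    simp [uIoc, min_add_add_right, max_add_add_right]
  have mem_uIcc_add : ∀ u ∈ uIcc a b, u + c ∈ uIcc (a + c) (b + c) := fun u hu => by
    rw [← image_add_const_uIcc]
    exact mem_image_of_mem _ hu
  refine ⟨δ, hδ, fun E hE hlen =>
    h (E.1, fun i => ((E.2 i).1 + c, (E.2 i).2 + c)) ⟨?_, ?_⟩ (by simpa using hlen)⟩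
  · exact fun i hi => ⟨mem_uIcc_add _ (hE.1 i hi).1, mem_uIcc_add _ (hE.1 i hi).2⟩
  · intro i hi j hj hij
    simp only [Function.onFun, image_uIoc]
    exact (disjoint_image_iff (add_left_injective c)).mpr (hE.2 hi hj hij)

section MeanValue

variable {V : Type*} [NormedAddCommGroup V] [NormedSpace ℝ V] {f : ℝ → V} {a b : ℝ}

theorem ae_hasDerivAt_of_ae_hasDerivWithinAt_Icc {s : Set V}
    (h : ∀ᵐ t : ℝ, t ∈ Icc a b → ∃ v ∈ s, HasDerivWithinAt f v (Icc a b) t) :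
    ∀ᵐ t : ℝ, t ∈ Icc a b → ∃ v ∈ s, HasDerivAt f v t := by
  filter_upwards [h, compl_mem_ae_iff.mpr (measure_singleton a),
    compl_mem_ae_iff.mpr (measure_singleton b)] with t ht hta htb htab
  obtain ⟨v, hv, hd⟩ := ht htab
  exact ⟨v, hv, hd.hasDerivAt (Icc_mem_nhds (htab.1.lt_of_ne (Ne.symm hta))
    (htab.2.lt_of_ne htb))⟩

theorem slope_mem_of_ae_hasDerivWithinAt (hab : a < b) (hf : AbsolutelyContinuousOnInterval f a b)
    {s : Set V} (hs : Convex ℝ s) (hc : IsClosed s)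
    (h : ∀ᵐ t : ℝ, t ∈ Icc a b → ∃ v ∈ s, HasDerivWithinAt f v (Icc a b) t) :
    slope f a b ∈ s := by
  -- Otherwise some functional separates the slope from `s`, against the scalar fundamental theorem.
  by_contra hn
  obtain ⟨l, u, hlu, hul⟩ := geometric_hahn_banach_closed_point hs hc hn
  have hac : AbsolutelyContinuousOnInterval (fun t => l (f t)) a b :=
    absolutelyContinuousOnInterval_lipschitzWith_comp l.lipschitz hf
  have hderiv : ∀ᵐ t : ℝ, t ∈ Icc a b → deriv (fun t => l (f t)) t ≤ u := by
    filter_upwards [ae_hasDerivAt_of_ae_hasDerivWithinAt_Icc h] with t ht htab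
    obtain ⟨v, hv, hd⟩ := ht htab
    exact (l.hasFDerivAt.comp_hasDerivAt t hd).deriv.trans_le (hlu v hv).le
  have hle : ∫ t in a..b, deriv (fun t => l (f t)) t ≤ ∫ _t in a..b, u :=
    intervalIntegral.integral_mono_ae_restrict hab.le hac.intervalIntegrable_deriv (by simp)
      ((ae_restrict_iff' measurableSet_Icc).mpr hderiv)
  rw [hac.integral_deriv_eq_sub, intervalIntegral.integral_const, smul_eq_mul,
    ← inv_mul_le_iff₀ (sub_pos.mpr hab)] at hle
  rw [slope_def_module, map_smul, map_sub, smul_eq_mul] at hul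
  exact hul.not_ge hle

theorem norm_sub_le_of_ae_hasDerivWithinAt {c : ℝ} (hab : a ≤ b)
    (hf : AbsolutelyContinuousOnInterval f a b)
    (h : ∀ᵐ t : ℝ, t ∈ Icc a b → ∃ v, ‖v‖ ≤ c ∧ HasDerivWithinAt f v (Icc a b) t) :
    ‖f b - f a‖ ≤ c * (b - a) := by
  rcases hab.eq_or_lt with rfl | hab
  · simp
  have hslope := slope_mem_of_ae_hasDerivWithinAt hab hf (convex_closedBall (0 : V) c)
    Metric.isClosed_closedBall (by simpa only [mem_closedBall_zero_iff] using h)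
  have hpos : 0 < b - a := sub_pos.mpr hab
  rwa [mem_closedBall_zero_iff, slope_def_module, norm_smul, norm_inv,
    Real.norm_of_nonneg hpos.le, inv_mul_le_iff₀ hpos, mul_comm] at hslope

end MeanValue

/-! ### Set-valued maps -/

theorem LocallyBoundedRel.exists_norm_le {X Y : Type*} [TopologicalSpace X]
    [NormedAddCommGroup Y] {M : X → Set Y} {K L : Set X} (hM : LocallyBoundedRel M K)
    (hL : IsCompact L) (hLK : L ⊆ K) : ∃ c, 0 ≤ c ∧ ∀ p ∈ L, ∀ v ∈ M p, ‖v‖ ≤ c := by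
  have hbdd : Bornology.IsBounded (⋃ p ∈ L, M p) := by
    refine hL.induction_on (p := fun s => Bornology.IsBounded (⋃ p ∈ s, M p)) (by simp)
      (fun s t hst ht => ht.subset (biUnion_subset_biUnion_left hst))
      (fun s t hs ht => by rw [biUnion_union]; exact hs.union ht) fun p hp => ?_
    obtain ⟨N, hN, hb⟩ := hM p (hLK hp)
    exact ⟨N ∩ L, inter_mem (mem_nhdsWithin_of_mem_nhds hN) self_mem_nhdsWithin,
      hb.subset (biUnion_subset_biUnion_left (inter_subset_inter_right N hLK))⟩
  obtain ⟨c, hc⟩ := hbdd.exists_norm_le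
  exact ⟨max c 0, le_max_right _ _, fun p hp v hv =>
    (hc v (mem_biUnion hp hv)).trans (le_max_left _ _)⟩

namespace OuterSemicontinuousRel

variable {X Y : Type*} [PseudoMetricSpace X] {M : X → Set Y} {K : Set X} {p : X}

theorem mem_of_tendsto [PseudoMetricSpace Y] {ι : Type*} (hM : OuterSemicontinuousRel M K)
    {l : Filter ι} [l.NeBot] {u : ι → X} {s : ι → Y} {y : Y} (hp : p ∈ K)
    (hu : Tendsto u l (𝓝 p)) (hs : Tendsto s l (𝓝 y)) (huK : ∀ᶠ i in l, u i ∈ K)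
    (hsM : ∀ᶠ i in l, s i ∈ M (u i)) : y ∈ M p := by
  have hfreq : ∃ᶠ q in 𝓝 p ×ˢ 𝓝 y, q.1 ∈ K ∧ q.2 ∈ M q.1 :=
    (hu.prodMk hs).frequently (huK.and hsM).frequently
  obtain ⟨q, hq, hqM⟩ := exists_seq_forall_of_frequently hfreq
  exact hM (fun n => (q n).1) (fun n => (q n).2) p y (fun n => (hqM n).1) hp
    (tendsto_fst.comp hq) (fun n => (hqM n).2) (tendsto_snd.comp hq)

theorem isClosed [PseudoMetricSpace Y] (hM : OuterSemicontinuousRel M K) (hp : p ∈ K) :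
    IsClosed (M p) :=
  IsSeqClosed.isClosed fun s y hs hy =>
    hM (fun _ => p) s p y (fun _ => hp) hp tendsto_const_nhds hs hy

theorem eventually_subset_thickening [NormedAddCommGroup Y] [ProperSpace Y]
    (hM : OuterSemicontinuousRel M K) (hb : LocallyBoundedRel M K) (hp : p ∈ K) {σ : ℝ}
    (hσ : 0 < σ) : ∀ᶠ q in 𝓝[K] p, M q ⊆ Metric.thickening σ (M p) := by
  by_contra hcon
  obtain ⟨q, hq, hqM⟩ := exists_seq_forall_of_frequently
    ((not_eventually.mp hcon).and_eventually self_mem_nhdsWithin)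
  choose v hv hvσ using fun n => not_subset.mp (hqM n).1
  obtain ⟨N, hN, hbdd⟩ := hb p hp
  have hvN : ∀ᶠ n in atTop, v n ∈ ⋃ q ∈ N ∩ K, M q := by
    filter_upwards [(tendsto_nhdsWithin_iff.mp hq).1 hN] with n hn
    exact mem_biUnion (show q n ∈ N ∩ K from ⟨hn, (hqM n).2⟩) (hv n)
  obtain ⟨y, -, k, hk, hy⟩ := tendsto_subseq_of_frequently_bounded hbdd hvN.frequently
  have hyM : y ∈ M p := hM (q ∘ k) (v ∘ k) p y (fun n => (hqM _).2) hp
    ((tendsto_nhdsWithin_iff.mp hq).1.comp hk.tendsto_atTop) (fun n => hv _) hy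
  obtain ⟨n, hn⟩ := (hy.eventually (Metric.isOpen_thickening.mem_nhds
    (Metric.self_subset_thickening hσ _ hyM))).exists
  exact hvσ _ hn

end OuterSemicontinuousRel

theorem exists_tendsto_ultrafilter_of_norm_le {ι E : Type*} [NormedAddCommGroup E] [ProperSpace E]
    {U : Ultrafilter ι} {u : ι → E} {c : ℝ} (h : ∀ᶠ i in (U : Filter ι), ‖u i‖ ≤ c) :
    ∃ p, Tendsto u U (𝓝 p) := by
  obtain ⟨p, -, hp⟩ := (isCompact_closedBall (0 : E) c).ultrafilter_le_nhds (U.map u)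
    (le_principal_iff.mpr (h.mono fun i hi => by simpa using hi))
  exact ⟨p, hp⟩

/-! ### Solutions on compact hybrid time domains -/

/-- The compact hybrid time domain `⋃_{k ≤ J} [t k, t (k + 1)] × {k}`; it has `J + 1` pieces, so
that its last point is `(t (J + 1), J)`. -/
def chainDomain (J : ℕ) (t : ℕ → ℝ) : Set (ℝ × ℕ) :=
  {p | p.2 ≤ J ∧ p.1 ∈ Icc (t p.2) (t (p.2 + 1))}

theorem monotoneOn_Iic_succ_of_le_succ {J : ℕ} {t : ℕ → ℝ} (hle : ∀ k ≤ J, t k ≤ t (k + 1)) :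
    MonotoneOn t (Iic (J + 1)) :=
  monotoneOn_of_le_succ ordConnected_Iic fun k _ _ hk => hle k (Nat.succ_le_succ_iff.mp hk)

theorem chainDomain_inter_Icc_prod_Iic {J : ℕ} {t : ℕ → ℝ} (hzero : t 0 = 0)
    (hle : ∀ k ≤ J, t k ≤ t (k + 1)) {T : ℝ} {K : ℕ} (hTK : (T, K) ∈ chainDomain J t) :
    chainDomain J t ∩ Icc 0 T ×ˢ Iic K = chainDomain K (Function.update t (K + 1) T) := by
  have hmono := monotoneOn_Iic_succ_of_le_succ hle
  obtain ⟨hK, hT⟩ : K ≤ J ∧ T ∈ Icc (t K) (t (K + 1)) := hTK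
  ext ⟨s, k⟩
  change (k ≤ J ∧ s ∈ Icc (t k) (t (k + 1))) ∧ s ∈ Icc 0 T ∧ k ≤ K ↔ k ≤ K ∧ s ∈ Icc _ _
  have hnonneg : k ≤ K → 0 ≤ t k := fun hk =>
    hzero ▸ hmono (Nat.zero_le _) (by simp only [mem_Iic]; omega) (Nat.zero_le k)
  rcases lt_trichotomy k K with hlt | rfl | hgt
  · have hkT : t (k + 1) ≤ T :=
      (hmono (by simp only [mem_Iic]; omega) (by simp only [mem_Iic]; omega) hlt).trans hT.1
    simp only [Function.update_of_ne (show k ≠ K + 1 by omega),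
      Function.update_of_ne (show k + 1 ≠ K + 1 by omega)]
    exact ⟨fun h => ⟨hlt.le, h.1.2⟩, fun h => ⟨⟨by omega, h.2⟩,
      ⟨(hnonneg hlt.le).trans h.2.1, h.2.2.trans hkT⟩, hlt.le⟩⟩
  · simp only [Function.update_self, Function.update_of_ne k.succ_ne_self.symm]
    exact ⟨fun h => ⟨le_rfl, h.1.2.1, h.2.1.2⟩, fun h => ⟨⟨hK, h.2.1, h.2.2.trans hT.2⟩,
      ⟨(hnonneg le_rfl).trans h.2.1, h.2.2⟩, le_rfl⟩⟩
  · exact ⟨fun h => absurd h.2.2 hgt.not_ge, fun h => absurd h.1 hgt.not_ge⟩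

theorem isHybridTimeDomain_chainDomain {J : ℕ} {t : ℕ → ℝ} (hzero : t 0 = 0)
    (hle : ∀ k ≤ J, t k ≤ t (k + 1)) : IsHybridTimeDomain (chainDomain J t) := by
  have hnonneg : ∀ p ∈ chainDomain J t, 0 ≤ p.1 := fun p hp =>
    (hzero ▸ monotoneOn_Iic_succ_of_le_succ hle (Nat.zero_le _) (hp.1.trans (Nat.le_succ J))
      (Nat.zero_le p.2)).trans hp.2.1
  refine ⟨hnonneg, ?_⟩
  rintro ⟨T, K⟩ hTK
  refine ⟨K + 1, Function.update t (K + 1) T, ?_, fun k hk => ?_, ?_⟩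
  · rwa [Function.update_of_ne (by omega)]
  · rw [Function.update_of_ne (by omega)]
    rcases (Nat.lt_succ_iff.mp hk).eq_or_lt with rfl | hlt
    · simpa only [Function.update_self] using hTK.2.1
    · rw [Function.update_of_ne (by omega)]
      exact hle k (hlt.le.trans hTK.1)
  · exact (chainDomain_inter_Icc_prod_Iic hzero hle hTK).trans
      (Set.ext fun p => and_congr_left' Nat.lt_succ_iff.symm)

theorem IsHybridTimeDomain.exists_chainDomain_subset {D : Set (ℝ × ℕ)} (hD : IsHybridTimeDomain D)
    {T : ℝ} {J : ℕ} (hT : (T, J) ∈ D) :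
    ∃ t, t 0 = 0 ∧ (∀ k ≤ J, t k ≤ t (k + 1)) ∧ t (J + 1) = T ∧ chainDomain J t ⊆ D := by
  obtain ⟨N, t, hzero, hle, hE⟩ := hD.2 _ hT
  have hmem : ∀ s k, ((s, k) ∈ D ∧ s ∈ Icc 0 T ∧ k ≤ J) ↔ (k < N ∧ s ∈ Icc (t k) (t (k + 1))) :=
    fun s k => Set.ext_iff.mp hE (s, k)
  have hTmem := (hmem T J).mp ⟨hT, ⟨hD.1 _ hT, le_rfl⟩, le_rfl⟩
  obtain rfl : N = J + 1 := by
    refine le_antisymm (not_lt.mp fun hlt => ?_) hTmem.1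
    have := ((hmem (t (J + 1)) (J + 1)).mpr ⟨hlt, left_mem_Icc.mpr (hle _ hlt)⟩).2.2
    omega
  have hlast := (hmem (t (J + 1)) J).mpr ⟨J.lt_succ_self, right_mem_Icc.mpr (hle J J.lt_succ_self)⟩
  exact ⟨t, hzero, fun k hk => hle k (by omega), hlast.2.1.2.antisymm hTmem.2.2,
    fun p hp => ((hmem p.1 p.2).mpr ⟨Nat.lt_succ_of_le hp.1, hp.2⟩).1⟩

section

variable {E : Type*} [NormedAddCommGroup E] [NormedSpace ℝ E]

namespace HybridSystem

/-- `x` solves the flow part of `H` on `[a, b]`; there is no condition on a degenerate interval. -/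
def IsFlowSegment (H : HybridSystem E) (x : ℝ → E) (a b : ℝ) : Prop :=
  a < b → AbsolutelyContinuousOnInterval x a b ∧ (∀ t ∈ Icc a b, x t ∈ H.C) ∧
    ∀ᵐ t : ℝ, t ∈ Icc a b → ∃ v ∈ H.F (x t), HasDerivWithinAt x v (Icc a b) t

/-- A solution on the compact hybrid time domain `chainDomain J t`, where `x k` is the curve
followed on the `k`-th interval. It can be cut and shifted without proofs about `HybridArc.dom`. -/
structure IsChain (H : HybridSystem E) (J : ℕ) (t : ℕ → ℝ) (x : ℕ → ℝ → E) : Prop where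
  zero : t 0 = 0
  start : x 0 0 ∈ H.C ∪ H.D
  le : ∀ k ≤ J, t k ≤ t (k + 1)
  flow : ∀ k ≤ J, H.IsFlowSegment (x k) (t k) (t (k + 1))
  jump : ∀ k < J, x k (t (k + 1)) ∈ H.D ∧ x (k + 1) (t (k + 1)) ∈ H.G (x k (t (k + 1)))

variable {H : HybridSystem E}

namespace IsFlowSegment

variable {x : ℝ → E} {a b c d : ℝ}

theorem mono (h : H.IsFlowSegment x a b) (hac : a ≤ c) (hdb : d ≤ b) :
    H.IsFlowSegment x c d := by
  intro hcd
  have hab : a < b := hac.trans_lt (hcd.trans_le hdb)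
  obtain ⟨habs, hC, hF⟩ := h hab
  have hsub : Icc c d ⊆ Icc a b := Icc_subset_Icc hac hdb
  refine ⟨habs.mono (by rwa [uIcc_of_le hcd.le, uIcc_of_le hab.le]), fun t ht => hC t (hsub ht), ?_⟩
  filter_upwards [hF] with t ht htcd
  obtain ⟨v, hv, hd⟩ := ht (hsub htcd)
  exact ⟨v, hv, hd.mono hsub⟩

theorem comp_add_right (h : H.IsFlowSegment x (a + c) (b + c)) :
    H.IsFlowSegment (fun t => x (t + c)) a b := by
  intro hab
  obtain ⟨habs, hC, hF⟩ := h (by linarith)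
  have hmaps : MapsTo (· + c) (Icc a b) (Icc (a + c) (b + c)) :=
    fun r hr => ⟨by simpa using hr.1, by simpa using hr.2⟩
  refine ⟨absolutelyContinuousOnInterval_comp_add_right habs, fun t ht => hC _ (hmaps ht), ?_⟩
  have hF' := (measurePreserving_add_right volume c).quasiMeasurePreserving.ae hF
  filter_upwards [hF'] with t ht htab
  obtain ⟨v, hv, hd⟩ := ht (hmaps htab)
  refine ⟨v, hv, ?_⟩
  simpa [Function.comp_def] using
    HasDerivWithinAt.scomp t hd ((hasDerivWithinAt_id t (Icc a b)).add_const c) hmaps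

theorem continuousOn (h : H.IsFlowSegment x a b) : ContinuousOn x (Icc a b) := by
  rcases lt_or_ge a b with hab | hab
  · simpa only [uIcc_of_le hab.le] using (h hab).1.continuousOn
  · exact (subsingleton_Icc_of_ge hab).continuousOn x

end IsFlowSegment

theorem IsSolution.exists_isChain {y : HybridArc E} (hy : H.IsSolution y) {T : ℝ} {J : ℕ}
    (hT : (T, J) ∈ y.dom) : ∃ t, H.IsChain J t (fun k s => y.val s k) ∧ t (J + 1) = T := by
  obtain ⟨t, hzero, hle, hlast, hdom⟩ := y.isHybridTimeDomain.exists_chainDomain_subset hT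
  have hsub : ∀ k ≤ J, Icc (t k) (t (k + 1)) ⊆ y.flowInterval k := fun k hk s hs => hdom ⟨hk, hs⟩
  refine ⟨t, ⟨hzero, hy.1, hle, fun k hk hlt => ?_, fun k hk => ?_⟩, hlast⟩
  · have hint : (interior (y.flowInterval k)).Nonempty :=
      (nonempty_Ioo.mpr hlt).mono (interior_Icc (a := t k) ▸ interior_mono (hsub k hk))
    refine ⟨y.locallyAbsolutelyContinuous k hint _ _ hlt.le (hsub k hk),
      fun s hs => (hy.2.1 k hint).1 s (hsub k hk hs), ?_⟩
    filter_upwards [(hy.2.1 k hint).2] with s hs hsk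
    obtain ⟨v, hv, hd⟩ := hs (hsub k hk hsk)
    exact ⟨v, hv, hd.mono (hsub k hk)⟩
  · exact hy.2.2 _ k (hsub k hk.le (right_mem_Icc.mpr (hle k hk.le)))
      (hsub (k + 1) hk (left_mem_Icc.mpr (hle (k + 1) hk)))

namespace IsChain

variable {J k : ℕ} {t : ℕ → ℝ} {x : ℕ → ℝ → E} {s c : ℝ}

theorem lt_of_nonempty_interior
    (hint : (interior {s | (s, k) ∈ chainDomain J t}).Nonempty) : k ≤ J ∧ t k < t (k + 1) := by
  obtain ⟨s, hs⟩ := hint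
  have hsub : {s | (s, k) ∈ chainDomain J t} ⊆ Icc (t k) (t (k + 1)) := fun r hr => hr.2
  have hIoo := interior_mono hsub hs
  rw [interior_Icc] at hIoo
  exact ⟨(interior_subset hs).1, hIoo.1.trans hIoo.2⟩

/-- The hybrid arc on `chainDomain J t` that the chain describes. -/
def toHybridArc (h : H.IsChain J t x) : HybridArc E where
  dom := chainDomain J t
  dom_nonempty := ⟨(t 0, 0), Nat.zero_le _, le_rfl, h.le 0 (Nat.zero_le _)⟩
  isHybridTimeDomain := isHybridTimeDomain_chainDomain h.zero h.le
  val s k := x k s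
  locallyAbsolutelyContinuous k hint a b hab hsub := by
    obtain ⟨hkJ, hlt⟩ := lt_of_nonempty_interior hint
    refine (h.flow k hkJ hlt).1.mono ?_
    rw [uIcc_of_le hab, uIcc_of_le hlt.le]
    exact fun s hs => (hsub hs).2

theorem isSolution_toHybridArc (h : H.IsChain J t x) : H.IsSolution h.toHybridArc := by
  refine ⟨h.start, fun k hint => ?_, ?_⟩
  · obtain ⟨hkJ, hlt⟩ := lt_of_nonempty_interior hint
    obtain ⟨-, hC, hF⟩ := h.flow k hkJ hlt
    refine ⟨fun s hs => hC s hs.2, ?_⟩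
    filter_upwards [hF] with s hs hsk
    obtain ⟨v, hv, hd⟩ := hs hsk.2
    exact ⟨v, hv, hd.mono fun r hr => hr.2⟩
  · intro s k hs hs'
    obtain rfl : s = t (k + 1) := le_antisymm hs.2.2 hs'.2.1
    exact h.jump k hs'.1

theorem end_nonneg (h : H.IsChain J t x) : 0 ≤ t (J + 1) :=
  h.zero ▸ monotoneOn_Iic_succ_of_le_succ h.le (Nat.zero_le _) self_mem_Iic (Nat.zero_le (J + 1))

theorem take (h : H.IsChain J t x) (hk : k ≤ J) (hs : s ∈ Icc (t k) (t (k + 1))) :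
    H.IsChain k (Function.update t (k + 1) s) x where
  zero := by simpa using h.zero
  start := h.start
  le i hi := by
    rw [Function.update_of_ne (by omega)]
    rcases hi.eq_or_lt with rfl | hlt
    · simpa using hs.1
    · rw [Function.update_of_ne (by omega)]
      exact h.le i (by omega)
  flow i hi := by
    rw [Function.update_of_ne (by omega)]
    rcases hi.eq_or_lt with rfl | hlt
    · simpa using (h.flow i hk).mono le_rfl hs.2
    · rw [Function.update_of_ne (by omega)]
      exact h.flow i (by omega)
  jump i hi := by
    rw [Function.update_of_ne (by omega)]
    exact h.jump i (by omega)

/-- The switching times of a chain after its time `s` on the `k`-th interval, counted from `s`. -/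
def dropTimes (t : ℕ → ℝ) (k : ℕ) (s : ℝ) : ℕ → ℝ
  | 0 => 0
  | i + 1 => t (i + k + 1) - s

theorem drop (h : H.IsChain J t x) (hk : k ≤ J) (hs : s ∈ Icc (t k) (t (k + 1)))
    (hlt : s < t (k + 1) ∨ k < J) :
    H.IsChain (J - k) (dropTimes t k s) (fun i r => x (i + k) (r + s)) where
  zero := rfl
  start := by
    simp only [zero_add]
    rcases hs.2.lt_or_eq with hs' | rfl
    · exact Or.inl ((h.flow k hk (hs.1.trans_lt hs')).2.1 s hs)
    · exact Or.inr (h.jump k (hlt.resolve_left (lt_irrefl _))).1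
  le i hi := by
    cases i with
    | zero => simpa [dropTimes] using hs.2
    | succ i => simpa [dropTimes, Nat.add_right_comm] using h.le (i + k + 1) (by omega)
  flow i hi := by
    apply IsFlowSegment.comp_add_right
    cases i with
    | zero => simpa [dropTimes] using (h.flow k hk).mono hs.1 le_rfl
    | succ i => simpa [dropTimes, Nat.add_right_comm] using h.flow (i + k + 1) (by omega)
  jump i hi := by
    simpa [dropTimes, Nat.add_right_comm] using h.jump (i + k) (by omega)

theorem exists_add_mem_Icc (h : H.IsChain J t x) (hc : 0 ≤ c) (hcJ : c ≤ t (J + 1) + J) :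
    ∃ k ≤ J, ∃ s ∈ Icc (t k) (t (k + 1)), s + k ∈ Icc c (c + 1) := by
  classical
  -- `k` is the first piece at whose end hybrid time has reached `c`.
  have hex : ∃ k, c ≤ t (k + 1) + k := ⟨J, hcJ⟩
  obtain ⟨k, hk, hmin⟩ : ∃ k, c ≤ t (k + 1) + k ∧ ∀ m < k, t (m + 1) + m < c :=
    ⟨Nat.find hex, Nat.find_spec hex, fun m hm => not_le.mp (Nat.find_min hex hm)⟩
  have hkJ : k ≤ J := not_lt.mp fun hlt => (hmin J hlt).not_ge hcJ
  refine ⟨k, hkJ, max (t k) (c - k), ⟨le_max_left _ _, max_le (h.le k hkJ) (by linarith)⟩, ?_⟩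
  rw [max_add, sub_add_cancel]
  refine ⟨le_max_right _ _, max_le ?_ (by linarith)⟩
  cases k with
  | zero => simpa [h.zero] using by linarith
  | succ m => push_cast; linarith [hmin m m.lt_succ_self]

end IsChain

/-- `H.Reaches p T q` says that some solution of `H` starting at `p` is at `q` when its hybrid time,
the sum of flow time and number of jumps, is `T`. -/
def Reaches (H : HybridSystem E) (p : E) (T : ℝ) (q : E) : Prop :=
  ∃ J t x, H.IsChain J t x ∧ x 0 0 = p ∧ x J (t (J + 1)) = q ∧ t (J + 1) + J = T

theorem IsSolution.reaches {y : HybridArc E} (hy : H.IsSolution y) {T : ℝ} {J : ℕ}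
    (hT : (T, J) ∈ y.dom) : H.Reaches (y.val 0 0) (T + J) (y.val T J) := by
  obtain ⟨t, ht, rfl⟩ := hy.exists_isChain hT
  exact ⟨J, t, _, ht, rfl, rfl, rfl⟩

namespace Reaches

variable {p q : E} {T c : ℝ}

theorem exists_isSolution (h : H.Reaches p T q) :
    ∃ y : HybridArc E, H.IsSolution y ∧ y.val 0 0 = p ∧
      ∃ t j, (t, j) ∈ y.dom ∧ y.val t j = q ∧ t + j = T := by
  obtain ⟨J, t, x, h, rfl, rfl, rfl⟩ := h
  exact ⟨h.toHybridArc, h.isSolution_toHybridArc, rfl, t (J + 1), J,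
    ⟨le_rfl, h.le J le_rfl, le_rfl⟩, rfl, rfl⟩

theorem nonneg (h : H.Reaches p T q) : 0 ≤ T := by
  obtain ⟨J, t, x, h, -, -, rfl⟩ := h
  exact add_nonneg h.end_nonneg J.cast_nonneg

theorem exists_split (h : H.Reaches p T q) (hc : 0 ≤ c) (hcT : c + 1 < T) :
    ∃ r, ∃ T₁ ∈ Icc c (c + 1), H.Reaches p T₁ r ∧ H.Reaches r (T - T₁) q := by
  obtain ⟨J, t, x, h, rfl, rfl, rfl⟩ := h
  obtain ⟨k, hk, s, hs, hsk⟩ := h.exists_add_mem_Icc hc (by linarith)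
  have hlt : s < t (k + 1) ∨ k < J := by
    by_contra! hcon
    obtain rfl : k = J := le_antisymm hk hcon.2
    linarith [hsk.2, hcon.1]
  refine ⟨x k s, s + k, hsk, ⟨k, _, x, h.take hk hs, rfl, by simp, by simp⟩,
    J - k, _, _, h.drop hk hs hlt, by simp, ?_, ?_⟩
  · simp [IsChain.dropTimes, Nat.sub_add_cancel hk]
  · simp only [IsChain.dropTimes, Nat.sub_add_cancel hk, Nat.cast_sub hk]
    ring

end Reaches

end HybridSystem

end

/-! ### From limits of solutions to practical stability -/

theorem forall_mem_Icc_update {k : ℕ} {t : ℕ → ℝ} {s : ℝ} {P : ℕ → ℝ → Prop}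
    (hs : s ∈ Icc (t k) (t (k + 1))) (hlast : P k s)
    (hbefore : ∀ k' ≤ k, ∀ s' ∈ Icc (t k') (t (k' + 1)), k' < k ∨ s' < s → P k' s') :
    ∀ k' ≤ k, ∀ s' ∈ Icc (Function.update t (k + 1) s k') (Function.update t (k + 1) s (k' + 1)),
      P k' s' := by
  intro k' hk' s' hs'
  rw [Function.update_of_ne (by omega)] at hs'
  rcases hk'.eq_or_lt with rfl | hlt
  · rw [Function.update_self] at hs'
    rcases hs'.2.eq_or_lt with rfl | hlt
    · exact hlast
    · exact hbefore _ le_rfl _ ⟨hs'.1, hs'.2.trans hs.2⟩ (Or.inr hlt)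
  · rw [Function.update_of_ne (by omega)] at hs'
    exact hbefore _ hk' _ hs' (Or.inl hlt)

namespace HybridSystem

variable {E : Type*} [NormedAddCommGroup E] [NormedSpace ℝ E] {H : HybridSystem E}

theorem IsChain.add_le_length {J k : ℕ} {t : ℕ → ℝ} {x : ℕ → ℝ → E} {s : ℝ}
    (h : H.IsChain J t x) (hk : k ≤ J) (hs : s ∈ Icc (t k) (t (k + 1))) :
    s + k ≤ t (J + 1) + J :=
  add_le_add (hs.2.trans (monotoneOn_Iic_succ_of_le_succ h.le (Nat.succ_le_succ hk) self_mem_Iic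
    (Nat.succ_le_succ hk))) (Nat.cast_le.mpr hk)

theorem IsChain.exists_first_notMem {J : ℕ} {t : ℕ → ℝ} {x : ℕ → ℝ → E} (h : H.IsChain J t x)
    {O : Set E} (hO : IsOpen O) (hn : x J (t (J + 1)) ∉ O) :
    ∃ k ≤ J, ∃ s ∈ Icc (t k) (t (k + 1)), x k s ∉ O ∧
      ∀ k' ≤ k, ∀ s' ∈ Icc (t k') (t (k' + 1)), k' < k ∨ s' < s → x k' s' ∈ O := by
  classical
  have hex : ∃ k, k ≤ J ∧ ∃ s ∈ Icc (t k) (t (k + 1)), x k s ∉ O :=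
    ⟨J, le_rfl, t (J + 1), ⟨h.le J le_rfl, le_rfl⟩, hn⟩
  obtain ⟨k, ⟨hkJ, s₀, hs₀, hs₀n⟩, hmin⟩ : ∃ k, (k ≤ J ∧ ∃ s ∈ Icc (t k) (t (k + 1)), x k s ∉ O) ∧
      ∀ m < k, ¬ (m ≤ J ∧ ∃ s ∈ Icc (t m) (t (m + 1)), x m s ∉ O) :=
    ⟨Nat.find hex, Nat.find_spec hex, fun _ => Nat.find_min hex⟩
  have hcpt : IsCompact (Icc (t k) (t (k + 1)) ∩ x k ⁻¹' Oᶜ) :=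
    isCompact_Icc.of_isClosed_subset ((h.flow k hkJ).continuousOn.preimage_isClosed_of_isClosed
      isClosed_Icc hO.isClosed_compl) inter_subset_left
  obtain ⟨s, hs, hleast⟩ := hcpt.exists_isLeast ⟨s₀, hs₀, hs₀n⟩
  refine ⟨k, hkJ, s, hs.1, hs.2, fun k' hk' s' hs' hbefore => ?_⟩
  by_contra hbad
  rcases hk'.eq_or_lt with rfl | hlt
  · exact (hbefore.resolve_left (lt_irrefl _)).not_ge (hleast ⟨hs', hbad⟩)
  · exact hmin k' hlt ⟨by omega, s', hs', hbad⟩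

theorem IsChain.mem_closure_or_eq_or_exists_jump {J k : ℕ} {t : ℕ → ℝ} {x : ℕ → ℝ → E} {s : ℝ}
    (h : H.IsChain J t x) (hk : k ≤ J) (hs : s ∈ Icc (t k) (t (k + 1))) {O : Set E}
    (hmem : ∀ k' ≤ k, ∀ s' ∈ Icc (t k') (t (k' + 1)), k' < k ∨ s' < s → x k' s' ∈ O) :
    x k s ∈ closure O ∨ x k s = x 0 0 ∨ ∃ p ∈ O ∩ H.D, x k s ∈ H.G p := by
  rcases hs.1.lt_or_eq with hlt | rfl
  · left
    have hcont : ContinuousWithinAt (x k) (Ico (t k) s) s :=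
      ((h.flow k hk).continuousOn s hs).mono fun r hr => ⟨hr.1, hr.2.le.trans hs.2⟩
    refine hcont.mem_closure (by rw [closure_Ico hlt.ne]; exact right_mem_Icc.mpr hlt.le)
      fun r hr => hmem k le_rfl r ⟨hr.1, hr.2.le.trans hs.2⟩ (Or.inr hr.2)
  · right
    cases k with
    | zero => exact Or.inl (by rw [h.zero])
    | succ m =>
      obtain ⟨hD, hG⟩ := h.jump m hk
      exact Or.inr ⟨_, ⟨hmem m m.le_succ _ (right_mem_Icc.mpr (h.le m (by omega)))
        (Or.inl m.lt_succ_self), hD⟩, hG⟩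

/-- A set that is reached again and again traps the solutions starting in it as closely as it does
over the first two return times. -/
theorem Reaches.mem_of_forall_return {N M : Set E} {T : ℝ} (hT : 1 ≤ T)
    (hreturn : ∀ p ∈ N, ∀ S ∈ Icc T (T + 1), ∀ q, H.Reaches p S q → q ∈ N)
    (hnear : ∀ p ∈ N, ∀ S ≤ 2 * T, ∀ q, H.Reaches p S q → q ∈ M) {p q : E} {S : ℝ}
    (h : H.Reaches p S q) (hp : p ∈ N) : q ∈ M := by
  obtain ⟨n, hn⟩ := exists_nat_ge S
  replace hn : S ≤ n * T := hn.trans (le_mul_of_one_le_right n.cast_nonneg hT)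
  induction n generalizing p S with
  | zero => exact hnear p hp S (hn.trans (by norm_num; linarith)) q h
  | succ n ih =>
    rcases le_or_gt S (2 * T) with hle | hgt
    · exact hnear p hp S hle q h
    · obtain ⟨r, T₁, hT₁, hpr, hrq⟩ := h.exists_split (c := T) (by linarith) (by linarith)
      refine ih hrq (hreturn p hp T₁ hT₁ r hpr) ?_
      push_cast at hn
      linarith [hT₁.1]

end HybridSystem

theorem exists_eventually_eq_of_le_ultrafilter {ι : Type*} (U : Ultrafilter ι) {J : ι → ℕ} {N : ℕ}
    (h : ∀ i, J i ≤ N) : ∃ j, ∀ᶠ i in (U : Filter ι), J i = j := by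
  obtain ⟨j, -, hj⟩ := (finite_Iic N).isCompact.ultrafilter_le_nhds (U.map J)
    (le_principal_iff.mpr (Filter.mem_map.mpr (univ_mem' h)))
  rw [nhds_discrete, Ultrafilter.coe_map, le_pure_iff] at hj
  exact ⟨j, hj⟩

section

variable {E P : Type*} [NormedAddCommGroup E] [NormedSpace ℝ E]
    [NormedAddCommGroup P] [NormedSpace ℝ P]

/-- Bounded solutions of `H ε` on compact time domains converge, as `ε → 0`, to solutions of `H₀`.
Convergence is expressed along ultrafilters. -/
def HasChainLimits (H : ℝ → HybridSystem (E × P)) (H₀ : HybridSystem E) : Prop :=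
  ∀ (U : Ultrafilter ℕ) (ε : ℕ → ℝ) (J : ℕ) (t : ℕ → ℕ → ℝ) (x : ℕ → ℕ → ℝ → E × P) (T ρ : ℝ),
    (∀ i, 0 < ε i) → Tendsto ε U (𝓝 0) →
    (∀ᶠ i in (U : Filter ℕ), (H (ε i)).IsChain J (t i) (x i) ∧ t i (J + 1) ≤ T ∧
      ∀ k ≤ J, ∀ s ∈ Icc (t i k) (t i (k + 1)), ‖(x i k s).1‖ ≤ ρ) →
    ∃ (t' : ℕ → ℝ) (x' : ℕ → ℝ → E), H₀.IsChain J t' x' ∧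
      Tendsto (fun i => t i (J + 1)) U (𝓝 (t' (J + 1))) ∧
      Tendsto (fun i => (x i 0 0).1) U (𝓝 (x' 0 0)) ∧
      Tendsto (fun i => (x i J (t i (J + 1))).1) U (𝓝 (x' J (t' (J + 1))))

/-- The jump maps of the systems `H ε` send bounded subsets of `E` to bounded subsets of `E`,
uniformly in `ε`. -/
def HasBoundedJumps (H : ℝ → HybridSystem (E × P)) : Prop :=
  ∀ ρ, ∃ ρ', ∀ ε p q, p ∈ (H ε).D → ‖p.1‖ ≤ ρ → q ∈ (H ε).G p → ‖q.1‖ ≤ ρ'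

variable {H : ℝ → HybridSystem (E × P)} {H₀ : HybridSystem E}

theorem HasBoundedJumps.exists_take_notMem (hjump : HasBoundedJumps H) {K O : Set E}
    (hK : Bornology.IsBounded K) (hO : IsOpen O) (hOb : Bornology.IsBounded O) :
    ∃ ρ, ∀ ε J t x, (H ε).IsChain J t x → (x 0 0).1 ∈ K → (x J (t (J + 1))).1 ∉ O →
      ∃ k ≤ J, ∃ s ∈ Icc (t k) (t (k + 1)), (x k s).1 ∉ O ∧ ∀ k' ≤ k,
        ∀ s' ∈ Icc (Function.update t (k + 1) s k') (Function.update t (k + 1) s (k' + 1)),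
          ‖(x k' s').1‖ ≤ ρ := by
  obtain ⟨c₁, hc₁⟩ := hOb.exists_norm_le
  obtain ⟨c₂, hc₂⟩ := hK.exists_norm_le
  obtain ⟨c₃, hc₃⟩ := hjump c₁
  refine ⟨max c₁ (max c₂ c₃), fun ε J t x h hx0 hn => ?_⟩
  obtain ⟨k, hk, s, hs, hsn, hfirst⟩ := h.exists_first_notMem (hO.preimage continuous_fst) hn
  refine ⟨k, hk, s, hs, hsn, forall_mem_Icc_update
    (P := fun k' s' => ‖(x k' s').1‖ ≤ max c₁ (max c₂ c₃)) hs ?_ fun k' hk' s' hs' hor =>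
      le_max_of_le_left (hc₁ _ (hfirst k' hk' s' hs' hor))⟩
  rcases h.mem_closure_or_eq_or_exists_jump hk hs hfirst with hcl | heq | ⟨p, ⟨hpO, hpD⟩, hpG⟩
  · exact le_max_of_le_left (closure_minimal (fun p hp => hc₁ p.1 hp)
      (isClosed_le continuous_fst.norm continuous_const) hcl)
  · exact heq ▸ le_max_of_le_right (le_max_of_le_left (hc₂ _ hx0))
  · exact le_max_of_le_right (le_max_of_le_right (hc₃ ε p _ hpD (hc₁ _ hpO) hpG))

namespace HasChainLimits

theorem exists_forall_isChain (hlim : HasChainLimits H H₀) {K : Set E} (hK : IsClosed K) {T : ℝ}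
    (ρ : ℝ) {Q : E → ℝ → E → Prop}
    (h₀ : ∀ p ∈ K, ∀ S ≤ T, ∀ q, H₀.Reaches p S q → ∀ᶠ r in 𝓝 (p, S, q), Q r.1 r.2.1 r.2.2) :
    ∃ ε₀ > 0, ∀ ε, 0 < ε → ε ≤ ε₀ → ∀ J t x, (H ε).IsChain J t x →
      (∀ k ≤ J, ∀ s ∈ Icc (t k) (t (k + 1)), ‖(x k s).1‖ ≤ ρ) → (x 0 0).1 ∈ K →
      t (J + 1) + J ≤ T → Q (x 0 0).1 (t (J + 1) + J) (x J (t (J + 1))).1 := by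
  by_contra! hcon
  have hpos : ∀ n : ℕ, 0 < 1 / ((n : ℝ) + 1) := fun n => by positivity
  choose ε hε hεn J t x hch hρ hx0 hT hQ using fun n => hcon _ (hpos n)
  have hε0 : Tendsto ε (hyperfilter ℕ : Filter ℕ) (𝓝 0) :=
    (squeeze_zero (fun i => (hε i).le) hεn tendsto_one_div_add_atTop_nhds_zero_nat).mono_left
      Nat.hyperfilter_le_atTop
  have htT : ∀ i, t i (J i + 1) ≤ T := fun i => by linarith [hT i, (J i).cast_nonneg (α := ℝ)]
  have hJT : ∀ i, J i ≤ ⌈T⌉₊ := fun i => by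
    have hJ : (J i : ℝ) ≤ T := by linarith [hT i, (hch i).end_nonneg]
    exact_mod_cast hJ.trans (Nat.le_ceil T)
  obtain ⟨j, hj⟩ := exists_eventually_eq_of_le_ultrafilter (hyperfilter ℕ) hJT
  obtain ⟨t', x', hch', ht', hx0', hend⟩ := hlim (hyperfilter ℕ) ε j t x T ρ hε hε0 (by
    filter_upwards [hj] with i hi
    exact hi ▸ ⟨hch i, htT i, hρ i⟩)
  have hlen : Tendsto (fun i => t i (j + 1) + j) (hyperfilter ℕ : Filter ℕ)
      (𝓝 (t' (j + 1) + j)) := ht'.add_const _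
  have hT' : t' (j + 1) + j ≤ T := le_of_tendsto hlen (hj.mono fun i hi => hi ▸ hT i)
  have hK' : x' 0 0 ∈ K := hK.mem_of_tendsto hx0' (.of_forall hx0)
  have hQ' := (hx0'.prodMk_nhds (hlen.prodMk_nhds hend)).eventually
    (h₀ _ hK' _ hT' _ ⟨j, t', x', hch', rfl, rfl, rfl⟩)
  obtain ⟨i, hi, rfl⟩ := (hQ'.and hj).exists
  exact hQ i hi

theorem exists_forall_reaches (hlim : HasChainLimits H H₀) (hjump : HasBoundedJumps H)
    {K O : Set E} (hK : IsCompact K) (hO : IsOpen O) (hOb : Bornology.IsBounded O) {T : ℝ}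
    {Q : E → ℝ → E → Prop} (hmem : ∀ p ∈ K, ∀ S ≤ T, ∀ q, H₀.Reaches p S q → q ∈ O)
    (hQ : ∀ p ∈ K, ∀ S ≤ T, ∀ q, H₀.Reaches p S q → ∀ᶠ r in 𝓝 (p, S, q), Q r.1 r.2.1 r.2.2) :
    ∃ ε₀ > 0, ∀ ε, 0 < ε → ε ≤ ε₀ → ∀ p S q, (H ε).Reaches p S q → p.1 ∈ K → S ≤ T →
      q.1 ∈ O ∧ Q p.1 S q.1 := by
  obtain ⟨c, hc⟩ := hOb.exists_norm_le
  obtain ⟨ρ, hρ⟩ := hjump.exists_take_notMem hK.isBounded hO hOb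
  obtain ⟨ε₀, hε₀, hfin⟩ := hlim.exists_forall_isChain hK.isClosed (max c ρ)
    (Q := fun p S q => q ∈ O ∧ Q p S q) fun p hp S hS q h => by
      have hend : Tendsto (fun r : E × ℝ × E => r.2.2) (𝓝 (p, S, q)) (𝓝 q) :=
        (continuous_snd.comp continuous_snd).tendsto (p, S, q)
      exact (hend.eventually (hO.mem_nhds (hmem p hp S hS q h))).and (hQ p hp S hS q h)
  refine ⟨ε₀, hε₀, ?_⟩
  rintro ε hε hεε _ _ _ ⟨J, t, x, h, rfl, rfl, rfl⟩ hp hS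
  have hin : ∀ k ≤ J, ∀ s ∈ Icc (t k) (t (k + 1)), (x k s).1 ∈ O := by
    intro k hk s hs
    by_contra hn
    have htake := h.take hk hs
    obtain ⟨m, hm, r, hr, hrn, hbound⟩ := hρ ε _ _ _ htake hp (by simpa using hn)
    have hlen := (htake.add_le_length hm hr).trans
      (by simpa using (h.add_le_length hk hs).trans hS)
    refine hrn ?_
    simpa using (hfin ε hε hεε _ _ _ (htake.take hm hr)
      (fun k' hk' s' hs' => le_max_of_le_right (hbound k' hk' s' hs')) hp (by simpa using hlen)).1
  exact hfin ε hε hεε J t x h (fun k hk s hs => le_max_of_le_left (hc _ (hin k hk s hs))) hp hS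

end HasChainLimits

end

namespace IsProperIndicator

variable {E : Type*} [NormedAddCommGroup E] {A B : Set E} {ω : E → ℝ}

theorem isBounded_sublevel (hω : IsProperIndicator A B ω) (c : ℝ) :
    Bornology.IsBounded {x ∈ B | ω x ≤ c} := by
  by_contra hunbounded
  have hlarge : ∀ n : ℕ, ∃ x ∈ {x ∈ B | ω x ≤ c}, (n : ℝ) < ‖x‖ := by
    intro n
    by_contra! hcon
    exact hunbounded (isBounded_iff_forall_norm_le.mpr ⟨n, hcon⟩)
  choose u hu hun using hlarge
  refine hω.2.2.2 u (fun i => (hu i).1) (Or.inr fun hb => ?_) ⟨c, ?_⟩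
  · obtain ⟨C, hC⟩ := hb.exists_norm_le
    obtain ⟨n, hn⟩ := exists_nat_gt C
    linarith [hun n, hC (u n) (mem_range_self n)]
  · rintro _ ⟨i, rfl⟩
    exact (hu i).2

theorem isClosed_sublevel (hω : IsProperIndicator A B ω) (hB : IsOpen B) (c : ℝ) :
    IsClosed {x ∈ B | ω x ≤ c} := by
  refine IsSeqClosed.isClosed fun u p hu hp => ?_
  have hpB : p ∈ B := by
    by_contra hpB
    have hfrontier : p ∈ frontier B := by
      rw [hB.frontier_eq]
      exact ⟨mem_closure_of_tendsto hp (.of_forall fun i => (hu i).1), hpB⟩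
    refine hω.2.2.2 u (fun i => (hu i).1) (Or.inl ?_) ⟨c, ?_⟩
    · exact tendsto_of_tendsto_of_tendsto_of_le_of_le tendsto_const_nhds
        (tendsto_iff_edist_tendsto_0.mp hp) (fun _ => zero_le) fun i =>
        Metric.infEDist_le_edist_of_mem hfrontier
    · rintro _ ⟨i, rfl⟩
      exact (hu i).2
  exact ⟨hpB, le_of_tendsto (((hω.1.continuousAt (hB.mem_nhds hpB)).tendsto).comp hp)
    (.of_forall fun i => (hu i).2)⟩

theorem isCompact_sublevel [ProperSpace E] (hω : IsProperIndicator A B ω) (hB : IsOpen B) (c : ℝ) :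
    IsCompact {x ∈ B | ω x ≤ c} :=
  Metric.isCompact_of_isClosed_isBounded (hω.isClosed_sublevel hB c) (hω.isBounded_sublevel c)

end IsProperIndicator

namespace IsClassKL

variable {β : ℝ → ℝ → ℝ}

theorem eq_zero_of_left_eq_zero (hβ : IsClassKL β) {s : ℝ} (hs : 0 ≤ s) : β 0 s = 0 :=
  (ge_of_tendsto (hβ.2.2.2.1 s hs) (eventually_mem_nhdsWithin.mono
    fun _ hr => hβ.2.1 0 _ s le_rfl (le_of_lt hr) hs)).antisymm (hβ.1 0 s le_rfl hs)

theorem comp_two_mul_max_sub_one (hβ : IsClassKL β) :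
    IsClassKL fun r s => β (2 * r) (max (s - 1) 0) := by
  refine ⟨fun r s hr _ => hβ.1 _ _ (by linarith) (le_max_right _ _),
    fun r r' s hr hrr _ => hβ.2.1 _ _ _ (by linarith) (by linarith) (le_max_right _ _),
    fun r s s' hr _ hss => hβ.2.2.1 _ _ _ (by linarith) (le_max_right _ _)
      (max_le_max (by linarith) le_rfl), fun s _ => ?_, fun r hr => ?_⟩
  · refine (hβ.2.2.2.1 _ (le_max_right _ _)).comp (tendsto_nhdsWithin_iff.mpr ⟨?_, ?_⟩)
    · exact ((continuous_const_mul (2 : ℝ)).tendsto' 0 0 (mul_zero 2)).mono_left nhdsWithin_le_nhds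
    · filter_upwards [self_mem_nhdsWithin] with r hr
      simpa using hr
  · exact (hβ.2.2.2.2 (2 * r) (by linarith)).comp (tendsto_atTop_mono
      (fun s => le_max_left _ _) (tendsto_atTop_add_const_right _ (-1) tendsto_id))

/-- The factor `2` and the time shift by `1` compensate for `β` not being continuous. -/
theorem eventually_le_comp_two_mul_max_sub_one (hβ : IsClassKL β) {u s : ℝ} (hu : 0 ≤ u)
    (hs : 0 ≤ s) :
    ∀ᶠ r in 𝓝 (u, s), 0 ≤ r.1 → β u s ≤ β (2 * r.1) (max (r.2 - 1) 0) := by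
  rcases hu.eq_or_lt with rfl | hpos
  · refine .of_forall fun r hr => ?_
    rw [hβ.eq_zero_of_left_eq_zero hs]
    exact hβ.1 _ _ (by positivity) (le_max_right _ _)
  · filter_upwards [(continuous_fst.tendsto (u, s)).eventually (lt_mem_nhds (half_lt_self hpos)),
      (continuous_snd.tendsto (u, s)).eventually (gt_mem_nhds (lt_add_one s))] with r h₁ h₂ hr
    exact (hβ.2.1 u (2 * r.1) s hpos.le (by linarith) hs).trans
      (hβ.2.2.1 _ _ _ (by positivity) (le_max_right _ _) (max_le (by linarith) hs))

theorem exists_radius_time (hβ : IsClassKL β) {ν : ℝ} (hν : 0 < ν) (m : ℝ) :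
    ∃ η ∈ Ioc 0 ν, β η 0 ≤ ν / 2 ∧ ∃ T ≥ 1, β (max m η) T ≤ η / 2 := by
  have hradius := (hβ.2.2.2.1 0 le_rfl).eventually (gt_mem_nhds (half_pos hν))
  obtain ⟨η, hβη, hη⟩ := (hradius.and (Ioc_mem_nhdsGT hν)).exists
  have htime := (hβ.2.2.2.2 (max m η) (le_max_of_le_right hη.1.le)).eventually
    (gt_mem_nhds (half_pos hη.1))
  obtain ⟨T, hβT, hT⟩ := (htime.and (eventually_ge_atTop 1)).exists
  exact ⟨η, hη, le_of_lt hβη, T, hT, le_of_lt hβT⟩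

theorem le_left_zero (hβ : IsClassKL β) {u R s : ℝ} (hu : 0 ≤ u) (huR : u ≤ R) (hs : 0 ≤ s) :
    β u s ≤ β R 0 :=
  (hβ.2.1 u R s hu huR hs).trans (hβ.2.2.1 R 0 s (hu.trans huR) le_rfl hs)

end IsClassKL

section

variable {E P : Type*} [NormedAddCommGroup E] [NormedSpace ℝ E]
    [NormedAddCommGroup P] [NormedSpace ℝ P] {H : ℝ → HybridSystem (E × P)} {H₀ : HybridSystem E}
    {A B : Set E} {ω : E → ℝ} {β : ℝ → ℝ → ℝ}

theorem HybridSystem.IsUAS.exists_forall_reaches (h : H₀.IsUAS A B) (hω : IsProperIndicator A B ω) :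
    ∃ β, IsClassKL β ∧ ∀ p ∈ B, ∀ T q, H₀.Reaches p T q → q ∈ B ∧ ω q ≤ β (ω p) T := by
  obtain ⟨β, hβ, hsol⟩ := h.2.2.2 ω hω
  refine ⟨β, hβ, fun p hp T q hpq => ?_⟩
  obtain ⟨y, hy, rfl, t, j, hdom, rfl, rfl⟩ := hpq.exists_isSolution
  exact hsol y hy hp t j hdom

namespace HasChainLimits

theorem exists_forall_le [ProperSpace E] (hlim : HasChainLimits H H₀) (hjump : HasBoundedJumps H)
    (hB : IsOpen B) (hω : IsProperIndicator A B ω) (hβ : IsClassKL β)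
    (h₀ : ∀ p ∈ B, ∀ T q, H₀.Reaches p T q → q ∈ B ∧ ω q ≤ β (ω p) T) (R T : ℝ) {η : ℝ}
    (hη : 0 < η) :
    ∃ ε₀ > 0, ∀ ε, 0 < ε → ε ≤ ε₀ → ∀ p S q, (H ε).Reaches p S q → p.1 ∈ B → ω p.1 ≤ R → S ≤ T →
      q.1 ∈ B ∧ ω q.1 ≤ β (2 * ω p.1) (max (S - 1) 0) + η := by
  have hcont : ∀ p ∈ B, ContinuousAt ω p := fun p hp => hω.1.continuousAt (hB.mem_nhds hp)
  have hmem : ∀ p ∈ {x ∈ B | ω x ≤ R}, ∀ S ≤ T, ∀ q, H₀.Reaches p S q →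
      q ∈ B ∩ ω ⁻¹' Iio (β R 0 + 1) := fun p hp S _ q h => by
    obtain ⟨hqB, hq⟩ := h₀ p hp.1 S q h
    exact ⟨hqB, (hq.trans (hβ.le_left_zero (hω.2.1 p hp.1) hp.2 h.nonneg)).trans_lt (lt_add_one _)⟩
  have hnear : ∀ p ∈ {x ∈ B | ω x ≤ R}, ∀ S ≤ T, ∀ q, H₀.Reaches p S q → ∀ᶠ r in 𝓝 (p, S, q),
      ω r.2.2 ≤ β (2 * ω r.1) (max (r.2.1 - 1) 0) + η := fun p hp S _ q h => by
    obtain ⟨hqB, hq⟩ := h₀ p hp.1 S q h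
    have hstart : Tendsto (fun r : E × ℝ × E => r.1) (𝓝 (p, S, q)) (𝓝 p) := continuous_fst.tendsto _
    have htime : Tendsto (fun r : E × ℝ × E => r.2.1) (𝓝 (p, S, q)) (𝓝 S) :=
      (continuous_fst.comp continuous_snd).tendsto _
    have hend : Tendsto (fun r : E × ℝ × E => r.2.2) (𝓝 (p, S, q)) (𝓝 q) :=
      (continuous_snd.comp continuous_snd).tendsto _
    filter_upwards [hstart.eventually (hB.mem_nhds hp.1),
      (((hcont p hp.1).tendsto.comp hstart).prodMk_nhds htime).eventually
        (hβ.eventually_le_comp_two_mul_max_sub_one (hω.2.1 p hp.1) h.nonneg),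
      ((hcont q hqB).tendsto.comp hend).eventually (gt_mem_nhds (lt_add_of_pos_right (ω q) hη))]
      with r hrB hrβ hrω
    exact (le_of_lt hrω).trans (by gcongr; exact hq.trans (hrβ (hω.2.1 _ hrB)))
  obtain ⟨ε₀, hε₀, hfin⟩ := hlim.exists_forall_reaches hjump (hω.isCompact_sublevel hB R)
    (hω.1.isOpen_inter_preimage hB isOpen_Iio)
    ((hω.isBounded_sublevel (β R 0 + 1)).subset fun x hx => ⟨hx.1, le_of_lt hx.2⟩)
    (Q := fun p S q => ω q ≤ β (2 * ω p) (max (S - 1) 0) + η) hmem hnear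
  exact ⟨ε₀, hε₀, fun ε hε hεε p S q h hp hpR hS =>
    (hfin ε hε hεε p S q h ⟨hp, hpR⟩ hS).imp_left And.left⟩

theorem isSGPAS [ProperSpace E] (hlim : HasChainLimits H H₀) (hjump : HasBoundedJumps H)
    (hUAS : H₀.IsUAS A B) : IsSGPAS H A B := by
  obtain ⟨hA, hB, hAB, -⟩ := id hUAS
  refine ⟨hA, hB, hAB, fun ω hω => ?_⟩
  obtain ⟨β, hβ, h₀⟩ := hUAS.exists_forall_reaches hω
  have hγ := hβ.comp_two_mul_max_sub_one
  set γ : ℝ → ℝ → ℝ := fun r s => β (2 * r) (max (s - 1) 0)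
  refine ⟨γ, hγ, fun K hK hKB ν hν => ?_⟩
  obtain ⟨m, hm⟩ := (hK.image_of_continuousOn (hω.1.mono hKB)).bddAbove
  obtain ⟨η, ⟨hη, hην⟩, hγη, T, hT, hγT⟩ := hγ.exists_radius_time hν m
  obtain ⟨ε₀, hε₀, hfin⟩ := hlim.exists_forall_le hjump hB hω hβ h₀ (max m η) (2 * T) (half_pos hη)
  refine ⟨ε₀, hε₀, fun ε hε hεε y hy hyK t j hdom => ?_⟩
  have hreturn : ∀ p : E × P, p.1 ∈ B → ω p.1 ≤ max m η → ∀ S ∈ Icc T (T + 1), ∀ q,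
      (H ε).Reaches p S q → q.1 ∈ B ∧ ω q.1 ≤ η := fun p hpB hp S hS q h => by
    obtain ⟨hqB, hq⟩ := hfin ε hε hεε p S q h hpB hp (by linarith [hS.2])
    have hγS : γ (ω p.1) S ≤ γ (max m η) T :=
      (hγ.2.1 _ _ S (hω.2.1 _ hpB) hp (by linarith [hS.1])).trans
        (hγ.2.2.1 _ T S (le_max_of_le_right hη.le) (by linarith) hS.1)
    exact ⟨hqB, by linarith⟩
  have hnear : ∀ p : E × P, p.1 ∈ B ∧ ω p.1 ≤ η → ∀ S ≤ 2 * T, ∀ q,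
      (H ε).Reaches p S q → q.1 ∈ B ∧ ω q.1 ≤ ν := fun p hp S hS q h => by
    obtain ⟨hqB, hq⟩ := hfin ε hε hεε p S q h hp.1 (le_max_of_le_right hp.2) hS
    have hγS : γ (ω p.1) S ≤ γ η 0 := hγ.le_left_zero (hω.2.1 _ hp.1) hp.2 h.nonneg
    exact ⟨hqB, by linarith⟩
  have hyB := hKB hyK
  have hym : ω (y.val 0 0).1 ≤ max m η := le_max_of_le_left (hm (mem_image_of_mem ω hyK))
  have hreach := hy.reaches hdom
  rcases le_or_gt (t + j) (2 * T) with hle | hgt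
  · obtain ⟨hqB, hq⟩ := hfin ε hε hεε _ _ _ hreach hyB hym hle
    exact ⟨hqB, by linarith⟩
  · obtain ⟨r, S, hS, hyr, hrq⟩ := hreach.exists_split (c := T) (by linarith) (by linarith)
    obtain ⟨hqB, hq⟩ := hrq.mem_of_forall_return (N := {p : E × P | p.1 ∈ B ∧ ω p.1 ≤ η})
      (M := {p : E × P | p.1 ∈ B ∧ ω p.1 ≤ ν}) hT (fun p hp S hS q h =>
        hreturn p hp.1 (le_max_of_le_right hp.2) S hS q h) hnear (hreturn _ hyB hym S hS r hyr)
    exact ⟨hqB, hq.trans (le_add_of_nonneg_left (hγ.1 _ _ (hω.2.1 _ hyB) hreach.nonneg))⟩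

end HasChainLimits

end

/-! ### Doubly periodic fields -/

theorem exists_sub_zsmul_mem_Icc {T : ℝ} (hT : 0 < T) (a : ℝ) : ∃ n : ℤ, a - n • T ∈ Icc 0 T := by
  obtain ⟨n, hn, -⟩ := existsUnique_sub_zsmul_mem_Ico hT a 0
  exact ⟨n, Ico_subset_Icc_self (by simpa using hn)⟩

/-- A family of functions of two phases `a`, `b` which depends continuously on its parameter in `O`
and has period `T₁` in `a` and period `T₂` in `b`. -/
structure IsDoublyPeriodicOn {Θ Y : Type*} [TopologicalSpace Θ] [TopologicalSpace Y]
    (F : Θ → ℝ → ℝ → Y) (T₁ T₂ : ℝ) (O : Set Θ) : Prop where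
  continuousOn : ContinuousOn (fun p : Θ × (ℝ × ℝ) => F p.1 p.2.1 p.2.2) (O ×ˢ univ)
  periodic_left : ∀ θ ∈ O, ∀ b, Function.Periodic (fun a => F θ a b) T₁
  periodic_right : ∀ θ ∈ O, ∀ a, Function.Periodic (F θ a) T₂

namespace IsDoublyPeriodicOn

section

variable {Θ Y : Type*} [TopologicalSpace Θ] [TopologicalSpace Y] {F : Θ → ℝ → ℝ → Y} {T₁ T₂ : ℝ}
  {O : Set Θ}

theorem continuous_subtype (h : IsDoublyPeriodicOn F T₁ T₂ O) :
    Continuous fun q : (O × ℝ) × ℝ => F q.1.1 q.1.2 q.2 :=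
  h.continuousOn.comp_continuous (f := fun q : (O × ℝ) × ℝ => ((q.1.1 : Θ), (q.1.2, q.2)))
    (by fun_prop) fun q => ⟨q.1.1.2, mem_univ _⟩

theorem continuous_phases (h : IsDoublyPeriodicOn F T₁ T₂ O) {θ : Θ} (hθ : θ ∈ O) :
    Continuous fun τ : ℝ × ℝ => F θ τ.1 τ.2 :=
  h.continuous_subtype.comp (f := fun τ : ℝ × ℝ => (((⟨θ, hθ⟩ : O), τ.1), τ.2)) (by fun_prop)

theorem apply_sub_zsmul (h : IsDoublyPeriodicOn F T₁ T₂ O) {θ : Θ} (hθ : θ ∈ O) (m n : ℤ)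
    (a b : ℝ) : F θ (a - m • T₁) (b - n • T₂) = F θ a b :=
  ((h.periodic_left θ hθ _).sub_zsmul_eq m).trans ((h.periodic_right θ hθ a).sub_zsmul_eq n)

end

variable {Θ Y : Type*} [PseudoMetricSpace Θ] [NormedAddCommGroup Y] {F : Θ → ℝ → ℝ → Y}
  {T₁ T₂ : ℝ} {O K : Set Θ}

theorem exists_norm_le (h : IsDoublyPeriodicOn F T₁ T₂ O) (hT₁ : 0 < T₁) (hT₂ : 0 < T₂)
    (hK : IsCompact K) (hKO : K ⊆ O) : ∃ c, 0 ≤ c ∧ ∀ θ ∈ K, ∀ a b, ‖F θ a b‖ ≤ c := by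
  obtain ⟨c, hc⟩ := (hK.prod (isCompact_Icc.prod isCompact_Icc)).exists_bound_of_continuousOn
    (h.continuousOn.mono (prod_mono hKO (subset_univ (Icc 0 T₁ ×ˢ Icc 0 T₂))))
  refine ⟨max c 0, le_max_right _ _, fun θ hθ a b => le_max_of_le_left ?_⟩
  obtain ⟨m, hm⟩ := exists_sub_zsmul_mem_Icc hT₁ a
  obtain ⟨n, hn⟩ := exists_sub_zsmul_mem_Icc hT₂ b
  rw [← h.apply_sub_zsmul (hKO hθ) m n]
  exact hc (θ, (_, _)) ⟨hθ, hm, hn⟩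

theorem exists_norm_sub_lt (h : IsDoublyPeriodicOn F T₁ T₂ O) (hT₁ : 0 < T₁) (hT₂ : 0 < T₂)
    (hO : IsOpen O) (hK : IsCompact K) (hKO : K ⊆ O) {η : ℝ} (hη : 0 < η) :
    ∃ κ > 0, ∀ θ ∈ K, ∀ θ' ∈ O, ∀ a a' b, dist θ' θ < κ → |a' - a| < κ →
      ‖F θ' a' b - F θ a b‖ < η := by
  have hQ : IsCompact (K ×ˢ (Icc 0 T₁ ×ˢ Icc 0 T₂)) := hK.prod (isCompact_Icc.prod isCompact_Icc)
  have hunif := hQ.uniformContinuousAt_of_continuousAt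
    (fun p : Θ × (ℝ × ℝ) => F p.1 p.2.1 p.2.2)
    (fun p hp => h.continuousOn.continuousAt
      ((hO.prod isOpen_univ).mem_nhds ⟨hKO hp.1, mem_univ _⟩))
    (Metric.dist_mem_uniformity hη)
  obtain ⟨κ, hκ, hsub⟩ := Metric.mem_uniformity_dist.mp hunif
  refine ⟨κ, hκ, fun θ hθ θ' hθ' a a' b hd ha => ?_⟩
  obtain ⟨m, hm⟩ := exists_sub_zsmul_mem_Icc hT₁ a
  obtain ⟨n, hn⟩ := exists_sub_zsmul_mem_Icc hT₂ b
  rw [← h.apply_sub_zsmul hθ' m n, ← h.apply_sub_zsmul (hKO hθ) m n, ← dist_eq_norm, dist_comm]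
  refine hsub (a := (θ, (a - m • T₁, b - n • T₂))) (b := (θ', (a' - m • T₁, b - n • T₂))) ?_
    ⟨hθ, hm, hn⟩
  rw [dist_comm, Prod.dist_eq, Prod.dist_eq, dist_self, dist_sub_right, Real.dist_eq]
  exact max_lt hd (max_lt ha hκ)

end IsDoublyPeriodicOn

/-- The ingredients of a fast vector field `ε⁻¹ f₁ + f₂` with two periodic phases over an open
set `O`; `g` is the differential of `f₁` with respect to `x` and the first phase. -/
structure IsPeriodicField {V W : Type*} [NormedAddCommGroup V] [NormedSpace ℝ V]
    [NormedAddCommGroup W] (O : Set (V × W)) (T₁ T₂ : ℝ) (f₁ f₂ : V × W → ℝ → ℝ → V)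
    (g : V × W → ℝ → ℝ → (V × ℝ →L[ℝ] V)) : Prop where
  isOpen : IsOpen O
  T₁_pos : 0 < T₁
  T₂_pos : 0 < T₂
  periodic₁ : IsDoublyPeriodicOn f₁ T₁ T₂ O
  periodic₂ : IsDoublyPeriodicOn f₂ T₁ T₂ O
  continuousOn_deriv : ContinuousOn (fun p : (V × W) × (ℝ × ℝ) => g p.1 p.2.1 p.2.2) (O ×ˢ univ)
  hasFDerivAt : ∀ x z a b, (x, z) ∈ O →
    HasFDerivAt (fun q : V × ℝ => f₁ (q.1, z) q.2 b) (g (x, z) a b) (x, a)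
  lipschitz : ∀ θ ∈ O, ∀ a b, ∃ N ∈ 𝓝 (θ, (a, b)), ∃ L : ℝ, ∀ x z z' a b,
    ((x, z), (a, b)) ∈ N → ((x, z'), (a, b)) ∈ N →
      ‖f₁ (x, z) a b - f₁ (x, z') a b‖ ≤ L * ‖z - z'‖
  integral_eq_zero : ∀ θ ∈ O, ∀ a, ∫ s in (0 : ℝ)..T₂, f₁ θ a s = 0

/-- The velocity of the first-order term of the motion, averaged over the second phase with the
first one frozen. -/
noncomputable def fastAverage {V W : Type*} [NormedAddCommGroup V] [NormedSpace ℝ V]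
    (T₂ : ℝ) (f₁ f₂ : V × W → ℝ → ℝ → V) (g : V × W → ℝ → ℝ → (V × ℝ →L[ℝ] V))
    (θ : V × W) (a : ℝ) : V :=
  T₂⁻¹ • ∫ s in (0 : ℝ)..T₂, (g θ a s (∫ r in (0 : ℝ)..s, f₁ θ a r, s) + f₂ θ a s)

theorem exists_forall_ball_of_isCompact {X : Type*} [PseudoMetricSpace X] {Q : Set X}
    (hQ : IsCompact Q) {P : ℝ → Set X → Prop}
    (hmono : ∀ L L' s s', L ≤ L' → s' ⊆ s → P L s → P L' s')
    (h : ∀ p ∈ Q, ∃ s ∈ 𝓝 p, ∃ L, P L s) :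
    ∃ L, ∃ κ > 0, ∀ p ∈ Q, P L (Metric.ball p κ) := by
  refine hQ.induction_on (p := fun R => ∃ L, ∃ κ > 0, ∀ p ∈ R, P L (Metric.ball p κ))
    ⟨0, 1, one_pos, by simp⟩ ?_ ?_ fun p hp => ?_
  · rintro R R' hR ⟨L, κ, hκ, H⟩
    exact ⟨L, κ, hκ, fun p hp => H p (hR hp)⟩
  · rintro R R' ⟨L, κ, hκ, H⟩ ⟨L', κ', hκ', H'⟩
    refine ⟨max L L', min κ κ', lt_min hκ hκ', ?_⟩
    rintro p (hp | hp)
    · exact hmono _ _ _ _ (le_max_left _ _) (Metric.ball_subset_ball (min_le_left _ _)) (H p hp)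
    · exact hmono _ _ _ _ (le_max_right _ _) (Metric.ball_subset_ball (min_le_right _ _)) (H' p hp)
  · obtain ⟨s, hs, L, hL⟩ := h p hp
    obtain ⟨r, hr, hball⟩ := Metric.mem_nhds_iff.mp hs
    refine ⟨Metric.ball p (r / 2),
      mem_nhdsWithin_of_mem_nhds (Metric.ball_mem_nhds _ (half_pos hr)), L, r / 2, half_pos hr,
      fun q hq => hmono _ _ _ _ le_rfl ?_ hL⟩
    refine (Metric.ball_subset_ball' ?_).trans hball
    linarith [Metric.mem_ball.mp hq]

namespace IsPeriodicField

variable {V W : Type*} [NormedAddCommGroup V] [NormedSpace ℝ V] [NormedAddCommGroup W]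
  {O K : Set (V × W)} {T₁ T₂ : ℝ} {f₁ f₂ : V × W → ℝ → ℝ → V}
  {g : V × W → ℝ → ℝ → (V × ℝ →L[ℝ] V)}

theorem periodic_deriv (h : IsPeriodicField O T₁ T₂ f₁ f₂ g) : IsDoublyPeriodicOn g T₁ T₂ O := by
  have eventually_mem : ∀ x z a, (x, z) ∈ O → ∀ᶠ q : V × ℝ in 𝓝 (x, a), (q.1, z) ∈ O :=
    fun x z a hθ => ((continuous_fst.prodMk continuous_const).tendsto (x, a)).eventually
      (h.isOpen.mem_nhds hθ)
  refine ⟨h.continuousOn_deriv, ?_, ?_⟩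
  · rintro ⟨x, z⟩ hθ b a
    have hshift : HasFDerivAt (fun q : V × ℝ => f₁ ((q + (0, T₁)).1, z) (q + (0, T₁)).2 b)
        (g (x, z) (a + T₁) b) (x, a) :=
      (hasFDerivAt_comp_add_right (f := fun q : V × ℝ => f₁ (q.1, z) q.2 b) (x := (x, a))
        (0, T₁)).mpr (by simpa using h.hasFDerivAt x z (a + T₁) b hθ)
    refine hshift.unique ((h.hasFDerivAt x z a b hθ).congr_of_eventuallyEq ?_)
    filter_upwards [eventually_mem x z a hθ] with q hq
    simpa using h.periodic₁.periodic_left _ hq b q.2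
  · rintro ⟨x, z⟩ hθ a b
    refine (h.hasFDerivAt x z a (b + T₂) hθ).unique
      ((h.hasFDerivAt x z a b hθ).congr_of_eventuallyEq ?_)
    filter_upwards [eventually_mem x z a hθ] with q hq
    exact h.periodic₁.periodic_right _ hq _ _

theorem continuous_fastIntegrand (h : IsPeriodicField O T₁ T₂ f₁ f₂ g) :
    Continuous fun q : (O × ℝ) × ℝ =>
      g q.1.1 q.1.2 q.2 (∫ r in (0 : ℝ)..q.2, f₁ q.1.1 q.1.2 r, q.2) + f₂ q.1.1 q.1.2 q.2 := by
  have hprim : Continuous fun q : (O × ℝ) × ℝ => ∫ r in (0 : ℝ)..q.2, f₁ q.1.1 q.1.2 r :=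
    intervalIntegral.continuous_parametric_primitive_of_continuous
      (f := fun (q : O × ℝ) r => f₁ q.1 q.2 r) h.periodic₁.continuous_subtype
  exact (h.periodic_deriv.continuous_subtype.clm_apply (hprim.prodMk continuous_snd)).add
    h.periodic₂.continuous_subtype

theorem isDoublyPeriodicOn_fastAverage (h : IsPeriodicField O T₁ T₂ f₁ f₂ g) :
    IsDoublyPeriodicOn (fun θ a (_ : ℝ) => fastAverage T₂ f₁ f₂ g θ a) T₁ T₂ O where
  continuousOn := by
    have hc : Continuous fun q : O × ℝ => fastAverage T₂ f₁ f₂ g q.1 q.2 :=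
      (intervalIntegral.continuous_parametric_intervalIntegral_of_continuous'
        (f := fun (q : O × ℝ) s =>
          g q.1 q.2 s (∫ r in (0 : ℝ)..s, f₁ q.1 q.2 r, s) + f₂ q.1 q.2 s)
        h.continuous_fastIntegrand 0 T₂).const_smul _
    rw [continuousOn_iff_continuous_domRestrict]
    exact hc.comp (f := fun p : (O ×ˢ (univ : Set (ℝ × ℝ)) : Set ((V × W) × (ℝ × ℝ))) =>
      ((⟨p.1.1, p.2.1⟩ : O), p.1.2.1)) (by fun_prop)
  periodic_left θ hθ _ a := by
    have hg (s : ℝ) : g θ (a + T₁) s = g θ a s := h.periodic_deriv.periodic_left θ hθ s a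
    have hf₁ (s : ℝ) : f₁ θ (a + T₁) s = f₁ θ a s := h.periodic₁.periodic_left θ hθ s a
    have hf₂ (s : ℝ) : f₂ θ (a + T₁) s = f₂ θ a s := h.periodic₂.periodic_left θ hθ s a
    simp only [fastAverage, hg, hf₁, hf₂]
  periodic_right _ _ _ _ := rfl

theorem exists_lipschitz (h : IsPeriodicField O T₁ T₂ f₁ f₂ g) (hK : IsCompact K) (hKO : K ⊆ O) :
    ∃ L, 0 ≤ L ∧ ∃ κ > 0, ∀ θ ∈ K, ∀ x z z' a b, dist (x, z) θ < κ → dist (x, z') θ < κ →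
      ‖f₁ (x, z) a b - f₁ (x, z') a b‖ ≤ L * ‖z - z'‖ := by
  have hQ : IsCompact (K ×ˢ (Icc 0 T₁ ×ˢ Icc 0 T₂)) := hK.prod (isCompact_Icc.prod isCompact_Icc)
  obtain ⟨κ₀, hκ₀, hthick⟩ := hK.exists_thickening_subset_open h.isOpen hKO
  obtain ⟨L, κ, hκ, hL⟩ := exists_forall_ball_of_isCompact hQ
    (P := fun L N => ∀ x z z' a b, ((x, z), (a, b)) ∈ N → ((x, z'), (a, b)) ∈ N →
      ‖f₁ (x, z) a b - f₁ (x, z') a b‖ ≤ L * ‖z - z'‖)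
    (fun L L' s s' hLL hs H x z z' a b h₁ h₂ =>
      (H x z z' a b (hs h₁) (hs h₂)).trans (by gcongr))
    fun p hp => h.lipschitz p.1 (hKO hp.1) p.2.1 p.2.2
  refine ⟨max L 0, le_max_right _ _, min κ κ₀, lt_min hκ hκ₀, fun θ hθ x z z' a b h₁ h₂ => ?_⟩
  rw [lt_min_iff] at h₁ h₂
  obtain ⟨m, hm⟩ := exists_sub_zsmul_mem_Icc h.T₁_pos a
  obtain ⟨n, hn⟩ := exists_sub_zsmul_mem_Icc h.T₂_pos b
  have mem_O (y : W) (hy : dist (x, y) θ < κ₀) : (x, y) ∈ O :=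
    hthick (Metric.mem_thickening_iff.mpr ⟨θ, hθ, hy⟩)
  have mem_ball (y : W) (hy : dist (x, y) θ < κ) : ((x, y), (a - m • T₁, b - n • T₂)) ∈
      Metric.ball (θ, (a - m • T₁, b - n • T₂)) κ := by
    rw [Metric.mem_ball, Prod.dist_eq, dist_self]
    exact max_lt hy hκ
  rw [← h.periodic₁.apply_sub_zsmul (mem_O z h₁.2) m n,
    ← h.periodic₁.apply_sub_zsmul (mem_O z' h₂.2) m n]
  refine (hL _ ⟨hθ, hm, hn⟩ x z z' _ _ (mem_ball z h₁.1) (mem_ball z' h₂.1)).trans ?_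
  gcongr
  exact le_max_left _ _

theorem exists_taylor_fst (h : IsPeriodicField O T₁ T₂ f₁ f₂ g) (hK : IsCompact K) (hKO : K ⊆ O)
    {η : ℝ} (hη : 0 < η) :
    ∃ κ > 0, ∀ x₀ z₀, (x₀, z₀) ∈ K → ∀ x a₀ a b, ‖x - x₀‖ < κ → |a - a₀| < κ →
      ‖f₁ (x, z₀) a b - f₁ (x₀, z₀) a₀ b - g (x₀, z₀) a₀ b (x - x₀, a - a₀)‖ ≤
        η * ‖(x - x₀, a - a₀)‖ := by
  obtain ⟨κ₀, hκ₀, hthick⟩ := hK.exists_thickening_subset_open h.isOpen hKO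
  obtain ⟨κ₁, hκ₁, hg⟩ := h.periodic_deriv.exists_norm_sub_lt h.T₁_pos h.T₂_pos h.isOpen hK hKO hη
  have hκ : 0 < min κ₀ κ₁ := lt_min hκ₀ hκ₁
  refine ⟨min κ₀ κ₁, hκ, fun x₀ z₀ hθ x a₀ a b hx ha => ?_⟩
  have mem_O : ∀ q ∈ Metric.ball (x₀, a₀) (min κ₀ κ₁),
      (q.1, z₀) ∈ O ∧ dist (q.1, z₀) (x₀, z₀) < κ₁ ∧ |q.2 - a₀| < κ₁ := by
    intro q hq
    have hd : dist (q.1, z₀) (x₀, z₀) = dist q.1 x₀ := by simp [Prod.dist_eq]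
    rw [Metric.mem_ball, Prod.dist_eq, max_lt_iff, Real.dist_eq, lt_min_iff, lt_min_iff] at hq
    refine ⟨hthick (Metric.mem_thickening_iff.mpr ⟨_, hθ, ?_⟩), ?_, hq.2.2⟩
    · rw [hd]; exact hq.1.1
    · rw [hd]; exact hq.1.2
  have hmvt := Convex.norm_image_sub_le_of_norm_hasFDerivWithin_le' (𝕜 := ℝ)
    (f := fun q : V × ℝ => f₁ (q.1, z₀) q.2 b) (f' := fun q => g (q.1, z₀) q.2 b)
    (φ := g (x₀, z₀) a₀ b) (C := η) (s := Metric.ball (x₀, a₀) (min κ₀ κ₁))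
    (x := (x₀, a₀)) (y := (x, a))
    (fun q hq => (h.hasFDerivAt q.1 z₀ q.2 b (mem_O q hq).1).hasFDerivWithinAt)
    (fun q hq => (hg _ hθ _ (mem_O q hq).1 _ _ b (mem_O q hq).2.1 (mem_O q hq).2.2).le)
    (convex_ball _ _) (Metric.mem_ball_self hκ) (by
      rw [Metric.mem_ball, Prod.dist_eq, dist_eq_norm, Real.dist_eq]
      exact max_lt hx ha)
  simpa using hmvt

theorem exists_taylor (h : IsPeriodicField O T₁ T₂ f₁ f₂ g) (hK : IsCompact K) (hKO : K ⊆ O) :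
    ∃ L, 0 ≤ L ∧ ∀ η > 0, ∃ κ > 0, ∀ x₀ z₀, (x₀, z₀) ∈ K → ∀ x z a₀ a b,
      ‖x - x₀‖ < κ → ‖z - z₀‖ < κ → |a - a₀| < κ →
      ‖f₁ (x, z) a b - f₁ (x₀, z₀) a₀ b - g (x₀, z₀) a₀ b (x - x₀, a - a₀)‖ ≤
        η * ‖(x - x₀, a - a₀)‖ + L * ‖z - z₀‖ := by
  obtain ⟨L, hL, κ₀, hκ₀, hlip⟩ := h.exists_lipschitz hK hKO
  refine ⟨L, hL, fun η hη => ?_⟩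
  obtain ⟨κ₁, hκ₁, htaylor⟩ := h.exists_taylor_fst hK hKO hη
  refine ⟨min κ₀ κ₁, lt_min hκ₀ hκ₁, fun x₀ z₀ hθ x z a₀ a b hx hz ha => ?_⟩
  rw [lt_min_iff] at hx hz ha
  have hchange_z : ‖f₁ (x, z) a b - f₁ (x, z₀) a b‖ ≤ L * ‖z - z₀‖ := by
    refine hlip _ hθ x z z₀ a b ?_ ?_ <;> rw [Prod.dist_eq, dist_eq_norm, dist_eq_norm]
    · exact max_lt hx.1 hz.1
    · exact max_lt hx.1 (by simpa using hκ₀)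
  calc _ = ‖(f₁ (x, z₀) a b - f₁ (x₀, z₀) a₀ b - g (x₀, z₀) a₀ b (x - x₀, a - a₀)) +
        (f₁ (x, z) a b - f₁ (x, z₀) a b)‖ := by congr 1; abel
    _ ≤ _ := (norm_add_le _ _).trans
        (add_le_add (htaylor x₀ z₀ hθ x a₀ a b hx.2 ha.2) hchange_z)

end IsPeriodicField

/-! ### Averaging over the fast phases -/

theorem eventually_const_mul_lt {c κ : ℝ} (hκ : 0 < κ) : ∀ᶠ ε in 𝓝[>] (0 : ℝ), c * ε < κ :=
  (((continuous_const_mul c).tendsto' 0 0 (mul_zero c)).mono_left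
    nhdsWithin_le_nhds).eventually_lt_const hκ

theorem eventually_pos_le_one : ∀ᶠ ε in 𝓝[>] (0 : ℝ), 0 < ε ∧ ε ≤ 1 := by
  filter_upwards [Ioc_mem_nhdsGT (one_pos (α := ℝ))] with ε hε using hε

theorem norm_sub_le_of_windows {V : Type*} [SeminormedAddCommGroup V] {G : ℝ → V} {p c d s t : ℝ}
    (r₀ : ℝ) (hp : 0 < p) (hc : 0 ≤ c) (hst : s ≤ t)
    (hwin : ∀ (n : ℤ) (r), r = r₀ + n • p → s ≤ r → r + p ≤ t → ‖G (r + p) - G r‖ ≤ c * p)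
    (hosc : ∀ r r', s ≤ r → r ≤ r' → r' ≤ t → r' ≤ r + p → ‖G r' - G r‖ ≤ d) :
    ‖G t - G s‖ ≤ c * (t - s) + 2 * d := by
  obtain ⟨n, ⟨hs, hsp⟩, -⟩ := existsUnique_add_zsmul_mem_Ico hp r₀ s
  set s' := r₀ + n • p
  have hcst : 0 ≤ c * (t - s) := mul_nonneg hc (sub_nonneg.mpr hst)
  have hd : 0 ≤ d := (norm_nonneg _).trans (hosc s s le_rfl le_rfl hst (by linarith))
  rcases lt_or_ge t s' with hlt | hge
  · linarith [hosc s t le_rfl hst le_rfl (by linarith)]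
  have hwindows (N : ℕ) (hN : s' + N * p ≤ t) : ‖G (s' + N * p) - G s'‖ ≤ c * (N * p) := by
    induction N with
    | zero => simp
    | succ N ih =>
      have hsucc : s' + (N + 1 : ℕ) * p = s' + N * p + p := by push_cast; ring
      rw [hsucc] at hN ⊢
      have hprev := ih (by linarith)
      have hlast := hwin (n + N) (s' + N * p)
        (by simp only [s', add_smul, zsmul_eq_mul]; push_cast; ring) (by nlinarith) hN
      push_cast
      linarith [norm_sub_le_norm_sub_add_norm_sub (G (s' + N * p + p)) (G (s' + N * p)) (G s')]
  set N := ⌊(t - s') / p⌋₊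
  have hNle : N * p ≤ t - s' :=
    (le_div_iff₀ hp).mp (Nat.floor_le (div_nonneg (sub_nonneg.mpr hge) hp.le))
  have hltN : t - s' < (N + 1) * p := (div_lt_iff₀ hp).mp (Nat.lt_floor_add_one _)
  have hNp : 0 ≤ N * p := by positivity
  have hfirst := hosc s s' le_rfl hs hge hsp.le
  have hlast := hosc (s' + N * p) t (by linarith) (by linarith) le_rfl (by linarith)
  have hmiddle := hwindows N (by linarith)
  have hcN : c * (N * p) ≤ c * (t - s) := by gcongr; linarith
  linarith [norm_sub_le_norm_sub_add_norm_sub (G t) (G (s' + N * p)) (G s),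
    norm_sub_le_norm_sub_add_norm_sub (G (s' + N * p)) (G s') (G s)]

section Integral

variable {V : Type*} [NormedAddCommGroup V] [NormedSpace ℝ V]

theorem norm_sub_sub_integral_le_of_ae_hasDerivWithinAt [CompleteSpace V] {x k : ℝ → V}
    {s t c : ℝ} (hst : s ≤ t) (hx : AbsolutelyContinuousOnInterval x s t) (hk : Continuous k)
    (h : ∀ᵐ r : ℝ, r ∈ Icc s t → ∃ v, ‖v - k r‖ ≤ c ∧ HasDerivWithinAt x v (Icc s t) r) :
    ‖x t - x s - ∫ r in s..t, k r‖ ≤ c * (t - s) := by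
  have hprim (r : ℝ) : HasDerivAt (fun r => ∫ q in s..r, k q) (k r) r :=
    (hk.integral_hasStrictDerivAt s r).hasDerivAt
  have hprim_smooth : ContDiff ℝ 1 fun r => ∫ q in s..r, k q :=
    contDiff_one_iff_deriv.mpr ⟨fun r => (hprim r).differentiableAt,
      by rwa [show deriv (fun r => ∫ q in s..r, k q) = k from funext fun r => (hprim r).deriv]⟩
  have hbound := norm_sub_le_of_ae_hasDerivWithinAt (c := c) hst
    (hx.sub hprim_smooth.contDiffOn.absolutelyContinuousOnInterval) (by
      filter_upwards [h] with r hr hrI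
      obtain ⟨v, hv, hd⟩ := hr hrI
      exact ⟨v - k r, hv, hd.sub (hprim r).hasDerivWithinAt⟩)
  simpa [sub_right_comm] using hbound

theorem norm_integral_sub_smul_le_of_norm_sub_le [CompleteSpace V] {k : ℝ → V} (hk : Continuous k)
    {s t c : ℝ} {v : V} (hst : s ≤ t) (h : ∀ r ∈ Icc s t, ‖k r - v‖ ≤ c) :
    ‖(∫ r in s..t, k r) - (t - s) • v‖ ≤ c * (t - s) := by
  rw [← intervalIntegral.integral_const, ← intervalIntegral.integral_sub
    (hk.intervalIntegrable _ _) (continuous_const.intervalIntegrable _ _)]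
  refine (intervalIntegral.norm_integral_le_of_norm_le_const fun r hr =>
    h r (Ioc_subset_Icc_self (uIoc_of_le hst ▸ hr))).trans_eq ?_
  rw [abs_of_nonneg (sub_nonneg.mpr hst)]

theorem norm_integral_le_of_norm_le {k : ℝ → V} {s t b : ℝ} (hst : s ≤ t) (hb : ∀ r, ‖k r‖ ≤ b) :
    ‖∫ r in s..t, k r‖ ≤ b * (t - s) := by
  simpa [abs_of_nonneg (sub_nonneg.mpr hst)] using
    intervalIntegral.norm_integral_le_of_norm_le_const (a := s) (b := t) fun r _ => hb r

theorem norm_integral_sub_smul_average_le {k : ℝ → V} (hk : Continuous k) {T b : ℝ} (hT : 0 < T)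
    (hper : Function.Periodic k T) (hb : ∀ a, ‖k a‖ ≤ b) {s t : ℝ} (hst : s ≤ t) :
    ‖(∫ a in s..t, k a) - (t - s) • (T⁻¹ • ∫ a in (0 : ℝ)..T, k a)‖ ≤ 4 * b * T := by
  set m := T⁻¹ • ∫ a in (0 : ℝ)..T, k a with hm
  have hmb : ‖m‖ ≤ b := by
    rw [hm, norm_smul, norm_inv, Real.norm_of_nonneg hT.le, inv_mul_le_iff₀ hT, mul_comm]
    simpa using norm_integral_le_of_norm_le hT.le hb
  have hG (r r' : ℝ) : ((∫ a in (0 : ℝ)..r', k a) - r' • m) - ((∫ a in (0 : ℝ)..r, k a) - r • m) =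
      (∫ a in r..r', k a) - (r' - r) • m := by
    rw [← intervalIntegral.integral_interval_sub_left (hk.intervalIntegrable 0 r')
      (hk.intervalIntegrable 0 r), sub_smul]
    abel
  have hbound := norm_sub_le_of_windows (G := fun r => (∫ a in (0 : ℝ)..r, k a) - r • m)
    (c := 0) (d := 2 * b * T) 0 hT le_rfl hst (fun n r _ _ _ => ?_) fun r r' _ hrr' _ hp => ?_
  · rw [hG] at hbound
    linarith
  · have hwindow : ∫ a in r..r + T, k a = T • m := by
      rw [hper.intervalIntegral_add_eq r 0, zero_add, hm, smul_inv_smul₀ hT.ne']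
    rw [hG, hwindow, add_sub_cancel_left, sub_self, norm_zero, zero_mul]
  · have hb₀ : 0 ≤ b := (norm_nonneg _).trans hmb
    have hsmul : ‖(r' - r) • m‖ ≤ (r' - r) * b := by
      rw [norm_smul, Real.norm_of_nonneg (sub_nonneg.mpr hrr')]
      gcongr
    have hle : b * (r' - r) ≤ b * T := by gcongr; linarith
    rw [hG]
    linarith [norm_sub_le (∫ a in r..r', k a) ((r' - r) • m), norm_integral_le_of_norm_le hrr' hb]

end Integral

/-- `x` is driven by the field `ε⁻¹ f₁ + f₂` on `[s, t]` with phases `α + r / ε` and `β + r / ε²`,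
while `z` moves at speed at most `M` and `(x, z)` stays in `K`. -/
structure IsFastTrajectory {V W : Type*} [NormedAddCommGroup V] [NormedSpace ℝ V]
    [NormedAddCommGroup W] (K : Set (V × W)) (M : ℝ) (f₁ f₂ : V × W → ℝ → ℝ → V) (ε α β : ℝ)
    (x : ℝ → V) (z : ℝ → W) (s t : ℝ) : Prop where
  ac : AbsolutelyContinuousOnInterval x s t
  mem : ∀ r ∈ Icc s t, (x r, z r) ∈ K
  speed : ∀ r ∈ Icc s t, ∀ r' ∈ Icc s t, r ≤ r' → ‖z r' - z r‖ ≤ M * (r' - r)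
  deriv : ∀ᵐ r : ℝ, r ∈ Icc s t → HasDerivWithinAt x
    (ε⁻¹ • f₁ (x r, z r) (α + r / ε) (β + r / ε ^ 2) + f₂ (x r, z r) (α + r / ε) (β + r / ε ^ 2))
    (Icc s t) r

namespace IsFastTrajectory

variable {V W : Type*} [NormedAddCommGroup V] [NormedSpace ℝ V] [NormedAddCommGroup W]
  {K O : Set (V × W)} {M : ℝ} {f₁ f₂ : V × W → ℝ → ℝ → V} {ε α β : ℝ} {x : ℝ → V} {z : ℝ → W}
  {s t : ℝ}

theorem mono (h : IsFastTrajectory K M f₁ f₂ ε α β x z s t) {s' t' : ℝ} (hs : s ≤ s')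
    (hst : s' ≤ t') (ht : t' ≤ t) : IsFastTrajectory K M f₁ f₂ ε α β x z s' t' where
  ac := h.ac.mono (by
    rw [uIcc_of_le hst, uIcc_of_le (by linarith)]
    exact Icc_subset_Icc hs ht)
  mem r hr := h.mem r (Icc_subset_Icc hs ht hr)
  speed r hr r' hr' := h.speed r (Icc_subset_Icc hs ht hr) r' (Icc_subset_Icc hs ht hr')
  deriv := by
    filter_upwards [h.deriv] with r hr hr'
    exact (hr (Icc_subset_Icc hs ht hr')).mono (Icc_subset_Icc hs ht)

theorem norm_sub_le (h : IsFastTrajectory K M f₁ f₂ ε α β x z s t) {b₁ b₂ : ℝ} (hε : 0 < ε)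
    (hε₁ : ε ≤ 1) (hb₁ : ∀ θ ∈ K, ∀ a b, ‖f₁ θ a b‖ ≤ b₁) (hb₂ : ∀ θ ∈ K, ∀ a b, ‖f₂ θ a b‖ ≤ b₂)
    (hst : s ≤ t) : ‖x t - x s‖ ≤ ε⁻¹ * (b₁ + b₂) * (t - s) := by
  refine norm_sub_le_of_ae_hasDerivWithinAt hst h.ac ?_
  filter_upwards [h.deriv] with r hr hrI
  refine ⟨_, ?_, hr hrI⟩
  have hf₂ := hb₂ _ (h.mem r hrI) (α + r / ε) (β + r / ε ^ 2)
  rw [mul_add]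
  refine norm_add_le_of_le ?_
    (hf₂.trans (le_mul_of_one_le_left ((norm_nonneg _).trans hf₂) ((one_le_inv₀ hε).mpr hε₁)))
  rw [norm_smul, norm_inv, Real.norm_of_nonneg hε.le]
  gcongr
  exact hb₁ _ (h.mem r hrI) _ _

theorem comp_add_right {c : ℝ} (h : IsFastTrajectory K M f₁ f₂ ε α β x z (s + c) (t + c)) :
    IsFastTrajectory K M f₁ f₂ ε (α + c / ε) (β + c / ε ^ 2) (fun r => x (r + c))
      (fun r => z (r + c)) s t := by
  have hmaps : MapsTo (· + c) (Icc s t) (Icc (s + c) (t + c)) :=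
    fun r hr => ⟨by simpa using hr.1, by simpa using hr.2⟩
  refine ⟨absolutelyContinuousOnInterval_comp_add_right h.ac, fun r hr => h.mem _ (hmaps hr),
    fun r hr r' hr' hrr' => ?_, ?_⟩
  · simpa using h.speed _ (hmaps hr) _ (hmaps hr') (by simpa using hrr')
  have hderiv := (measurePreserving_add_right volume c).quasiMeasurePreserving.ae h.deriv
  filter_upwards [hderiv] with r hr hrI
  rw [show α + c / ε + r / ε = α + (r + c) / ε by ring,
    show β + c / ε ^ 2 + r / ε ^ 2 = β + (r + c) / ε ^ 2 by ring]
  simpa [Function.comp_def] using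
    HasDerivWithinAt.scomp r (hr (hmaps hrI)) ((hasDerivWithinAt_id r (Icc s t)).add_const c) hmaps

theorem sub_zsmul {T₁ T₂ : ℝ} (h : IsFastTrajectory K M f₁ f₂ ε α β x z s t) (hKO : K ⊆ O)
    (hf₁ : IsDoublyPeriodicOn f₁ T₁ T₂ O) (hf₂ : IsDoublyPeriodicOn f₂ T₁ T₂ O) (n : ℤ) :
    IsFastTrajectory K M f₁ f₂ ε α (β - n • T₂) x z s t where
  ac := h.ac
  mem := h.mem
  speed := h.speed
  deriv := by
    filter_upwards [h.deriv] with r hr hrI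
    have hO := hKO (h.mem r hrI)
    rw [sub_add_eq_add_sub, (hf₁.periodic_right _ hO _).sub_zsmul_eq,
      (hf₂.periodic_right _ hO _).sub_zsmul_eq]
    exact hr hrI

end IsFastTrajectory

namespace IsPeriodicField

variable {V W : Type*} [NormedAddCommGroup V] [NormedSpace ℝ V] [NormedAddCommGroup W]
  {O K : Set (V × W)} {T₁ T₂ M : ℝ} {f₁ f₂ : V × W → ℝ → ℝ → V}
  {g : V × W → ℝ → ℝ → (V × ℝ →L[ℝ] V)}

theorem exists_norm_sub_le_mul (h : IsPeriodicField O T₁ T₂ f₁ f₂ g) (hK : IsCompact K)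
    (hKO : K ⊆ O) (hM : 0 ≤ M) :
    ∃ c, 0 ≤ c ∧ ∀ᶠ ε in 𝓝[>] (0 : ℝ), ∀ α β x z s t, s ≤ t → t ≤ s + ε ^ 2 * T₂ →
      IsFastTrajectory K M f₁ f₂ ε α β x z s t →
        ‖x t - x s‖ ≤ c * ε ∧ ‖z t - z s‖ ≤ c * ε ^ 2 := by
  obtain ⟨b₁, hb₁, hf₁⟩ := h.periodic₁.exists_norm_le h.T₁_pos h.T₂_pos hK hKO
  obtain ⟨b₂, hb₂, hf₂⟩ := h.periodic₂.exists_norm_le h.T₁_pos h.T₂_pos hK hKO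
  have hT₂ := h.T₂_pos
  refine ⟨max ((b₁ + b₂) * T₂) (M * T₂), by positivity, ?_⟩
  filter_upwards [eventually_pos_le_one] with ε ⟨hε, hε₁⟩ α β x z s t hst hts hx
  have hlen : t - s ≤ ε ^ 2 * T₂ := by linarith
  constructor
  · calc ‖x t - x s‖ ≤ ε⁻¹ * (b₁ + b₂) * (t - s) := hx.norm_sub_le hε hε₁ hf₁ hf₂ hst
      _ ≤ ε⁻¹ * (b₁ + b₂) * (ε ^ 2 * T₂) := by gcongr
      _ = (b₁ + b₂) * T₂ * ε := by field_simp
      _ ≤ _ := by gcongr; exact le_max_left _ _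
  · calc ‖z t - z s‖ ≤ M * (t - s) := hx.speed s ⟨le_rfl, hst⟩ t ⟨hst, le_rfl⟩ hst
      _ ≤ M * (ε ^ 2 * T₂) := by gcongr
      _ = M * T₂ * ε ^ 2 := by ring
      _ ≤ _ := by gcongr; exact le_max_right _ _

theorem exists_window_displacement_le (h : IsPeriodicField O T₁ T₂ f₁ f₂ g) (hK : IsCompact K)
    (hKO : K ⊆ O) (hM : 0 ≤ M) :
    ∃ c, 0 ≤ c ∧ ∀ᶠ ε in 𝓝[>] (0 : ℝ), ∀ a x z,
      IsFastTrajectory K M f₁ f₂ ε a 0 x z 0 (ε ^ 2 * T₂) → ∀ r ∈ Icc 0 (ε ^ 2 * T₂),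
        ‖(x r - x 0, r / ε)‖ ≤ c * ε ∧ ‖z r - z 0‖ ≤ c * ε ^ 2 := by
  obtain ⟨c, hc, hmove⟩ := h.exists_norm_sub_le_mul hK hKO hM
  refine ⟨max c T₂, le_max_of_le_left hc, ?_⟩
  filter_upwards [hmove, eventually_pos_le_one] with ε hε ⟨hε₀, _⟩ a x z hx r hr
  obtain ⟨hxr, hzr⟩ := hε a 0 x z 0 r hr.1 (by linarith [hr.2]) (hx.mono le_rfl hr.1 hr.2)
  have hphase : r / ε ≤ T₂ * ε := by
    rw [div_le_iff₀ hε₀]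
    linarith [hr.2]
  rw [Prod.norm_mk, Real.norm_of_nonneg (div_nonneg hr.1 hε₀.le)]
  refine ⟨max_le (hxr.trans ?_) (hphase.trans ?_), hzr.trans ?_⟩ <;> gcongr
  exacts [le_max_left _ _, le_max_right _ _, le_max_left _ _]

theorem eventually_window_taylor (h : IsPeriodicField O T₁ T₂ f₁ f₂ g) (hK : IsCompact K)
    (hKO : K ⊆ O) (hM : 0 ≤ M) {η : ℝ} (hη : 0 < η) :
    ∀ᶠ ε in 𝓝[>] (0 : ℝ), ∀ a x z, IsFastTrajectory K M f₁ f₂ ε a 0 x z 0 (ε ^ 2 * T₂) →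
      ∀ r ∈ Icc 0 (ε ^ 2 * T₂),
        ‖f₁ (x r, z r) (a + r / ε) (r / ε ^ 2) - f₁ (x 0, z 0) a (r / ε ^ 2) -
          g (x 0, z 0) a (r / ε ^ 2) (x r - x 0, r / ε)‖ ≤ η * ε ∧
        ‖f₂ (x r, z r) (a + r / ε) (r / ε ^ 2) - f₂ (x 0, z 0) a (r / ε ^ 2)‖ ≤ η := by
  obtain ⟨c, hc, hmove⟩ := h.exists_window_displacement_le hK hKO hM
  obtain ⟨L, hL, htaylor⟩ := h.exists_taylor hK hKO
  obtain ⟨κ₁, hκ₁, hf₁⟩ := htaylor (η / (2 * (c + 1))) (by positivity)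
  obtain ⟨κ₂, hκ₂, hf₂⟩ := h.periodic₂.exists_norm_sub_lt h.T₁_pos h.T₂_pos h.isOpen hK hKO hη
  filter_upwards [hmove, eventually_pos_le_one, eventually_const_mul_lt (c := c) hκ₁,
    eventually_const_mul_lt (c := c) hκ₂, eventually_const_mul_lt (c := L * c) (half_pos hη)] with
    ε hε ⟨hε₀, hε₁⟩ hcκ₁ hcκ₂ hLc a x z hx r hr
  obtain ⟨hxr, hzr⟩ := hε a x z hx r hr
  have hz_le : ‖z r - z 0‖ ≤ c * ε :=
    hzr.trans (mul_le_mul_of_nonneg_left (pow_le_of_le_one hε₀.le hε₁ two_ne_zero) hc)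
  have hx_le : ‖x r - x 0‖ ≤ c * ε := (le_max_left _ _).trans hxr
  have ha_le : |a + r / ε - a| ≤ c * ε := by
    rw [add_sub_cancel_left]
    exact (le_max_right _ _).trans hxr
  have hmem₀ : (x 0, z 0) ∈ K := hx.mem 0 ⟨le_rfl, hr.1.trans hr.2⟩
  constructor
  · have hremainder := hf₁ _ _ hmem₀ (x r) (z r) a (a + r / ε) (r / ε ^ 2) (hx_le.trans_lt hcκ₁)
      (hz_le.trans_lt hcκ₁) (ha_le.trans_lt hcκ₁)
    rw [add_sub_cancel_left] at hremainder
    calc _ ≤ η / (2 * (c + 1)) * (c * ε) + L * (c * ε ^ 2) := hremainder.trans (by gcongr)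
      _ = η / 2 * (c / (c + 1)) * ε + L * c * ε * ε := by field_simp
      _ ≤ η / 2 * 1 * ε + η / 2 * ε := by
        gcongr
        exact div_le_one_of_le₀ (by linarith) (by linarith)
      _ = η * ε := by ring
  · refine (hf₂ _ hmem₀ _ (hKO (hx.mem r hr)) _ _ _ ?_ (ha_le.trans_lt hcκ₂)).le
    rw [Prod.dist_eq, dist_eq_norm, dist_eq_norm]
    exact max_lt (hx_le.trans_lt hcκ₂) (hz_le.trans_lt hcκ₂)

theorem continuous_fastIntegrand_right (h : IsPeriodicField O T₁ T₂ f₁ f₂ g) {θ : V × W}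
    (hθ : θ ∈ O) (a : ℝ) :
    Continuous fun s => g θ a s (∫ r in (0 : ℝ)..s, f₁ θ a r, s) + f₂ θ a s :=
  h.continuous_fastIntegrand.comp (Continuous.prodMk_right ((⟨θ, hθ⟩ : O), a))

theorem integral_window_eq (h : IsPeriodicField O T₁ T₂ f₁ f₂ g) {θ : V × W} (hθ : θ ∈ O) (a : ℝ)
    {ε : ℝ} (hε : 0 < ε) :
    ∫ q in (0 : ℝ)..ε ^ 2 * T₂, (ε⁻¹ • f₁ θ a (q / ε ^ 2) +
        (g θ a (q / ε ^ 2) (∫ r in (0 : ℝ)..q / ε ^ 2, f₁ θ a r, q / ε ^ 2) +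
          f₂ θ a (q / ε ^ 2))) =
      (ε ^ 2 * T₂) • fastAverage T₂ f₁ f₂ g θ a := by
  have hT₂ := h.T₂_pos
  have hf₁ : Continuous fun s => ε⁻¹ • f₁ θ a s :=
    ((h.periodic₁.continuous_phases hθ).comp (Continuous.prodMk_right a)).const_smul _
  rw [intervalIntegral.integral_comp_div (fun s => ε⁻¹ • f₁ θ a s +
      (g θ a s (∫ r in (0 : ℝ)..s, f₁ θ a r, s) + f₂ θ a s)) (by positivity),
    zero_div, mul_div_cancel_left₀ _ (by positivity), intervalIntegral.integral_add
      (hf₁.intervalIntegrable _ _) ((h.continuous_fastIntegrand_right hθ a).intervalIntegrable _ _),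
    intervalIntegral.integral_smul, h.integral_eq_zero θ hθ, smul_zero, zero_add, fastAverage,
    smul_smul, mul_assoc, mul_inv_cancel₀ hT₂.ne', mul_one]

theorem continuous_fastAverage_right (h : IsPeriodicField O T₁ T₂ f₁ f₂ g) {θ : V × W}
    (hθ : θ ∈ O) : Continuous fun a => fastAverage T₂ f₁ f₂ g θ a :=
  (h.isDoublyPeriodicOn_fastAverage.continuous_phases hθ).comp (Continuous.prodMk_left 0)

theorem continuous_fastAverage_phase (h : IsPeriodicField O T₁ T₂ f₁ f₂ g) {θ : V × W}
    (hθ : θ ∈ O) (α ε : ℝ) : Continuous fun q => fastAverage T₂ f₁ f₂ g θ (α + q / ε) :=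
  (h.continuous_fastAverage_right hθ).comp (by fun_prop)

variable [CompleteSpace V]

theorem exists_window_sub_primitive_le (h : IsPeriodicField O T₁ T₂ f₁ f₂ g) (hK : IsCompact K)
    (hKO : K ⊆ O) (hM : 0 ≤ M) :
    ∃ c, 0 ≤ c ∧ ∀ᶠ ε in 𝓝[>] (0 : ℝ), ∀ a x z,
      IsFastTrajectory K M f₁ f₂ ε a 0 x z 0 (ε ^ 2 * T₂) → ∀ r ∈ Icc 0 (ε ^ 2 * T₂),
        ‖x r - x 0 - ε • ∫ s in (0 : ℝ)..r / ε ^ 2, f₁ (x 0, z 0) a s‖ ≤ c * ε ^ 2 := by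
  obtain ⟨c, hc, hmove⟩ := h.exists_window_displacement_le hK hKO hM
  obtain ⟨b₂, hb₂, hf₂⟩ := h.periodic₂.exists_norm_le h.T₁_pos h.T₂_pos hK hKO
  obtain ⟨b, hb, hg⟩ := h.periodic_deriv.exists_norm_le h.T₁_pos h.T₂_pos hK hKO
  have hT₂ := h.T₂_pos
  refine ⟨(1 + b * c + b₂) * T₂, by positivity, ?_⟩
  filter_upwards [hmove, h.eventually_window_taylor hK hKO hM one_pos, eventually_pos_le_one]
    with ε hε htaylor ⟨hε₀, _⟩ a x z hx r hr
  have hmem₀ : (x 0, z 0) ∈ K := hx.mem 0 ⟨le_rfl, hr.1.trans hr.2⟩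
  have hcont : Continuous fun s => f₁ (x 0, z 0) a s :=
    (h.periodic₁.continuous_phases (hKO hmem₀)).comp (Continuous.prodMk_right a)
  have hxr := hx.mono le_rfl hr.1 hr.2
  have hbound := norm_sub_sub_integral_le_of_ae_hasDerivWithinAt
    (k := fun q => ε⁻¹ • f₁ (x 0, z 0) a (q / ε ^ 2)) (c := 1 + b * c + b₂) hr.1 hxr.ac
    ((hcont.comp (continuous_id.div_const _)).const_smul _) (by
      filter_upwards [hxr.deriv] with q hq hqr
      refine ⟨_, ?_, hq hqr⟩
      have hqI : q ∈ Icc 0 (ε ^ 2 * T₂) := ⟨hqr.1, hqr.2.trans hr.2⟩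
      rw [zero_add, add_sub_right_comm, ← smul_sub]
      refine norm_add_le_of_le ?_ (hf₂ _ (hx.mem q hqI) _ _)
      rw [norm_smul, norm_inv, Real.norm_of_nonneg hε₀.le, inv_mul_le_iff₀ hε₀]
      have hlin := (g (x 0, z 0) a (q / ε ^ 2)).le_of_opNorm_le_of_le (hg _ hmem₀ _ _)
        (hε a x z hx q hqI).1
      linarith [norm_sub_norm_le (f₁ (x q, z q) (a + q / ε) (q / ε ^ 2) -
        f₁ (x 0, z 0) a (q / ε ^ 2)) (g (x 0, z 0) a (q / ε ^ 2) (x q - x 0, q / ε)),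
        (htaylor a x z hx q hqI).1])
  have hint : ∫ q in (0 : ℝ)..r, ε⁻¹ • f₁ (x 0, z 0) a (q / ε ^ 2) =
      ε • ∫ s in (0 : ℝ)..r / ε ^ 2, f₁ (x 0, z 0) a s := by
    rw [intervalIntegral.integral_smul, intervalIntegral.integral_comp_div _ (by positivity),
      zero_div, smul_smul]
    congr 1
    field_simp
  rw [hint, sub_zero] at hbound
  calc _ ≤ (1 + b * c + b₂) * r := hbound
    _ ≤ (1 + b * c + b₂) * (ε ^ 2 * T₂) := by gcongr; exact hr.2
    _ = _ := by ring

theorem eventually_window_velocity (h : IsPeriodicField O T₁ T₂ f₁ f₂ g) (hK : IsCompact K)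
    (hKO : K ⊆ O) (hM : 0 ≤ M) {η : ℝ} (hη : 0 < η) :
    ∀ᶠ ε in 𝓝[>] (0 : ℝ), ∀ a x z, IsFastTrajectory K M f₁ f₂ ε a 0 x z 0 (ε ^ 2 * T₂) →
      ∀ q ∈ Icc 0 (ε ^ 2 * T₂), ∀ σ, σ = q / ε ^ 2 →
        ‖ε⁻¹ • f₁ (x q, z q) (a + q / ε) σ + f₂ (x q, z q) (a + q / ε) σ -
          (ε⁻¹ • f₁ (x 0, z 0) a σ + (g (x 0, z 0) a σ (∫ r in (0 : ℝ)..σ, f₁ (x 0, z 0) a r, σ) +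
            f₂ (x 0, z 0) a σ))‖ ≤ η := by
  obtain ⟨c, _, hprim⟩ := h.exists_window_sub_primitive_le hK hKO hM
  obtain ⟨b, _, hg⟩ := h.periodic_deriv.exists_norm_le h.T₁_pos h.T₂_pos hK hKO
  have hη₃ : 0 < η / 3 := by positivity
  filter_upwards [hprim, h.eventually_window_taylor hK hKO hM hη₃,
    eventually_const_mul_lt (c := b * c) hη₃, eventually_pos_le_one]
    with ε hprim htaylor hbc ⟨hε₀, _⟩ a x z hx q hqI σ hσ
  have hmem₀ : (x 0, z 0) ∈ K := hx.mem 0 ⟨le_rfl, hqI.1.trans hqI.2⟩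
  set θ₀ := (x 0, z 0)
  have hprim_q := hprim a x z hx q hqI
  obtain ⟨htaylor₁, htaylor₂⟩ := htaylor a x z hx q hqI
  rw [← hσ] at hprim_q htaylor₁ htaylor₂
  set u := ∫ r in (0 : ℝ)..σ, f₁ θ₀ a r
  have hlin : ‖g θ₀ a σ (x q - x 0 - ε • u, 0)‖ ≤ η / 3 * ε := by
    refine ((g θ₀ a σ).le_of_opNorm_le_of_le (b := c * ε ^ 2) (hg _ hmem₀ _ _) ?_).trans
      (by nlinarith)
    rwa [Prod.norm_mk, norm_zero, max_eq_left (norm_nonneg _)]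
  have hsplit : g θ₀ a σ (x q - x 0, q / ε) =
      g θ₀ a σ (x q - x 0 - ε • u, 0) + ε • g θ₀ a σ (u, σ) := by
    rw [← map_smul, ← map_add, Prod.smul_mk, Prod.mk_add_mk, sub_add_cancel, zero_add, smul_eq_mul,
      show ε * σ = q / ε by rw [hσ]; field_simp]
  calc _ = ‖ε⁻¹ • ((f₁ (x q, z q) (a + q / ε) σ - f₁ θ₀ a σ - g θ₀ a σ (x q - x 0, q / ε)) +
        g θ₀ a σ (x q - x 0 - ε • u, 0)) + (f₂ (x q, z q) (a + q / ε) σ - f₂ θ₀ a σ)‖ := by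
        rw [hsplit]
        congr 1
        match_scalars <;> field_simp
        ring
    _ ≤ ε⁻¹ * (η / 3 * ε + η / 3 * ε) + η / 3 := by
        refine norm_add_le_of_le ?_ htaylor₂
        rw [norm_smul, norm_inv, Real.norm_of_nonneg hε₀.le]
        gcongr
        exact norm_add_le_of_le htaylor₁ hlin
    _ = η := by field_simp; ring

theorem eventually_window_average (h : IsPeriodicField O T₁ T₂ f₁ f₂ g) (hK : IsCompact K)
    (hKO : K ⊆ O) (hM : 0 ≤ M) {η : ℝ} (hη : 0 < η) :
    ∀ᶠ ε in 𝓝[>] (0 : ℝ), ∀ a x z, IsFastTrajectory K M f₁ f₂ ε a 0 x z 0 (ε ^ 2 * T₂) →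
      ‖x (ε ^ 2 * T₂) - x 0 - (ε ^ 2 * T₂) • fastAverage T₂ f₁ f₂ g (x 0, z 0) a‖ ≤
        η * (ε ^ 2 * T₂) := by
  have hT₂ := h.T₂_pos
  filter_upwards [h.eventually_window_velocity hK hKO hM hη, eventually_pos_le_one]
    with ε hvel ⟨hε₀, _⟩ a x z hx
  have hp : 0 ≤ ε ^ 2 * T₂ := by positivity
  have hO : (x 0, z 0) ∈ O := hKO (hx.mem 0 ⟨le_rfl, hp⟩)
  have hf₁ : Continuous fun s => ε⁻¹ • f₁ (x 0, z 0) a s :=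
    ((h.periodic₁.continuous_phases hO).comp (Continuous.prodMk_right a)).const_smul _
  have hk := (hf₁.add (h.continuous_fastIntegrand_right hO a)).comp
    (continuous_id.div_const (ε ^ 2))
  rw [← h.integral_window_eq hO a hε₀]
  refine (norm_sub_sub_integral_le_of_ae_hasDerivWithinAt (c := η) hp hx.ac hk ?_).trans_eq
    (by rw [sub_zero])
  filter_upwards [hx.deriv] with q hq hqI
  refine ⟨_, ?_, hq hqI⟩
  rw [zero_add]
  exact hvel a x z hx q hqI _ rfl

theorem eventually_phase_window_average (h : IsPeriodicField O T₁ T₂ f₁ f₂ g) (hK : IsCompact K)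
    (hKO : K ⊆ O) (hM : 0 ≤ M) {η : ℝ} (hη : 0 < η) :
    ∀ᶠ ε in 𝓝[>] (0 : ℝ), ∀ α β x z s t, IsFastTrajectory K M f₁ f₂ ε α β x z s t →
      ∀ (n : ℤ) (r), r = -(ε ^ 2 * β) + n • (ε ^ 2 * T₂) → s ≤ r → r + ε ^ 2 * T₂ ≤ t →
        ‖x (r + ε ^ 2 * T₂) - x r -
          (ε ^ 2 * T₂) • fastAverage T₂ f₁ f₂ g (x r, z r) (α + r / ε)‖ ≤ η * (ε ^ 2 * T₂) := by
  filter_upwards [h.eventually_window_average hK hKO hM hη, eventually_pos_le_one]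
    with ε hwin ⟨hε, _⟩ α β x z s t hx n r hr hs ht
  have hT₂ := h.T₂_pos
  have hp : 0 ≤ ε ^ 2 * T₂ := by positivity
  have hphase : β + r / ε ^ 2 - n • T₂ = 0 := by
    rw [hr, zsmul_eq_mul, zsmul_eq_mul]
    field_simp
    ring
  have hshift := (IsFastTrajectory.comp_add_right (c := r) (s := 0) (t := ε ^ 2 * T₂)
    (hx.mono (by simpa using hs) (by simpa using hp) (by linarith))).sub_zsmul hKO
      h.periodic₁ h.periodic₂ n
  rw [hphase] at hshift
  simpa [add_comm r] using hwin _ _ _ hshift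

end IsPeriodicField

/-- The average of `fastAverage` over the first phase: the velocity of the averaged motion. -/
noncomputable def fullAverage {V W : Type*} [NormedAddCommGroup V] [NormedSpace ℝ V]
    (T₁ T₂ : ℝ) (f₁ f₂ : V × W → ℝ → ℝ → V) (g : V × W → ℝ → ℝ → (V × ℝ →L[ℝ] V))
    (θ : V × W) : V :=
  T₁⁻¹ • ∫ a in (0 : ℝ)..T₁, fastAverage T₂ f₁ f₂ g θ a

namespace IsPeriodicField

variable {V W : Type*} [NormedAddCommGroup V] [NormedSpace ℝ V] [NormedAddCommGroup W]
  {O K : Set (V × W)} {T₁ T₂ M : ℝ} {f₁ f₂ : V × W → ℝ → ℝ → V}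
  {g : V × W → ℝ → ℝ → (V × ℝ →L[ℝ] V)}

theorem norm_integral_fastAverage_sub_le (h : IsPeriodicField O T₁ T₂ f₁ f₂ g) {θ : V × W}
    (hθ : θ ∈ O) {b : ℝ} (hb : ∀ a, ‖fastAverage T₂ f₁ f₂ g θ a‖ ≤ b) {ε s t : ℝ} (hε : 0 < ε)
    (hst : s ≤ t) (α : ℝ) :
    ‖(∫ q in s..t, fastAverage T₂ f₁ f₂ g θ (α + q / ε)) -
      (t - s) • fullAverage T₁ T₂ f₁ f₂ g θ‖ ≤ 4 * b * T₁ * ε := by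
  have hper : Function.Periodic (fastAverage T₂ f₁ f₂ g θ) T₁ :=
    h.isDoublyPeriodicOn_fastAverage.periodic_left θ hθ 0
  have hbound := norm_integral_sub_smul_average_le (h.continuous_fastAverage_right hθ) h.T₁_pos
    hper hb (s := α + s / ε) (t := α + t / ε) (by gcongr)
  rw [intervalIntegral.integral_comp_add_div _ hε.ne']
  calc _ = ‖ε • ((∫ a in α + s / ε..α + t / ε, fastAverage T₂ f₁ f₂ g θ a) -
        (α + t / ε - (α + s / ε)) • fullAverage T₁ T₂ f₁ f₂ g θ)‖ := by
        rw [smul_sub, smul_smul]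
        congr 3
        field_simp
        ring
    _ ≤ ε * (4 * b * T₁) := by
        rw [norm_smul, Real.norm_of_nonneg hε.le]
        gcongr
        exact hbound
    _ = _ := by ring

variable [CompleteSpace V]

theorem exists_norm_sub_le (h : IsPeriodicField O T₁ T₂ f₁ f₂ g) (hK : IsCompact K) (hKO : K ⊆ O)
    (hM : 0 ≤ M) :
    ∃ c Q, 0 ≤ c ∧ 0 ≤ Q ∧ ∀ᶠ ε in 𝓝[>] (0 : ℝ), ∀ α β x z s t, s ≤ t →
      IsFastTrajectory K M f₁ f₂ ε α β x z s t → ‖x t - x s‖ ≤ c * (t - s) + Q * ε := by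
  have hT₂ := h.T₂_pos
  obtain ⟨b, hb, hF⟩ :=
    h.isDoublyPeriodicOn_fastAverage.exists_norm_le h.T₁_pos h.T₂_pos hK hKO
  obtain ⟨d, hd, hmove⟩ := h.exists_norm_sub_le_mul hK hKO hM
  refine ⟨b + 1, 2 * d, by positivity, by positivity, ?_⟩
  filter_upwards [hmove, h.eventually_phase_window_average hK hKO hM one_pos,
    eventually_pos_le_one] with ε hmove hwin ⟨hε, _⟩ α β x z s t hst hx
  have hp : 0 < ε ^ 2 * T₂ := by positivity
  rw [mul_assoc]
  refine norm_sub_le_of_windows (-(ε ^ 2 * β)) hp (by positivity) hst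
    (fun n r hr hs ht => ?_) fun r r' hs hrr' ht hp => ?_
  · have haverage : ‖(ε ^ 2 * T₂) • fastAverage T₂ f₁ f₂ g (x r, z r) (α + r / ε)‖ ≤
        (ε ^ 2 * T₂) * b := by
      rw [norm_smul, Real.norm_of_nonneg hp.le]
      gcongr
      exact hF _ (hx.mem r ⟨hs, by linarith⟩) _ 0
    linarith [hwin α β x z s t hx n r hr hs ht, norm_sub_norm_le (x (r + ε ^ 2 * T₂) - x r)
      ((ε ^ 2 * T₂) • fastAverage T₂ f₁ f₂ g (x r, z r) (α + r / ε))]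
  · exact (hmove α β x z r r' hrr' hp (hx.mono hs hrr' ht)).1

theorem exists_window_sub_integral_le (h : IsPeriodicField O T₁ T₂ f₁ f₂ g) (hK : IsCompact K)
    (hKO : K ⊆ O) (hM : 0 ≤ M) {η : ℝ} (hη : 0 < η) :
    ∃ κ > 0, ∀ᶠ ε in 𝓝[>] (0 : ℝ), ∀ α β x z s t, IsFastTrajectory K M f₁ f₂ ε α β x z s t →
      ∀ θ ∈ K, ∀ (n : ℤ) (r), r = -(ε ^ 2 * β) + n • (ε ^ 2 * T₂) → s ≤ r → r + ε ^ 2 * T₂ ≤ t →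
        dist (x r, z r) θ < κ →
        ‖x (r + ε ^ 2 * T₂) - x r -
          ∫ q in r..r + ε ^ 2 * T₂, fastAverage T₂ f₁ f₂ g θ (α + q / ε)‖ ≤
            η * (ε ^ 2 * T₂) := by
  have hT₂ := h.T₂_pos
  obtain ⟨κ, hκ, hunif⟩ := h.isDoublyPeriodicOn_fastAverage.exists_norm_sub_lt h.T₁_pos h.T₂_pos
    h.isOpen hK hKO (η := η / 3) (by positivity)
  refine ⟨κ, hκ, ?_⟩
  filter_upwards [h.eventually_phase_window_average hK hKO hM (η := η / 3) (by positivity),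
    eventually_const_mul_lt (c := T₂) hκ, eventually_pos_le_one]
    with ε hwin hεκ ⟨hε, _⟩ α β x z s t hx θ hθ n r hr hs ht hdist
  have hp : 0 < ε ^ 2 * T₂ := by positivity
  set A := fastAverage T₂ f₁ f₂ g (x r, z r) (α + r / ε)
  set A' := fastAverage T₂ f₁ f₂ g θ (α + r / ε)
  have hAA' : ‖(ε ^ 2 * T₂) • (A - A')‖ ≤ η / 3 * (ε ^ 2 * T₂) := by
    rw [norm_smul, Real.norm_of_nonneg hp.le, mul_comm]
    gcongr
    exact (hunif θ hθ _ (hKO (hx.mem r ⟨hs, by linarith⟩)) _ _ 0 hdist (by simpa using hκ)).le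
  have hintegral := norm_integral_sub_smul_le_of_norm_sub_le (s := r) (t := r + ε ^ 2 * T₂)
    (v := A') (c := η / 3) (h.continuous_fastAverage_phase (hKO hθ) α ε) (by linarith)
    (fun q hq => ?_)
  · rw [add_sub_cancel_left] at hintegral
    set I := ∫ q in r..r + ε ^ 2 * T₂, fastAverage T₂ f₁ f₂ g θ (α + q / ε)
    calc ‖x (r + ε ^ 2 * T₂) - x r - I‖ = ‖(x (r + ε ^ 2 * T₂) - x r - (ε ^ 2 * T₂) • A) +
          (ε ^ 2 * T₂) • (A - A') - (I - (ε ^ 2 * T₂) • A')‖ := by congr 1; module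
      _ ≤ η / 3 * (ε ^ 2 * T₂) + η / 3 * (ε ^ 2 * T₂) + η / 3 * (ε ^ 2 * T₂) :=
        norm_sub_le_of_le (norm_add_le_of_le (hwin α β x z s t hx n r hr hs ht) hAA') hintegral
      _ = η * (ε ^ 2 * T₂) := by ring
  · refine (hunif θ hθ θ (hKO hθ) _ _ 0 (by simpa using hκ) ?_).le
    have hphase : α + q / ε - (α + r / ε) = (q - r) / ε := by ring
    rw [hphase, abs_of_nonneg (div_nonneg (sub_nonneg.mpr hq.1) hε.le), div_lt_iff₀ hε]
    nlinarith [hq.2]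

theorem exists_norm_sub_smul_fullAverage_le (h : IsPeriodicField O T₁ T₂ f₁ f₂ g)
    (hK : IsCompact K) (hKO : K ⊆ O) (hM : 0 ≤ M) :
    ∃ Q, 0 ≤ Q ∧ ∀ η > 0, ∃ κ > 0, ∀ᶠ ε in 𝓝[>] (0 : ℝ), ∀ α β x z s t, s ≤ t →
      IsFastTrajectory K M f₁ f₂ ε α β x z s t →
      ∀ θ ∈ K, (∀ r ∈ Icc s t, dist (x r, z r) θ < κ) →
        ‖x t - x s - (t - s) • fullAverage T₁ T₂ f₁ f₂ g θ‖ ≤ η * (t - s) + Q * ε := by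
  have hT₂ := h.T₂_pos
  have hT₁ := h.T₁_pos
  obtain ⟨b, hb, hF⟩ := h.isDoublyPeriodicOn_fastAverage.exists_norm_le hT₁ hT₂ hK hKO
  obtain ⟨d, hd, hmove⟩ := h.exists_norm_sub_le_mul hK hKO hM
  refine ⟨2 * (d + b * T₂) + 4 * b * T₁, by positivity, fun η hη => ?_⟩
  obtain ⟨κ, hκ, hwin⟩ := h.exists_window_sub_integral_le hK hKO hM hη
  refine ⟨κ, hκ, ?_⟩
  filter_upwards [hmove, hwin, eventually_pos_le_one]
    with ε hmove hwin ⟨hε, hε₁⟩ α β x z s t hst hx θ hθ hdist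
  have hp : 0 < ε ^ 2 * T₂ := by positivity
  have hk := h.continuous_fastAverage_phase (hKO hθ) α ε
  set k := fun q => fastAverage T₂ f₁ f₂ g θ (α + q / ε)
  have hG (r r' : ℝ) : (x r' - ∫ q in (0 : ℝ)..r', k q) - (x r - ∫ q in (0 : ℝ)..r, k q) =
      x r' - x r - ∫ q in r..r', k q := by
    rw [← intervalIntegral.integral_interval_sub_left (hk.intervalIntegrable 0 r')
      (hk.intervalIntegrable 0 r)]
    abel
  have hcorrected := norm_sub_le_of_windows (G := fun r => x r - ∫ q in (0 : ℝ)..r, k q)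
    (c := η) (d := (d + b * T₂) * ε) (-(ε ^ 2 * β)) hp hη.le hst (fun n r hr hs ht => ?_)
    fun r r' hs hrr' ht hrp => ?_
  · have haverage := h.norm_integral_fastAverage_sub_le (hKO hθ) (fun a => hF θ hθ a 0) hε hst α
    rw [hG] at hcorrected
    calc _ = ‖(x t - x s - ∫ q in s..t, k q) +
          ((∫ q in s..t, k q) - (t - s) • fullAverage T₁ T₂ f₁ f₂ g θ)‖ := by congr 1; abel
      _ ≤ η * (t - s) + 2 * ((d + b * T₂) * ε) + 4 * b * T₁ * ε :=
        norm_add_le_of_le hcorrected haverage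
      _ = _ := by ring
  · rw [hG]
    exact hwin α β x z s t hx θ hθ n r hr hs ht (hdist r ⟨hs, by linarith⟩)
  · have hintegral : ‖∫ q in r..r', k q‖ ≤ b * T₂ * ε := by
      refine (norm_integral_le_of_norm_le hrr' fun q => hF θ hθ _ 0).trans ?_
      have hlen : r' - r ≤ T₂ * ε := by nlinarith [mul_pos hε hT₂]
      rw [mul_assoc]
      gcongr
    rw [hG, add_mul]
    exact norm_sub_le_of_le (hmove α β x z r r' hrr' hrp (hx.mono hs hrr' ht)).1 hintegral

end IsPeriodicField

/-! ### The Lie bracket form of the average -/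

theorem integral_primitive_apply_eq_neg {E F : Type*} [NormedAddCommGroup E] [NormedSpace ℝ E]
    [CompleteSpace E] [NormedAddCommGroup F] [NormedSpace ℝ F] [CompleteSpace F]
    {A : ℝ → E →L[ℝ] F} {f : ℝ → E} (hA : Continuous A) (hf : Continuous f) {T : ℝ}
    (h0 : ∫ r in (0 : ℝ)..T, f r = 0) :
    ∫ s in (0 : ℝ)..T, (∫ r in (0 : ℝ)..s, A r) (f s) =
      -∫ s in (0 : ℝ)..T, A s (∫ r in (0 : ℝ)..s, f r) := by
  have hA' : ∀ s, HasDerivAt (fun s => ∫ r in (0 : ℝ)..s, A r) (A s) s := fun s =>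
    hA.integral_hasStrictDerivAt 0 s |>.hasDerivAt
  have hf' : ∀ s, HasDerivAt (fun s => ∫ r in (0 : ℝ)..s, f r) (f s) s := fun s =>
    hf.integral_hasStrictDerivAt 0 s |>.hasDerivAt
  have hi₁ : IntervalIntegrable (fun s => A s (∫ r in (0 : ℝ)..s, f r)) volume 0 T :=
    (hA.clm_apply (continuous_iff_continuousAt.mpr fun s =>
      (hf' s).continuousAt)).intervalIntegrable _ _
  have hi₂ : IntervalIntegrable (fun s => (∫ r in (0 : ℝ)..s, A r) (f s)) volume 0 T :=
    ((continuous_iff_continuousAt.mpr fun s =>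
      (hA' s).continuousAt).clm_apply hf).intervalIntegrable _ _
  have hparts := intervalIntegral.integral_eq_sub_of_hasDerivAt
    (fun s _ => (hA' s).clm_apply (hf' s)) (hi₁.add hi₂)
  simp only [h0, intervalIntegral.integral_same, map_zero, sub_zero] at hparts
  rw [intervalIntegral.integral_add hi₁ hi₂] at hparts
  exact eq_neg_of_add_eq_zero_right hparts

namespace IsPeriodicField

variable {V W : Type*} [NormedAddCommGroup V] [NormedSpace ℝ V] [NormedAddCommGroup W]
  {O : Set (V × W)} {T₁ T₂ : ℝ} {f₁ f₂ : V × W → ℝ → ℝ → V} {g : V × W → ℝ → ℝ → (V × ℝ →L[ℝ] V)}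

theorem hasFDerivAt_fst (h : IsPeriodicField O T₁ T₂ f₁ f₂ g) {x : V} {z : W} (hθ : (x, z) ∈ O)
    (a b : ℝ) :
    HasFDerivAt (fun y => f₁ (y, z) a b) ((g (x, z) a b).comp (.inl ℝ V ℝ)) x :=
  HasFDerivAt.comp (g := fun q : V × ℝ => f₁ (q.1, z) q.2 b) (f := fun y : V => (y, a)) x
    (h.hasFDerivAt x z a b hθ) (hasFDerivAt_prodMk_left x a)

theorem hasDerivAt_phase (h : IsPeriodicField O T₁ T₂ f₁ f₂ g) {θ : V × W} (hθ : θ ∈ O)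
    (a b : ℝ) : HasDerivAt (fun a => f₁ θ a b) (g θ a b (0, 1)) a :=
  HasFDerivAt.comp_hasDerivAt (l := fun q : V × ℝ => f₁ (q.1, θ.2) q.2 b)
    (f := fun a : ℝ => (θ.1, a)) a (h.hasFDerivAt θ.1 θ.2 a b hθ)
    ((hasDerivAt_const a θ.1).prodMk (hasDerivAt_id a))

theorem continuous_deriv_fst (h : IsPeriodicField O T₁ T₂ f₁ f₂ g) {θ : V × W} (hθ : θ ∈ O)
    (a : ℝ) : Continuous fun b => (g θ a b).comp (.inl ℝ V ℝ) :=
  ((h.periodic_deriv.continuous_phases hθ).comp (f := fun b : ℝ => (a, b))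
    (by fun_prop)).clm_comp continuous_const

theorem continuous_primitive (h : IsPeriodicField O T₁ T₂ f₁ f₂ g) {θ : V × W} (hθ : θ ∈ O) :
    Continuous fun τ : ℝ × ℝ => ∫ r in (0 : ℝ)..τ.2, f₁ θ τ.1 r :=
  intervalIntegral.continuous_parametric_primitive_of_continuous
    (f := fun a r => f₁ θ a r) (h.periodic₁.continuous_phases hθ)

theorem exists_eventually_norm_deriv_fst_le (h : IsPeriodicField O T₁ T₂ f₁ f₂ g) {x : V} {z : W}
    (hθ : (x, z) ∈ O) (a : ℝ) :
    ∃ c, ∀ᶠ y in 𝓝 x, ∀ r, ‖(g (y, z) a r).comp (.inl ℝ V ℝ)‖ ≤ c := by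
  have hK : IsCompact ({(x, z)} : Set (V × W)) := isCompact_singleton
  have hKO : ({(x, z)} : Set (V × W)) ⊆ O := singleton_subset_iff.mpr hθ
  obtain ⟨c, -, hc⟩ := h.periodic_deriv.exists_norm_le h.T₁_pos h.T₂_pos hK hKO
  obtain ⟨κ, hκ, hunif⟩ := h.periodic_deriv.exists_norm_sub_lt h.T₁_pos h.T₂_pos h.isOpen hK hKO
    one_pos
  have hslice : Tendsto (fun y : V => (y, z)) (𝓝 x) (𝓝 (x, z)) :=
    (continuous_id.prodMk continuous_const).tendsto x
  refine ⟨c + 1, ?_⟩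
  filter_upwards [hslice (h.isOpen.mem_nhds hθ), hslice (Metric.ball_mem_nhds _ hκ)]
    with y hyO hyκ r
  have hclose := hunif _ rfl _ hyO a a r hyκ (by simpa using hκ)
  calc ‖(g (y, z) a r).comp (.inl ℝ V ℝ)‖
      ≤ ‖g (y, z) a r‖ * ‖ContinuousLinearMap.inl ℝ V ℝ‖ := ContinuousLinearMap.opNorm_comp_le _ _
    _ ≤ ‖g (y, z) a r‖ :=
      mul_le_of_le_one_right (norm_nonneg _) (ContinuousLinearMap.norm_inl_le_one ℝ V ℝ)
    _ ≤ c + 1 := by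
      linarith [norm_le_norm_sub_add (g (y, z) a r) (g (x, z) a r), hc _ rfl a r]

theorem hasFDerivAt_primitive (h : IsPeriodicField O T₁ T₂ f₁ f₂ g) {x : V} {z : W}
    (hθ : (x, z) ∈ O) (a b : ℝ) :
    HasFDerivAt (fun y => ∫ r in (0 : ℝ)..b, f₁ (y, z) a r)
      (∫ r in (0 : ℝ)..b, (g (x, z) a r).comp (.inl ℝ V ℝ)) x := by
  obtain ⟨c, hc⟩ := h.exists_eventually_norm_deriv_fst_le hθ a
  have hO : ∀ᶠ y in 𝓝 x, (y, z) ∈ O :=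
    (continuous_id.prodMk continuous_const).continuousAt (h.isOpen.mem_nhds hθ)
  have hcont : ∀ y, (y, z) ∈ O → Continuous fun r => f₁ (y, z) a r := fun y hy =>
    (h.periodic₁.continuous_phases hy).comp (f := fun r : ℝ => (a, r)) (by fun_prop)
  refine intervalIntegral.hasFDerivAt_integral_of_dominated_of_fderiv_le
    (F := fun y r => f₁ (y, z) a r) (F' := fun y r => (g (y, z) a r).comp (.inl ℝ V ℝ))
    (bound := fun _ => c) (hO.and hc) ?_ ((hcont x hθ).intervalIntegrable _ _)
    (h.continuous_deriv_fst hθ a).aestronglyMeasurable (.of_forall fun r _ y hy => hy.2 r)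
    (by simp) (.of_forall fun r _ y hy => h.hasFDerivAt_fst hy.1 a r)
  filter_upwards [hO] with y hy
  exact (hcont y hy).aestronglyMeasurable

theorem fastAverage_eq (h : IsPeriodicField O T₁ T₂ f₁ f₂ g) {θ : V × W} (hθ : θ ∈ O) (a : ℝ) :
    fastAverage T₂ f₁ f₂ g θ a = T₂⁻¹ •
      ((∫ b in (0 : ℝ)..T₂, (f₂ θ a b + g θ a b (∫ r in (0 : ℝ)..b, f₁ θ a r, 0))) +
        ∫ b in (0 : ℝ)..T₂, b • g θ a b (0, 1)) := by
  have hpair : Continuous fun b : ℝ => (a, b) := by fun_prop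
  have hg : Continuous fun b => g θ a b := (h.periodic_deriv.continuous_phases hθ).comp hpair
  have hf₂ : Continuous fun b => f₂ θ a b := (h.periodic₂.continuous_phases hθ).comp hpair
  have hu : Continuous fun b => ∫ r in (0 : ℝ)..b, f₁ θ a r :=
    (h.continuous_primitive hθ).comp hpair
  have hsum : Continuous fun b => f₂ θ a b + g θ a b (∫ r in (0 : ℝ)..b, f₁ θ a r, 0) :=
    hf₂.add (hg.clm_apply (hu.prodMk continuous_const))
  have hphase : Continuous fun b => b • g θ a b (0, 1) :=
    continuous_id.smul (hg.clm_apply continuous_const)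
  have hsplit : ∀ b v, g θ a b (v, b) = g θ a b (v, 0) + b • g θ a b (0, 1) := fun b v => by
    rw [← map_smul, ← map_add]
    simp
  rw [fastAverage, ← intervalIntegral.integral_add (hsum.intervalIntegrable _ _)
    (hphase.intervalIntegrable _ _)]
  congr 1
  refine intervalIntegral.integral_congr fun b _ => ?_
  simp only [hsplit]
  abel

variable [CompleteSpace V]

theorem integral_smul_deriv_phase_eq_zero (h : IsPeriodicField O T₁ T₂ f₁ f₂ g) {θ : V × W}
    (hθ : θ ∈ O) : ∫ a in (0 : ℝ)..T₁, ∫ b in (0 : ℝ)..T₂, b • g θ a b (0, 1) = 0 := by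
  have hcont : Continuous fun τ : ℝ × ℝ => g θ τ.1 τ.2 (0, 1) :=
    (h.periodic_deriv.continuous_phases hθ).clm_apply continuous_const
  have hzero : ∀ b, ∫ a in (0 : ℝ)..T₁, b • g θ a b (0, 1) = 0 := by
    intro b
    have hslice : Continuous fun a => g θ a b (0, 1) :=
      hcont.comp (f := fun a : ℝ => (a, b)) (by fun_prop)
    rw [intervalIntegral.integral_smul, intervalIntegral.integral_eq_sub_of_hasDerivAt
      (fun a _ => h.hasDerivAt_phase hθ a b) (hslice.intervalIntegrable _ _),
      (h.periodic₁.periodic_left θ hθ b).eq, sub_self, smul_zero]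
  rw [intervalIntegral_intervalIntegral_swap]
  · simp only [hzero, intervalIntegral.integral_zero]
  · exact ((continuous_snd.smul hcont).continuousOn.integrableOn_compact
      (isCompact_uIcc.prod isCompact_uIcc)).mono_set (prod_mono uIoc_subset_uIcc uIoc_subset_uIcc)

theorem integral_lieBracket_eq (h : IsPeriodicField O T₁ T₂ f₁ f₂ g) {x : V} {z : W}
    (hθ : (x, z) ∈ O) (a : ℝ) :
    ∫ b in (0 : ℝ)..T₂, (f₂ (x, z) a b + (1 / 2 : ℝ) •
        (fderiv ℝ (fun y => f₁ (y, z) a b) x (∫ r in (0 : ℝ)..b, f₁ (x, z) a r) -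
          fderiv ℝ (fun y => ∫ r in (0 : ℝ)..b, f₁ (y, z) a r) x (f₁ (x, z) a b))) =
      ∫ b in (0 : ℝ)..T₂, (f₂ (x, z) a b + g (x, z) a b (∫ r in (0 : ℝ)..b, f₁ (x, z) a r, 0)) := by
  have hpair : Continuous fun b : ℝ => (a, b) := by fun_prop
  have hf₁ : Continuous (f₁ (x, z) a) := (h.periodic₁.continuous_phases hθ).comp hpair
  have hf₂ : Continuous (f₂ (x, z) a) := (h.periodic₂.continuous_phases hθ).comp hpair
  have hg := h.continuous_deriv_fst hθ a
  set A : ℝ → V →L[ℝ] V := fun b => (g (x, z) a b).comp (.inl ℝ V ℝ)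
  set u : ℝ → V := fun b => ∫ r in (0 : ℝ)..b, f₁ (x, z) a r
  have hu : Continuous u := (h.continuous_primitive hθ).comp hpair
  have hAu : Continuous fun b => A b (u b) := hg.clm_apply hu
  have hPf : Continuous fun b => (∫ r in (0 : ℝ)..b, A r) (f₁ (x, z) a b) :=
    (intervalIntegral.continuous_primitive (fun _ _ => hg.intervalIntegrable _ _) 0).clm_apply hf₁
  have hdiff : Continuous fun b =>
      (1 / 2 : ℝ) • (A b (u b) - (∫ r in (0 : ℝ)..b, A r) (f₁ (x, z) a b)) :=
    (hAu.sub hPf).const_smul _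
  simp only [(h.hasFDerivAt_fst hθ a _).fderiv, (h.hasFDerivAt_primitive hθ a _).fderiv]
  change ∫ b in (0 : ℝ)..T₂, (f₂ (x, z) a b +
      (1 / 2 : ℝ) • (A b (u b) - (∫ r in (0 : ℝ)..b, A r) (f₁ (x, z) a b))) =
    ∫ b in (0 : ℝ)..T₂, (f₂ (x, z) a b + A b (u b))
  rw [intervalIntegral.integral_add (hf₂.intervalIntegrable _ _)
      (hdiff.intervalIntegrable _ _),
    intervalIntegral.integral_add (hf₂.intervalIntegrable _ _) (hAu.intervalIntegrable _ _),
    intervalIntegral.integral_smul, intervalIntegral.integral_sub (hAu.intervalIntegrable _ _)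
      (hPf.intervalIntegrable _ _),
    integral_primitive_apply_eq_neg hg hf₁ (h.integral_eq_zero _ hθ a)]
  module

theorem fullAverage_eq_lieBracket (h : IsPeriodicField O T₁ T₂ f₁ f₂ g) {x : V} {z : W}
    (hθ : (x, z) ∈ O) :
    fullAverage T₁ T₂ f₁ f₂ g (x, z) = (T₁ * T₂)⁻¹ • ∫ a in (0 : ℝ)..T₁, ∫ b in (0 : ℝ)..T₂,
      (f₂ (x, z) a b + (1 / 2 : ℝ) •
        (fderiv ℝ (fun y => f₁ (y, z) a b) x (∫ r in (0 : ℝ)..b, f₁ (x, z) a r) -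
          fderiv ℝ (fun y => ∫ r in (0 : ℝ)..b, f₁ (y, z) a r) x (f₁ (x, z) a b))) := by
  have hg := h.periodic_deriv.continuous_phases hθ
  have hbracket : Continuous fun τ : ℝ × ℝ =>
      f₂ (x, z) τ.1 τ.2 + g (x, z) τ.1 τ.2 (∫ r in (0 : ℝ)..τ.2, f₁ (x, z) τ.1 r, 0) :=
    (h.periodic₂.continuous_phases hθ).add
      (hg.clm_apply ((h.continuous_primitive hθ).prodMk continuous_const))
  have hphase : Continuous fun τ : ℝ × ℝ => τ.2 • g (x, z) τ.1 τ.2 (0, 1) :=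
    continuous_snd.smul (hg.clm_apply continuous_const)
  simp only [h.integral_lieBracket_eq hθ]
  rw [fullAverage, mul_inv, mul_smul]
  simp only [h.fastAverage_eq hθ]
  rw [intervalIntegral.integral_smul, intervalIntegral.integral_add,
    h.integral_smul_deriv_phase_eq_zero hθ, add_zero]
  · exact (intervalIntegral.continuous_parametric_intervalIntegral_of_continuous'
      hbracket _ _).intervalIntegrable _ _
  · exact (intervalIntegral.continuous_parametric_intervalIntegral_of_continuous'
      hphase _ _).intervalIntegrable _ _

end IsPeriodicField

/-! ### Extension of periodic functions of nonnegative phases -/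

theorem apply_toIcoMod_eq {Y : Type*} {F : ℝ → Y} {T : ℝ} (hT : 0 < T)
    (h : ∀ a, 0 ≤ a → F (a + T) = F a) {a : ℝ} (ha : 0 ≤ a) : F (toIcoMod hT 0 a) = F a := by
  have hnsmul : ∀ (k : ℕ) (c : ℝ), 0 ≤ c → F (c + k • T) = F c := by
    intro k c hc
    induction k with
    | zero => simp
    | succ k ih => rw [succ_nsmul, ← add_assoc, h _ (by positivity), ih]
  have hdiv : 0 ≤ toIcoDiv hT 0 a := by
    rw [toIcoDiv_eq_floor, sub_zero]
    positivity
  obtain ⟨k, hk⟩ := Int.eq_ofNat_of_zero_le hdiv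
  have hsum : toIcoMod hT 0 a + k • T = a := by
    rw [← natCast_zsmul, ← hk, toIcoMod_add_toIcoDiv_zsmul]
  rw [← hnsmul k _ (left_le_toIcoMod hT 0 a), hsum]

theorem exists_add_nsmul_pos {T : ℝ} (hT : 0 < T) (a : ℝ) : ∃ m : ℕ, 0 < a + m • T := by
  obtain ⟨m, hm⟩ := exists_lt_nsmul hT (-a)
  exact ⟨m, by linarith⟩

theorem eventually_add_phases_pos {Θ : Type*} [TopologicalSpace Θ] {p : Θ × (ℝ × ℝ)} {s t : ℝ}
    (hs : 0 < p.2.1 + s) (ht : 0 < p.2.2 + t) :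
    ∀ᶠ q in 𝓝 p, 0 < q.2.1 + s ∧ 0 < q.2.2 + t := by
  have hleft : ContinuousAt (fun q : Θ × (ℝ × ℝ) => q.2.1 + s) p := by fun_prop
  have hright : ContinuousAt (fun q : Θ × (ℝ × ℝ) => q.2.2 + t) p := by fun_prop
  exact (hleft.eventually (lt_mem_nhds hs)).and (hright.eventually (lt_mem_nhds ht))

-- Near any real phases, `F` is `φ` evaluated at phases shifted into the open first quadrant.
theorem continuousOn_of_forall_eq_add_nsmul {Θ Y : Type*} [TopologicalSpace Θ]
    [TopologicalSpace Y] {O : Set Θ} {T₁ T₂ : ℝ} (hT₁ : 0 < T₁) (hT₂ : 0 < T₂)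
    {F φ : Θ → ℝ → ℝ → Y}
    (hφ : ContinuousOn (fun p : Θ × (ℝ × ℝ) => φ p.1 p.2.1 p.2.2) (withPhases O))
    (h : ∀ θ ∈ O, ∀ (m n : ℕ) (a b : ℝ), 0 < a + m • T₁ → 0 < b + n • T₂ →
      F θ a b = φ θ (a + m • T₁) (b + n • T₂)) :
    ContinuousOn (fun p : Θ × (ℝ × ℝ) => F p.1 p.2.1 p.2.2) (O ×ˢ univ) := by
  intro p hp
  obtain ⟨m, hm⟩ := exists_add_nsmul_pos hT₁ p.2.1
  obtain ⟨n, hn⟩ := exists_add_nsmul_pos hT₂ p.2.2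
  have hpos := nhdsWithin_le_nhds (s := O ×ˢ univ) (eventually_add_phases_pos hm hn)
  have hshift : Continuous fun q : Θ × (ℝ × ℝ) => (q.1, (q.2.1 + m • T₁, q.2.2 + n • T₂)) := by
    fun_prop
  have hlim : Tendsto (fun q : Θ × (ℝ × ℝ) => (q.1, (q.2.1 + m • T₁, q.2.2 + n • T₂)))
      (𝓝[O ×ˢ univ] p) (𝓝[withPhases O] (p.1, (p.2.1 + m • T₁, p.2.2 + n • T₂))) := by
    refine tendsto_nhdsWithin_iff.mpr ⟨(hshift.tendsto p).mono_left nhdsWithin_le_nhds, ?_⟩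
    filter_upwards [self_mem_nhdsWithin, hpos] with q hq hq'
    exact ⟨hq.1, hq'.1.le, hq'.2.le⟩
  rw [ContinuousWithinAt, h p.1 hp.1 m n _ _ hm hn]
  have hφ' := hφ (p.1, (p.2.1 + m • T₁, p.2.2 + n • T₂)) ⟨hp.1, hm.le, hn.le⟩
  refine (hφ'.tendsto.comp hlim).congr' ?_
  filter_upwards [self_mem_nhdsWithin, hpos] with q hq hq'
  exact (h q.1 hq.1 m n _ _ hq'.1 hq'.2).symm

/-- A continuous function on `Q × [0,∞)²` with period `T₁` in the first phase and period `T₂` in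
the second one. -/
structure IsPhasePeriodicOn {V W Y : Type*} [TopologicalSpace V] [TopologicalSpace W]
    [TopologicalSpace Y] (φ : V → W → ℝ → ℝ → Y) (T₁ T₂ : ℝ) (Q : Set (V × W)) : Prop where
  continuousOn : ContinuousOn (fun p : (V × W) × (ℝ × ℝ) => φ p.1.1 p.1.2 p.2.1 p.2.2)
    (withPhases Q)
  periodic_left : ∀ x z τ₁ τ₂, (x, z) ∈ Q → 0 ≤ τ₁ → 0 ≤ τ₂ → φ x z (τ₁ + T₁) τ₂ = φ x z τ₁ τ₂
  periodic_right : ∀ x z τ₁ τ₂, (x, z) ∈ Q → 0 ≤ τ₁ → 0 ≤ τ₂ → φ x z τ₁ (τ₂ + T₂) = φ x z τ₁ τ₂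

/-- The extension of a function of nonnegative phases to a function of real phases with periods
`T₁` and `T₂`. -/
noncomputable def extendPhases {V W Y : Type*} {T₁ T₂ : ℝ} (hT₁ : 0 < T₁) (hT₂ : 0 < T₂)
    (φ : V → W → ℝ → ℝ → Y) (θ : V × W) (a b : ℝ) : Y :=
  φ θ.1 θ.2 (toIcoMod hT₁ 0 a) (toIcoMod hT₂ 0 b)

namespace IsPhasePeriodicOn

section

variable {V W Y : Type*} [TopologicalSpace V] [TopologicalSpace W] [TopologicalSpace Y]
  {φ : V → W → ℝ → ℝ → Y} {T₁ T₂ : ℝ} {Q : Set (V × W)}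

theorem extendPhases_eq (h : IsPhasePeriodicOn φ T₁ T₂ Q) (hT₁ : 0 < T₁) (hT₂ : 0 < T₂)
    {θ : V × W} (hθ : θ ∈ Q) (m n : ℕ) {a b : ℝ} (ha : 0 ≤ a + m • T₁) (hb : 0 ≤ b + n • T₂) :
    extendPhases hT₁ hT₂ φ θ a b = φ θ.1 θ.2 (a + m • T₁) (b + n • T₂) := by
  rw [extendPhases, ← toIcoMod_add_nsmul hT₁ 0 a m, ← toIcoMod_add_nsmul hT₂ 0 b n,
    apply_toIcoMod_eq (F := fun a => φ θ.1 θ.2 a _) hT₁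
      (fun a ha => h.periodic_left _ _ _ _ hθ ha (left_le_toIcoMod hT₂ 0 _)) ha]
  exact apply_toIcoMod_eq (F := fun b => φ θ.1 θ.2 _ b) hT₂
    (fun b hb => h.periodic_right _ _ _ _ hθ ha hb) hb

theorem extendPhases_of_nonneg (h : IsPhasePeriodicOn φ T₁ T₂ Q) (hT₁ : 0 < T₁) (hT₂ : 0 < T₂)
    {θ : V × W} (hθ : θ ∈ Q) {a b : ℝ} (ha : 0 ≤ a) (hb : 0 ≤ b) :
    extendPhases hT₁ hT₂ φ θ a b = φ θ.1 θ.2 a b := by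
  simpa only [zero_nsmul, add_zero] using
    h.extendPhases_eq hT₁ hT₂ hθ 0 0 (by simpa using ha) (by simpa using hb)

theorem isDoublyPeriodicOn_extendPhases (h : IsPhasePeriodicOn φ T₁ T₂ Q) (hT₁ : 0 < T₁)
    (hT₂ : 0 < T₂) : IsDoublyPeriodicOn (extendPhases hT₁ hT₂ φ) T₁ T₂ (interior Q) where
  continuousOn := continuousOn_of_forall_eq_add_nsmul hT₁ hT₂ (φ := fun θ a b => φ θ.1 θ.2 a b)
    (h.continuousOn.mono (prod_mono interior_subset Subset.rfl))
    fun _ hθ m n _ _ ha hb => h.extendPhases_eq hT₁ hT₂ (interior_subset hθ) m n ha.le hb.le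
  periodic_left θ _ b a := by simp only [extendPhases, toIcoMod_add_right]
  periodic_right θ _ a b := by simp only [extendPhases, toIcoMod_add_right]

end

theorem hasFDerivAt_extendPhases {V W Y : Type*} [NormedAddCommGroup V] [NormedSpace ℝ V]
    [TopologicalSpace W] [NormedAddCommGroup Y] [NormedSpace ℝ Y] {φ : V → W → ℝ → ℝ → Y}
    {T₁ T₂ : ℝ} {Q : Set (V × W)} (h : IsPhasePeriodicOn φ T₁ T₂ Q) (hT₁ : 0 < T₁)
    (hT₂ : 0 < T₂) {x : V} {z : W} (hθ : (x, z) ∈ interior Q) (m n : ℕ) {a b : ℝ}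
    (ha : 0 < a + m • T₁) (hb : 0 < b + n • T₂) {g' : V × ℝ →L[ℝ] Y}
    (hg' : HasFDerivWithinAt (fun q : V × ℝ => φ q.1 z q.2 (b + n • T₂)) g'
      {q | ((q.1, z), (q.2, b + n • T₂)) ∈ withPhases Q} (x, a + m • T₁)) :
    HasFDerivAt (fun q : V × ℝ => extendPhases hT₁ hT₂ φ (q.1, z) q.2 b) g' (x, a) := by
  have hQ : ∀ c : ℝ, ∀ᶠ q : V × ℝ in 𝓝 (x, c), (q.1, z) ∈ Q := fun c =>
    ((continuous_fst.prodMk continuous_const).tendsto (x, c)).eventually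
      (mem_interior_iff_mem_nhds.mp hθ)
  have hφ : HasFDerivAt (fun q : V × ℝ => φ q.1 z q.2 (b + n • T₂)) g' ((x, a) + (0, m • T₁)) := by
    have hmem : {q : V × ℝ | ((q.1, z), (q.2, b + n • T₂)) ∈ withPhases Q} ∈
        𝓝 (x, a + m • T₁) := by
      filter_upwards [hQ _, continuousAt_snd.eventually (lt_mem_nhds ha)] with q hq hq'
      exact ⟨hq, le_of_lt hq', hb.le⟩
    rw [Prod.mk_add_mk, add_zero]
    exact hg'.hasFDerivAt hmem
  have hpos : ∀ᶠ q : V × ℝ in 𝓝 (x, a), 0 < q.2 + m • T₁ :=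
    (show ContinuousAt (fun q : V × ℝ => q.2 + m • T₁) (x, a) by fun_prop).eventually
      (lt_mem_nhds ha)
  refine ((hasFDerivAt_comp_add_right _).mpr hφ).congr_of_eventuallyEq ?_
  filter_upwards [hQ a, hpos] with q hq hq'
  simpa using h.extendPhases_eq hT₁ hT₂ hq m n hq'.le hb.le

end IsPhasePeriodicOn

theorem subset_interior_euclideanInflation {n₁ n₂ : ℕ} (C : Set (OscState n₁ n₂)) {δ : ℝ}
    (hδ : 0 < δ) : C ⊆ interior (euclideanInflation C δ) := by
  intro θ hθ
  rw [mem_interior_iff_mem_nhds]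
  refine Filter.mem_of_superset (Metric.ball_mem_nhds θ (half_pos hδ)) fun q hq => ⟨θ, hθ, ?_⟩
  rw [Metric.mem_ball', Prod.dist_eq, max_lt_iff, dist_eq_norm, dist_eq_norm] at hq
  have hfst := pow_le_pow_left₀ (norm_nonneg _) hq.1.le 2
  have hsnd := pow_le_pow_left₀ (norm_nonneg _) hq.2.le 2
  nlinarith [sq_nonneg δ]

namespace OscillatoryData

variable {n₁ n₂ : ℕ} {S : OscillatoryData n₁ n₂} {δ T₁ T₂ : ℝ}

/-- The conditions on `φ₁`, `φ₂` over `C_δ × [0,∞)²` for second-order averaging: both are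
continuous and periodic, `φ₁` has zero mean in the second phase, is continuously differentiable in
`(x, τ₁)` and locally Lipschitz in `z`. -/
structure AveragingAssumption (S : OscillatoryData n₁ n₂) (δ T₁ T₂ : ℝ) : Prop where
  δ_pos : 0 < δ
  T₁_pos : 0 < T₁
  T₂_pos : 0 < T₂
  periodic_φ₁ : IsPhasePeriodicOn S.φ₁ T₁ T₂ (euclideanInflation S.C δ)
  periodic_φ₂ : IsPhasePeriodicOn S.φ₂ T₁ T₂ (euclideanInflation S.C δ)
  exists_deriv : ∃ g' : EuclideanSpace ℝ (Fin n₁) → EuclideanSpace ℝ (Fin n₂) → ℝ → ℝ →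
      (EuclideanSpace ℝ (Fin n₁) × ℝ →L[ℝ] EuclideanSpace ℝ (Fin n₁)),
    (∀ x z τ₁ τ₂, ((x, z), (τ₁, τ₂)) ∈ withPhases (euclideanInflation S.C δ) →
      HasFDerivWithinAt (fun q : EuclideanSpace ℝ (Fin n₁) × ℝ => S.φ₁ q.1 z q.2 τ₂)
        (g' x z τ₁ τ₂) {q | ((q.1, z), (q.2, τ₂)) ∈ withPhases (euclideanInflation S.C δ)}
        (x, τ₁)) ∧
    ContinuousOn (fun p : OscState n₁ n₂ × (ℝ × ℝ) => g' p.1.1 p.1.2 p.2.1 p.2.2)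
      (withPhases (euclideanInflation S.C δ))
  lipschitz_φ₁ : LocallyLipschitzInZ S.φ₁ (withPhases (euclideanInflation S.C δ))
  zeroAverage : ∀ x z τ₁, (x, z) ∈ euclideanInflation S.C δ → 0 ≤ τ₁ →
    ∫ s in (0 : ℝ)..T₂, S.φ₁ x z τ₁ s = 0

theorem OscillationAssumption.averagingAssumption (h : S.OscillationAssumption δ T₁ T₂) :
    S.AveragingAssumption δ T₁ T₂ where
  δ_pos := h.δ_pos
  T₁_pos := h.T₁_pos
  T₂_pos := h.T₂_pos
  periodic_φ₁ := ⟨h.continuous_φ₁, h.periodic₁_φ₁, h.periodic₂_φ₁⟩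
  periodic_φ₂ := ⟨h.continuous_φ₂, h.periodic₁_φ₂, h.periodic₂_φ₂⟩
  exists_deriv :=
    let ⟨g', hg', hcont, _⟩ := h.c1_φ₁
    ⟨g', hg', hcont⟩
  lipschitz_φ₁ := h.c0_z_φ₁
  zeroAverage := h.zeroAverage

/-- The differential of the periodic extension of `φ₁` with respect to `(x, τ₁)`. -/
noncomputable def extendedDeriv (S : OscillatoryData n₁ n₂) {T₁ T₂ : ℝ} (hT₁ : 0 < T₁)
    (hT₂ : 0 < T₂) (θ : OscState n₁ n₂) (a b : ℝ) :
    EuclideanSpace ℝ (Fin n₁) × ℝ →L[ℝ] EuclideanSpace ℝ (Fin n₁) :=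
  fderiv ℝ (fun q : EuclideanSpace ℝ (Fin n₁) × ℝ =>
    extendPhases hT₁ hT₂ S.φ₁ (q.1, θ.2) q.2 b) (θ.1, a)

namespace AveragingAssumption

theorem continuousOn_extendedDeriv (h : S.AveragingAssumption δ T₁ T₂) :
    ContinuousOn (fun p : OscState n₁ n₂ × (ℝ × ℝ) =>
      S.extendedDeriv h.T₁_pos h.T₂_pos p.1 p.2.1 p.2.2)
      (interior (euclideanInflation S.C δ) ×ˢ univ) := by
  obtain ⟨g', hg', hcont⟩ := h.exists_deriv
  exact continuousOn_of_forall_eq_add_nsmul h.T₁_pos h.T₂_pos (φ := fun θ a b => g' θ.1 θ.2 a b)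
    (hcont.mono (prod_mono interior_subset Subset.rfl)) fun θ hθ m n a b ha hb =>
      (h.periodic_φ₁.hasFDerivAt_extendPhases h.T₁_pos h.T₂_pos hθ m n ha hb
        (hg' _ _ _ _ ⟨interior_subset hθ, ha.le, hb.le⟩)).fderiv

theorem hasFDerivAt_extendPhases (h : S.AveragingAssumption δ T₁ T₂)
    {x : EuclideanSpace ℝ (Fin n₁)} {z : EuclideanSpace ℝ (Fin n₂)}
    (hθ : (x, z) ∈ interior (euclideanInflation S.C δ)) (a b : ℝ) :
    HasFDerivAt (fun q : EuclideanSpace ℝ (Fin n₁) × ℝ =>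
      extendPhases h.T₁_pos h.T₂_pos S.φ₁ (q.1, z) q.2 b)
      (S.extendedDeriv h.T₁_pos h.T₂_pos (x, z) a b) (x, a) := by
  obtain ⟨g', hg', -⟩ := h.exists_deriv
  obtain ⟨m, hm⟩ := exists_add_nsmul_pos h.T₁_pos a
  obtain ⟨n, hn⟩ := exists_add_nsmul_pos h.T₂_pos b
  exact (h.periodic_φ₁.hasFDerivAt_extendPhases h.T₁_pos h.T₂_pos hθ m n hm hn
    (hg' _ _ _ _ ⟨interior_subset hθ, hm.le, hn.le⟩)).differentiableAt.hasFDerivAt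

theorem lipschitz_extendPhases (h : S.AveragingAssumption δ T₁ T₂) {θ : OscState n₁ n₂}
    (hθ : θ ∈ interior (euclideanInflation S.C δ)) (a b : ℝ) :
    ∃ N ∈ 𝓝 (θ, (a, b)), ∃ L : ℝ, ∀ x z z' a b,
      ((x, z), (a, b)) ∈ N → ((x, z'), (a, b)) ∈ N →
        ‖extendPhases h.T₁_pos h.T₂_pos S.φ₁ (x, z) a b -
          extendPhases h.T₁_pos h.T₂_pos S.φ₁ (x, z') a b‖ ≤ L * ‖z - z'‖ := by
  obtain ⟨m, hm⟩ := exists_add_nsmul_pos h.T₁_pos a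
  obtain ⟨n, hn⟩ := exists_add_nsmul_pos h.T₂_pos b
  obtain ⟨N, hN, L, hL⟩ := h.lipschitz_φ₁ (θ, (a + m • T₁, b + n • T₂))
    ⟨interior_subset hθ, hm.le, hn.le⟩
  have hinfl : ∀ᶠ p : OscState n₁ n₂ × (ℝ × ℝ) in 𝓝 (θ, (a, b)),
      p.1 ∈ euclideanInflation S.C δ :=
    continuousAt_fst.eventually (mem_interior_iff_mem_nhds.mp hθ)
  have hshift : Continuous fun q : OscState n₁ n₂ × (ℝ × ℝ) =>
      (q.1, (q.2.1 + m • T₁, q.2.2 + n • T₂)) := by fun_prop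
  refine ⟨_, ((hshift.tendsto (θ, (a, b))).eventually hN).and
    (hinfl.and (eventually_add_phases_pos (p := (θ, (a, b))) hm hn)), L, ?_⟩
  rintro x z z' a b ⟨hpN, hp, ha, hb⟩ ⟨hpN', hp', -, -⟩
  rw [h.periodic_φ₁.extendPhases_eq _ _ hp m n ha.le hb.le,
    h.periodic_φ₁.extendPhases_eq _ _ hp' m n ha.le hb.le]
  exact hL x z z' _ _ ⟨hpN, hp, ha.le, hb.le⟩ ⟨hpN', hp', ha.le, hb.le⟩

theorem integral_extendPhases_eq_zero (h : S.AveragingAssumption δ T₁ T₂) {θ : OscState n₁ n₂}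
    (hθ : θ ∈ euclideanInflation S.C δ) (a : ℝ) :
    ∫ s in (0 : ℝ)..T₂, extendPhases h.T₁_pos h.T₂_pos S.φ₁ θ a s = 0 := by
  have ha := left_le_toIcoMod h.T₁_pos 0 a
  rw [← h.zeroAverage θ.1 θ.2 _ hθ ha]
  refine intervalIntegral.integral_congr fun s hs => ?_
  rw [uIcc_of_le h.T₂_pos.le] at hs
  exact apply_toIcoMod_eq (F := fun b => S.φ₁ θ.1 θ.2 _ b) h.T₂_pos
    (fun b hb => h.periodic_φ₁.periodic_right _ _ _ _ hθ ha hb) hs.1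

theorem isPeriodicField (h : S.AveragingAssumption δ T₁ T₂) :
    IsPeriodicField (interior (euclideanInflation S.C δ)) T₁ T₂
      (extendPhases h.T₁_pos h.T₂_pos S.φ₁) (extendPhases h.T₁_pos h.T₂_pos S.φ₂)
      (S.extendedDeriv h.T₁_pos h.T₂_pos) where
  isOpen := isOpen_interior
  T₁_pos := h.T₁_pos
  T₂_pos := h.T₂_pos
  periodic₁ := h.periodic_φ₁.isDoublyPeriodicOn_extendPhases _ _
  periodic₂ := h.periodic_φ₂.isDoublyPeriodicOn_extendPhases _ _
  continuousOn_deriv := h.continuousOn_extendedDeriv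
  hasFDerivAt _ _ a b hθ := h.hasFDerivAt_extendPhases hθ a b
  lipschitz _ hθ a b := h.lipschitz_extendPhases hθ a b
  integral_eq_zero _ hθ a := h.integral_extendPhases_eq_zero (interior_subset hθ) a

theorem integral_extendPhases_eq_u₁ (h : S.AveragingAssumption δ T₁ T₂) {θ : OscState n₁ n₂}
    (hθ : θ ∈ euclideanInflation S.C δ) {a b : ℝ} (ha : 0 ≤ a) (hb : 0 ≤ b) :
    ∫ r in (0 : ℝ)..b, extendPhases h.T₁_pos h.T₂_pos S.φ₁ θ a r = S.u₁ θ.1 θ.2 a b :=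
  intervalIntegral.integral_congr fun r hr => by
    rw [uIcc_of_le hb] at hr
    exact h.periodic_φ₁.extendPhases_of_nonneg _ _ hθ ha hr.1

theorem fullAverage_extendPhases (h : S.AveragingAssumption δ T₁ T₂) {θ : OscState n₁ n₂}
    (hθ : θ ∈ interior (euclideanInflation S.C δ)) :
    fullAverage T₁ T₂ (extendPhases h.T₁_pos h.T₂_pos S.φ₁)
      (extendPhases h.T₁_pos h.T₂_pos S.φ₂) (S.extendedDeriv h.T₁_pos h.T₂_pos) θ =
      S.averageMap T₁ T₂ θ := by
  obtain ⟨x, z⟩ := θ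
  have hev : ∀ᶠ y in 𝓝 x, (y, z) ∈ euclideanInflation S.C δ :=
    ((continuous_id.prodMk continuous_const).tendsto x).eventually
      (mem_interior_iff_mem_nhds.mp hθ)
  have hθ' := interior_subset hθ
  rw [h.isPeriodicField.fullAverage_eq_lieBracket hθ, averageMap]
  congr 1
  refine intervalIntegral.integral_congr fun a ha => intervalIntegral.integral_congr fun b hb => ?_
  rw [uIcc_of_le h.T₁_pos.le] at ha
  rw [uIcc_of_le h.T₂_pos.le] at hb
  have hderiv_φ₁ : fderiv ℝ (fun y => extendPhases h.T₁_pos h.T₂_pos S.φ₁ (y, z) a b) x =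
      fderiv ℝ (fun y => S.φ₁ y z a b) x :=
    Filter.EventuallyEq.fderiv_eq (hev.mono fun y hy =>
      h.periodic_φ₁.extendPhases_of_nonneg _ _ hy ha.1 hb.1)
  have hderiv_u₁ : fderiv ℝ (fun y => ∫ r in (0 : ℝ)..b,
      extendPhases h.T₁_pos h.T₂_pos S.φ₁ (y, z) a r) x = fderiv ℝ (fun y => S.u₁ y z a b) x :=
    Filter.EventuallyEq.fderiv_eq (hev.mono fun y hy =>
      h.integral_extendPhases_eq_u₁ hy ha.1 hb.1)
  simp only [lieBracket, hderiv_φ₁, hderiv_u₁, h.integral_extendPhases_eq_u₁ hθ' ha.1 hb.1,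
    h.periodic_φ₁.extendPhases_of_nonneg _ _ hθ' ha.1 hb.1,
    h.periodic_φ₂.extendPhases_of_nonneg _ _ hθ' ha.1 hb.1]

end AveragingAssumption

end OscillatoryData

/-! ### Limits of asymptotically Lipschitz curves -/

theorem tendsto_max_min_of_mem_Icc {ι : Type*} {l : Filter ι} {a b : ι → ℝ} {a₀ b₀ s : ℝ}
    (ha : Tendsto a l (𝓝 a₀)) (hb : Tendsto b l (𝓝 b₀)) (hs : s ∈ Icc a₀ b₀) :
    Tendsto (fun i => max (a i) (min (b i) s)) l (𝓝 s) := by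
  have hlim := ha.max (hb.min (tendsto_const_nhds (x := s)))
  rwa [min_eq_right hs.2, max_eq_right hs.1] at hlim

theorem norm_sub_le_mul_abs_sub_add {E : Type*} [NormedAddCommGroup E] {θ : ℝ → E} {a b c e : ℝ}
    (h : ∀ s ∈ Icc a b, ∀ t ∈ Icc a b, s ≤ t → ‖θ t - θ s‖ ≤ c * (t - s) + e) {s t : ℝ}
    (hs : s ∈ Icc a b) (ht : t ∈ Icc a b) : ‖θ t - θ s‖ ≤ c * |t - s| + e := by
  rcases le_total s t with hst | hst
  · rw [abs_of_nonneg (sub_nonneg.mpr hst)]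
    exact h s hs t ht hst
  · rw [norm_sub_rev, abs_sub_comm, abs_of_nonneg (sub_nonneg.mpr hst)]
    exact h t ht s hs hst

/-- `Θ` on `[a₀, b₀]` is the limit along `U` of the curves `θ i` on `[a i, b i]`, which are
`c`-Lipschitz up to errors `e i` that vanish along `U`. -/
structure IsLimitCurve {ι E : Type*} [NormedAddCommGroup E] (U : Ultrafilter ι) (θ : ι → ℝ → E)
    (a b : ι → ℝ) (c : ℝ) (e : ι → ℝ) (Θ : ℝ → E) (a₀ b₀ : ℝ) : Prop where
  c_nonneg : 0 ≤ c
  tendsto_left : Tendsto a U (𝓝 a₀)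
  tendsto_right : Tendsto b U (𝓝 b₀)
  tendsto_error : Tendsto e U (𝓝 0)
  le : ∀ᶠ i in (U : Filter ι), a i ≤ b i
  norm_sub_le_add : ∀ᶠ i in (U : Filter ι), ∀ s ∈ Icc (a i) (b i), ∀ t ∈ Icc (a i) (b i), s ≤ t →
    ‖θ i t - θ i s‖ ≤ c * (t - s) + e i
  tendsto : ∀ (r : ι → ℝ) (r₀ : ℝ), (∀ᶠ i in (U : Filter ι), r i ∈ Icc (a i) (b i)) →
    Tendsto r U (𝓝 r₀) → Tendsto (fun i => θ i (r i)) U (𝓝 (Θ r₀))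

namespace IsLimitCurve

variable {ι E F : Type*} [NormedAddCommGroup E] {U : Ultrafilter ι} {θ : ι → ℝ → E}
  {a b e : ι → ℝ} {a₀ b₀ c s t t₀ : ℝ} {Θ : ℝ → E}

theorem exists_of_norm_le [ProperSpace E] {ρ : ℝ} (hc : 0 ≤ c) (ha : Tendsto a U (𝓝 a₀))
    (hb : Tendsto b U (𝓝 b₀)) (he : Tendsto e U (𝓝 0))
    (hab : ∀ᶠ i in (U : Filter ι), a i ≤ b i)
    (hρ : ∀ᶠ i in (U : Filter ι), ∀ s ∈ Icc (a i) (b i), ‖θ i s‖ ≤ ρ)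
    (hθ : ∀ᶠ i in (U : Filter ι), ∀ s ∈ Icc (a i) (b i), ∀ t ∈ Icc (a i) (b i), s ≤ t →
      ‖θ i t - θ i s‖ ≤ c * (t - s) + e i) :
    ∃ Θ, IsLimitCurve U θ a b c e Θ a₀ b₀ := by
  have hlim (s : ℝ) : ∃ p, Tendsto (fun i => θ i (max (a i) (min (b i) s))) U (𝓝 p) :=
    exists_tendsto_ultrafilter_of_norm_le (c := ρ) (by
      filter_upwards [hab, hρ] with i hi hρi
      exact hρi _ (projIcc (a i) (b i) hi s).2)
  choose Θ hΘ using hlim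
  refine ⟨Θ, hc, ha, hb, he, hab, hθ, fun r r₀ hr hrt => ?_⟩
  have herror : Tendsto (fun i => c * |r i - r₀| + e i) U (𝓝 0) := by
    simpa using (((hrt.sub_const r₀).abs).const_mul c).add he
  have hdiff : Tendsto (fun i => θ i (r i) - θ i (max (a i) (min (b i) r₀))) U (𝓝 0) := by
    refine squeeze_zero_norm' ?_ herror
    filter_upwards [hab, hr, hθ] with i hi hri hθi
    have hproj : |r i - max (a i) (min (b i) r₀)| ≤ |r i - r₀| := by
      simpa only [projIcc_of_mem hi hri, coe_projIcc] using
        abs_projIcc_sub_projIcc (h := hi) (c := r i) (d := r₀)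
    have hmem : max (a i) (min (b i) r₀) ∈ Icc (a i) (b i) := (projIcc (a i) (b i) hi r₀).2
    exact (norm_sub_le_mul_abs_sub_add hθi hmem hri).trans (by gcongr)
  simpa using hdiff.add (hΘ r₀)

theorem eventually_max_min_mem (h : IsLimitCurve U θ a b c e Θ a₀ b₀) (s : ℝ) :
    ∀ᶠ i in (U : Filter ι), max (a i) (min (b i) s) ∈ Icc (a i) (b i) := by
  filter_upwards [h.le] with i hi
  exact (projIcc (a i) (b i) hi s).2

theorem tendsto_max_min (h : IsLimitCurve U θ a b c e Θ a₀ b₀) (hs : s ∈ Icc a₀ b₀) :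
    Tendsto (fun i => max (a i) (min (b i) s)) U (𝓝 s) :=
  tendsto_max_min_of_mem_Icc h.tendsto_left h.tendsto_right hs

theorem tendsto_apply_max_min (h : IsLimitCurve U θ a b c e Θ a₀ b₀) (hs : s ∈ Icc a₀ b₀) :
    Tendsto (fun i => θ i (max (a i) (min (b i) s))) U (𝓝 (Θ s)) :=
  h.tendsto _ _ (h.eventually_max_min_mem s) (h.tendsto_max_min hs)

theorem norm_sub_le (h : IsLimitCurve U θ a b c e Θ a₀ b₀) (hs : s ∈ Icc a₀ b₀)
    (ht : t ∈ Icc a₀ b₀) : ‖Θ t - Θ s‖ ≤ c * |t - s| := by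
  have hbound := ((((h.tendsto_max_min ht).sub (h.tendsto_max_min hs)).abs).const_mul c).add
    h.tendsto_error
  rw [add_zero] at hbound
  refine le_of_tendsto_of_tendsto
    ((h.tendsto_apply_max_min ht).sub (h.tendsto_apply_max_min hs)).norm hbound ?_
  filter_upwards [h.eventually_max_min_mem s, h.eventually_max_min_mem t, h.norm_sub_le_add]
    with i hsi hti hi
  exact norm_sub_le_mul_abs_sub_add hi hsi hti

theorem lipschitzOnWith (h : IsLimitCurve U θ a b c e Θ a₀ b₀) :
    LipschitzOnWith c.toNNReal Θ (Icc a₀ b₀) :=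
  LipschitzOnWith.of_dist_le_mul fun s hs t ht => by
    rw [dist_eq_norm, Real.dist_eq, Real.coe_toNNReal _ h.c_nonneg]
    exact h.norm_sub_le ht hs

theorem mem_of_isClosed (h : IsLimitCurve U θ a b c e Θ a₀ b₀) {Q : Set E} (hQ : IsClosed Q)
    (hmem : ∀ᶠ i in (U : Filter ι), ∀ s ∈ Icc (a i) (b i), θ i s ∈ Q) (hs : s ∈ Icc a₀ b₀) :
    Θ s ∈ Q := by
  refine hQ.mem_of_tendsto (h.tendsto_apply_max_min hs) ?_
  filter_upwards [h.eventually_max_min_mem s, hmem] with i hsi hi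
  exact hi _ hsi

theorem exists_eventually_dist_lt (h : IsLimitCurve U θ a b c e Θ a₀ b₀) (ht₀ : t₀ ∈ Icc a₀ b₀)
    {κ : ℝ} (hκ : 0 < κ) :
    ∃ σ > 0, ∀ᶠ i in (U : Filter ι), ∀ r ∈ Icc (a i) (b i), |r - t₀| < σ →
      dist (θ i r) (Θ t₀) < κ := by
  have hc := h.c_nonneg
  obtain ⟨σ, hσ, hcσ⟩ : ∃ σ > 0, c * σ < κ := by
    refine ⟨κ / (c + 1), by positivity, ?_⟩
    rw [← mul_div_assoc, div_lt_iff₀ (by positivity)]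
    nlinarith
  refine ⟨σ, hσ, ?_⟩
  have herror : Tendsto (fun i => c * (σ + |t₀ - max (a i) (min (b i) t₀)|) + e i +
      dist (θ i (max (a i) (min (b i) t₀))) (Θ t₀)) U (𝓝 (c * σ)) := by
    simpa using ((((((h.tendsto_max_min ht₀).const_sub t₀).abs).const_add σ).const_mul c).add
      h.tendsto_error).add (tendsto_iff_dist_tendsto_zero.mp (h.tendsto_apply_max_min ht₀))
  filter_upwards [herror.eventually (gt_mem_nhds hcσ), h.eventually_max_min_mem t₀,
    h.norm_sub_le_add] with i hi hmem hθi r hr hrσ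
  calc dist (θ i r) (Θ t₀)
      ≤ dist (θ i r) (θ i (max (a i) (min (b i) t₀))) +
        dist (θ i (max (a i) (min (b i) t₀))) (Θ t₀) := dist_triangle _ _ _
    _ ≤ c * (σ + |t₀ - max (a i) (min (b i) t₀)|) + e i +
        dist (θ i (max (a i) (min (b i) t₀))) (Θ t₀) := by
      rw [dist_eq_norm]
      have habs := (abs_sub_le r t₀ (max (a i) (min (b i) t₀))).trans
        (add_le_add_left hrσ.le _)
      gcongr
      exact (norm_sub_le_mul_abs_sub_add hθi hmem hr).trans (by gcongr)
    _ < κ := hi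

theorem exists_approx (h : IsLimitCurve U θ a b c e Θ a₀ b₀) (ht₀ : t₀ ∈ Icc a₀ b₀) {κ : ℝ}
    (hκ : 0 < κ) :
    ∃ σ > 0, ∀ s ∈ Icc a₀ b₀, ∀ t ∈ Icc a₀ b₀, s ≤ t → |s - t₀| < σ → |t - t₀| < σ →
      ∃ s' t' : ι → ℝ, Tendsto s' U (𝓝 s) ∧ Tendsto t' U (𝓝 t) ∧
        Tendsto (fun i => θ i (s' i)) U (𝓝 (Θ s)) ∧ Tendsto (fun i => θ i (t' i)) U (𝓝 (Θ t)) ∧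
        ∀ᶠ i in (U : Filter ι), s' i ∈ Icc (a i) (b i) ∧ t' i ∈ Icc (a i) (b i) ∧ s' i ≤ t' i ∧
          ∀ r ∈ Icc (s' i) (t' i), dist (θ i r) (Θ t₀) < κ := by
  obtain ⟨σ, hσ, hclose⟩ := h.exists_eventually_dist_lt ht₀ hκ
  refine ⟨σ, hσ, fun s hs t ht hst hsσ htσ => ?_⟩
  have hs' := h.tendsto_max_min hs
  have ht' := h.tendsto_max_min ht
  refine ⟨_, _, hs', ht', h.tendsto_apply_max_min hs, h.tendsto_apply_max_min ht, ?_⟩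
  filter_upwards [hclose, h.eventually_max_min_mem s, h.eventually_max_min_mem t,
    (hs'.sub_const t₀).abs.eventually (gt_mem_nhds hsσ),
    (ht'.sub_const t₀).abs.eventually (gt_mem_nhds htσ)] with i hi hsi hti hsiσ htiσ
  refine ⟨hsi, hti, max_le_max le_rfl (min_le_min le_rfl hst), fun r hr => ?_⟩
  refine hi r ⟨hsi.1.trans hr.1, hr.2.trans hti.2⟩ ?_
  rw [abs_lt] at hsiσ htiσ ⊢
  exact ⟨by linarith [hr.1], by linarith [hr.2]⟩

variable [NormedAddCommGroup F] [NormedSpace ℝ F] {g : E → F} {v : F}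

theorem exists_norm_sub_sub_smul_le (h : IsLimitCurve U θ a b c e Θ a₀ b₀)
    (ht₀ : t₀ ∈ Icc a₀ b₀) (hg : Continuous g) {e' : ι → ℝ} (he' : Tendsto e' U (𝓝 0)) {η : ℝ}
    (hv : ∃ κ > 0, ∀ᶠ i in (U : Filter ι), ∀ s ∈ Icc (a i) (b i), ∀ t ∈ Icc (a i) (b i), s ≤ t →
      (∀ r ∈ Icc s t, dist (θ i r) (Θ t₀) < κ) →
        ‖g (θ i t) - g (θ i s) - (t - s) • v‖ ≤ η * (t - s) + e' i) :
    ∃ σ > 0, ∀ s ∈ Icc a₀ b₀, ∀ t ∈ Icc a₀ b₀, s ≤ t → |s - t₀| < σ → |t - t₀| < σ →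
      ‖g (Θ t) - g (Θ s) - (t - s) • v‖ ≤ η * (t - s) := by
  obtain ⟨κ, hκ, hev⟩ := hv
  obtain ⟨σ, hσ, happrox⟩ := h.exists_approx ht₀ hκ
  refine ⟨σ, hσ, fun s hs t ht hst hsσ htσ => ?_⟩
  obtain ⟨s', t', hs', ht', hθs, hθt, hall⟩ := happrox s hs t ht hst hsσ htσ
  have hlim := (((hg.tendsto _).comp hθt).sub ((hg.tendsto _).comp hθs)).sub
    ((ht'.sub hs').smul_const v) |>.norm
  have hbound := ((ht'.sub hs').const_mul η).add he'
  rw [add_zero] at hbound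
  refine le_of_tendsto_of_tendsto hlim hbound ?_
  filter_upwards [hall, hev] with i ⟨hsi, hti, hle, hclose⟩ hi
  exact hi _ hsi _ hti hle hclose

theorem hasDerivWithinAt_comp (h : IsLimitCurve U θ a b c e Θ a₀ b₀) (ht₀ : t₀ ∈ Icc a₀ b₀)
    (hg : Continuous g) {e' : ι → ℝ} (he' : Tendsto e' U (𝓝 0))
    (hv : ∀ η > 0, ∃ κ > 0, ∀ᶠ i in (U : Filter ι), ∀ s ∈ Icc (a i) (b i),
      ∀ t ∈ Icc (a i) (b i), s ≤ t → (∀ r ∈ Icc s t, dist (θ i r) (Θ t₀) < κ) →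
        ‖g (θ i t) - g (θ i s) - (t - s) • v‖ ≤ η * (t - s) + e' i) :
    HasDerivWithinAt (fun t => g (Θ t)) v (Icc a₀ b₀) t₀ := by
  rw [hasDerivWithinAt_iff_isLittleO, Asymptotics.isLittleO_iff]
  intro η hη
  obtain ⟨σ, hσ, hbound⟩ := h.exists_norm_sub_sub_smul_le ht₀ hg he' (hv η hη)
  have ht₀σ : |t₀ - t₀| < σ := by simpa using hσ
  filter_upwards [self_mem_nhdsWithin,
    nhdsWithin_le_nhds (Metric.ball_mem_nhds t₀ hσ)] with t ht htσ
  rw [Metric.mem_ball, Real.dist_eq] at htσ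
  rcases le_total t₀ t with hle | hle
  · rw [Real.norm_of_nonneg (sub_nonneg.mpr hle)]
    exact hbound t₀ ht₀ t ht hle ht₀σ htσ
  · have hneg : g (Θ t) - g (Θ t₀) - (t - t₀) • v = -(g (Θ t₀) - g (Θ t) - (t₀ - t) • v) := by
      module
    rw [hneg, norm_neg, norm_sub_rev t, Real.norm_of_nonneg (sub_nonneg.mpr hle)]
    exact hbound t ht t₀ ht₀ hle htσ ht₀σ

theorem exists_slope_mem (h : IsLimitCurve U θ a b c e Θ a₀ b₀) (ht₀ : t₀ ∈ Icc a₀ b₀)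
    (hg : Continuous g) {Q : Set F} (hQ : IsClosed Q)
    (hv : ∃ κ > 0, ∀ᶠ i in (U : Filter ι), ∀ s ∈ Icc (a i) (b i), ∀ t ∈ Icc (a i) (b i), s < t →
      (∀ r ∈ Icc s t, dist (θ i r) (Θ t₀) < κ) → slope (fun t => g (θ i t)) s t ∈ Q) :
    ∃ σ > 0, ∀ s ∈ Icc a₀ b₀, ∀ t ∈ Icc a₀ b₀, s < t → |s - t₀| < σ → |t - t₀| < σ →
      slope (fun t => g (Θ t)) s t ∈ Q := by
  obtain ⟨κ, hκ, hev⟩ := hv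
  obtain ⟨σ, hσ, happrox⟩ := h.exists_approx ht₀ hκ
  refine ⟨σ, hσ, fun s hs t ht hst hsσ htσ => ?_⟩
  obtain ⟨s', t', hs', ht', hθs, hθt, hall⟩ := happrox s hs t ht hst.le hsσ htσ
  have hlim := ((ht'.sub hs').inv₀ (sub_ne_zero.mpr hst.ne')).smul
    (((hg.tendsto _).comp hθt).sub ((hg.tendsto _).comp hθs))
  rw [slope_def_module]
  refine hQ.mem_of_tendsto hlim ?_
  filter_upwards [hall, hev, hs'.eventually_lt ht' hst] with i ⟨hsi, hti, _, hclose⟩ hi hlt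
  simpa only [slope_def_module, Function.comp_apply] using hi _ hsi _ hti hlt hclose

theorem deriv_comp_mem (h : IsLimitCurve U θ a b c e Θ a₀ b₀) (hab : a₀ < b₀)
    (ht₀ : t₀ ∈ Icc a₀ b₀) (hg : Continuous g) {Q : Set F} (hQ : IsClosed Q)
    (hd : HasDerivWithinAt (fun t => g (Θ t)) v (Icc a₀ b₀) t₀)
    (hv : ∃ κ > 0, ∀ᶠ i in (U : Filter ι), ∀ s ∈ Icc (a i) (b i), ∀ t ∈ Icc (a i) (b i), s < t →
      (∀ r ∈ Icc s t, dist (θ i r) (Θ t₀) < κ) → slope (fun t => g (θ i t)) s t ∈ Q) :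
    v ∈ Q := by
  obtain ⟨σ, hσ, hslope⟩ := h.exists_slope_mem ht₀ hg hQ hv
  have ht₀σ : |t₀ - t₀| < σ := by simpa using hσ
  rw [hasDerivWithinAt_iff_tendsto_slope] at hd
  have hne : (𝓝[Icc a₀ b₀ \ {t₀}] t₀).NeBot := by
    have hud := uniqueDiffOn_Icc hab t₀ ht₀
    rwa [uniqueDiffWithinAt_iff_accPt, accPt_principal_iff_nhdsWithin] at hud
  refine hQ.mem_of_tendsto hd ?_
  filter_upwards [self_mem_nhdsWithin,
    nhdsWithin_le_nhds (Metric.ball_mem_nhds t₀ hσ)] with t ⟨ht, hne⟩ htσ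
  rw [Metric.mem_ball, Real.dist_eq] at htσ
  rcases lt_or_gt_of_ne (show t ≠ t₀ from hne) with hlt | hlt
  · rw [slope_comm]
    exact hslope t ht t₀ ht₀ hlt htσ ht₀σ
  · exact hslope t₀ ht₀ t ht hlt ht₀σ htσ

end IsLimitCurve

/-! ### Limits of the oscillatory system -/

theorem eq_add_smul_of_ae_hasDerivWithinAt {V : Type*} [NormedAddCommGroup V] [NormedSpace ℝ V]
    {f : ℝ → V} {a b r : ℝ} {v : V} (hf : AbsolutelyContinuousOnInterval f a b)
    (h : ∀ᵐ t : ℝ, t ∈ Icc a b → HasDerivWithinAt f v (Icc a b) t) (hr : r ∈ Icc a b) :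
    f r = f a + (r - a) • v := by
  rcases hr.1.eq_or_lt with rfl | har
  · simp
  have hsub : Icc a r ⊆ Icc a b := Icc_subset_Icc_right hr.2
  have hslope : slope f a r = v := slope_mem_of_ae_hasDerivWithinAt har
    (hf.mono (by rwa [uIcc_of_le har.le, uIcc_of_le (hr.1.trans hr.2)])) (convex_singleton v)
    isClosed_singleton (by
      filter_upwards [h] with t ht htr
      exact ⟨v, rfl, (ht (hsub htr)).mono hsub⟩)
  rw [← hslope, sub_smul_slope, vsub_eq_sub, add_sub_cancel]

theorem HybridSystem.IsFlowSegment.continuousLinearMap_comp {E F : Type*} [NormedAddCommGroup E]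
    [NormedSpace ℝ E] [NormedAddCommGroup F] [NormedSpace ℝ F] {H : HybridSystem E} {x : ℝ → E}
    {a b : ℝ} (h : H.IsFlowSegment x a b) (hab : a < b) (L : E →L[ℝ] F) :
    AbsolutelyContinuousOnInterval (fun t => L (x t)) a b ∧
      ∀ᵐ t : ℝ, t ∈ Icc a b →
        ∃ v ∈ H.F (x t), HasDerivWithinAt (fun t => L (x t)) (L v) (Icc a b) t := by
  obtain ⟨hac, -, hderiv⟩ := h hab
  refine ⟨absolutelyContinuousOnInterval_lipschitzWith_comp L.lipschitz hac, ?_⟩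
  filter_upwards [hderiv] with t ht htab
  obtain ⟨v, hv, hd⟩ := ht htab
  exact ⟨v, hv, L.hasFDerivAt.comp_hasDerivWithinAt t hd⟩

namespace OscillatoryData

variable {n₁ n₂ : ℕ} {S : OscillatoryData n₁ n₂} {δ T₁ T₂ ε ρ M a b : ℝ}
  {y : ℝ → OscState n₁ n₂ × (ℝ × ℝ)}

section Segments

theorem phases_eq_of_isFlowSegment (hy : (S.original ε).IsFlowSegment y a b) (hab : a < b) {r : ℝ}
    (hr : r ∈ Icc a b) : (y r).2 = (y a).2 + (r - a) • (ε⁻¹, (ε ^ 2)⁻¹) := by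
  obtain ⟨hac, hderiv⟩ := hy.continuousLinearMap_comp hab (.snd ℝ _ _)
  refine eq_add_smul_of_ae_hasDerivWithinAt hac ?_ hr
  filter_upwards [hderiv] with t ht htab
  obtain ⟨v, ⟨-, hv⟩, hd⟩ := ht htab
  exact mem_singleton_iff.mp hv ▸ hd

theorem ae_hasDerivWithinAt_x (hy : (S.original ε).IsFlowSegment y a b) (hab : a < b) :
    AbsolutelyContinuousOnInterval (fun t => (y t).1.1) a b ∧
      ∀ᵐ t : ℝ, t ∈ Icc a b → HasDerivWithinAt (fun t => (y t).1.1)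
        (S.vectorField ε (y t).1.1 (y t).1.2 (y t).2.1 (y t).2.2) (Icc a b) t := by
  obtain ⟨hac, hderiv⟩ := hy.continuousLinearMap_comp hab
    ((ContinuousLinearMap.fst ℝ _ _).comp (.fst ℝ _ _))
  refine ⟨hac, ?_⟩
  filter_upwards [hderiv] with t ht htab
  obtain ⟨v, ⟨⟨hv, -⟩, -⟩, hd⟩ := ht htab
  exact mem_singleton_iff.mp hv ▸ hd

theorem ae_hasDerivWithinAt_z (hy : (S.original ε).IsFlowSegment y a b) (hab : a < b) :
    AbsolutelyContinuousOnInterval (fun t => (y t).1.2) a b ∧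
      ∀ᵐ t : ℝ, t ∈ Icc a b → ∃ v ∈ S.Φ (y t).1.2,
        HasDerivWithinAt (fun t => (y t).1.2) v (Icc a b) t := by
  obtain ⟨hac, hderiv⟩ := hy.continuousLinearMap_comp hab
    ((ContinuousLinearMap.snd ℝ _ _).comp (.fst ℝ _ _))
  refine ⟨hac, ?_⟩
  filter_upwards [hderiv] with t ht htab
  obtain ⟨v, ⟨⟨-, hv⟩, -⟩, hd⟩ := ht htab
  exact ⟨_, hv, hd⟩

theorem mem_of_isFlowSegment (hy : (S.original ε).IsFlowSegment y a b) (hab : a < b)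
    (hρ : ∀ s ∈ Icc a b, ‖(y s).1‖ ≤ ρ) {r : ℝ} (hr : r ∈ Icc a b) :
    (y r).1 ∈ S.C ∩ Metric.closedBall 0 ρ :=
  ⟨((hy hab).2.1 r hr).1, by simpa using hρ r hr⟩

theorem norm_z_sub_le (hM : ∀ θ ∈ S.C ∩ Metric.closedBall 0 ρ, ∀ v ∈ S.Φ θ.2, ‖v‖ ≤ M)
    (hy : (S.original ε).IsFlowSegment y a b) (hρ : ∀ s ∈ Icc a b, ‖(y s).1‖ ≤ ρ) (hab : a ≤ b) :
    ‖(y b).1.2 - (y a).1.2‖ ≤ M * (b - a) := by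
  rcases hab.eq_or_lt with rfl | hlt
  · simp
  obtain ⟨hac, hderiv⟩ := ae_hasDerivWithinAt_z hy hlt
  refine norm_sub_le_of_ae_hasDerivWithinAt hab hac ?_
  filter_upwards [hderiv] with t ht htab
  obtain ⟨v, hv, hd⟩ := ht htab
  exact ⟨v, hM _ (mem_of_isFlowSegment hy hlt hρ htab) v hv, hd⟩

theorem slope_z_mem {Q : Set (EuclideanSpace ℝ (Fin n₂))} (hQ : Convex ℝ Q) (hQc : IsClosed Q)
    (hy : (S.original ε).IsFlowSegment y a b) (hab : a < b)
    (hΦ : ∀ r ∈ Icc a b, (y r).1 ∈ S.C → S.Φ (y r).1.2 ⊆ Q) :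
    slope (fun t => (y t).1.2) a b ∈ Q := by
  obtain ⟨hac, hderiv⟩ := ae_hasDerivWithinAt_z hy hab
  refine slope_mem_of_ae_hasDerivWithinAt hab hac hQ hQc ?_
  filter_upwards [hderiv] with t ht htab
  obtain ⟨v, hv, hd⟩ := ht htab
  exact ⟨v, hΦ t htab ((hy hab).2.1 t htab).1 hv, hd⟩

theorem AveragingAssumption.vectorField_eq (h : S.AveragingAssumption δ T₁ T₂)
    {p : OscState n₁ n₂ × (ℝ × ℝ)} (hp : p ∈ (S.original ε).C) :
    S.vectorField ε p.1.1 p.1.2 p.2.1 p.2.2 =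
      ε⁻¹ • extendPhases h.T₁_pos h.T₂_pos S.φ₁ p.1 p.2.1 p.2.2 +
        extendPhases h.T₁_pos h.T₂_pos S.φ₂ p.1 p.2.1 p.2.2 := by
  obtain ⟨hC, hτ₁, hτ₂⟩ := hp
  have hCδ := interior_subset (subset_interior_euclideanInflation S.C h.δ_pos hC)
  rw [vectorField, h.periodic_φ₁.extendPhases_of_nonneg _ _ hCδ hτ₁ hτ₂,
    h.periodic_φ₂.extendPhases_of_nonneg _ _ hCδ hτ₁ hτ₂]

theorem AveragingAssumption.exists_isFastTrajectory (h : S.AveragingAssumption δ T₁ T₂)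
    (hM : ∀ θ ∈ S.C ∩ Metric.closedBall 0 ρ, ∀ v ∈ S.Φ θ.2, ‖v‖ ≤ M)
    (hy : (S.original ε).IsFlowSegment y a b) (hρ : ∀ s ∈ Icc a b, ‖(y s).1‖ ≤ ρ) (hab : a < b) :
    ∃ α β, IsFastTrajectory (S.C ∩ Metric.closedBall 0 ρ) M
      (extendPhases h.T₁_pos h.T₂_pos S.φ₁) (extendPhases h.T₁_pos h.T₂_pos S.φ₂) ε α β
      (fun r => (y r).1.1) (fun r => (y r).1.2) a b := by
  obtain ⟨hac, hderiv⟩ := ae_hasDerivWithinAt_x hy hab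
  refine ⟨(y a).2.1 - a / ε, (y a).2.2 - a / ε ^ 2, hac,
    fun r hr => mem_of_isFlowSegment hy hab hρ hr, fun r hr r' hr' hrr' => ?_, ?_⟩
  · exact norm_z_sub_le hM (hy.mono hr.1 hr'.2)
      (fun s hs => hρ s ⟨hr.1.trans hs.1, hs.2.trans hr'.2⟩) hrr'
  · filter_upwards [hderiv] with r hr hrab
    have hτ := phases_eq_of_isFlowSegment hy hab hrab
    have hτ₁ : (y r).2.1 = (y a).2.1 - a / ε + r / ε := by
      rw [hτ, Prod.fst_add, Prod.smul_fst, smul_eq_mul]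
      ring
    have hτ₂ : (y r).2.2 = (y a).2.2 - a / ε ^ 2 + r / ε ^ 2 := by
      rw [hτ, Prod.snd_add, Prod.smul_snd, smul_eq_mul]
      ring
    rw [← hτ₁, ← hτ₂]
    exact h.vectorField_eq ((hy hab).2.1 r hrab) ▸ hr hrab

theorem AveragingAssumption.exists_norm_sub_le (h : S.AveragingAssumption δ T₁ T₂)
    (hC : IsClosed S.C) (hΦ : LocallyBoundedRel (fun θ : OscState n₁ n₂ => S.Φ θ.2) S.C) (ρ : ℝ) :
    ∃ c Q, 0 ≤ c ∧ 0 ≤ Q ∧ ∀ᶠ ε in 𝓝[>] 0, ∀ y a b, a ≤ b → (S.original ε).IsFlowSegment y a b →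
      (∀ s ∈ Icc a b, ‖(y s).1‖ ≤ ρ) → ‖(y b).1 - (y a).1‖ ≤ c * (b - a) + Q * ε := by
  have hK : IsCompact (S.C ∩ Metric.closedBall 0 ρ) := (isCompact_closedBall 0 ρ).inter_left hC
  have hKO : S.C ∩ Metric.closedBall 0 ρ ⊆ interior (euclideanInflation S.C δ) :=
    inter_subset_left.trans (subset_interior_euclideanInflation S.C h.δ_pos)
  obtain ⟨M, hM₀, hM⟩ := hΦ.exists_norm_le hK inter_subset_left
  obtain ⟨c, Q, hc, hQ, hav⟩ := h.isPeriodicField.exists_norm_sub_le hK hKO hM₀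
  refine ⟨max c M, Q, le_max_of_le_left hc, hQ, ?_⟩
  filter_upwards [hav, self_mem_nhdsWithin] with ε hε hε₀ y a b hab hy hρ
  have hQε : 0 ≤ Q * ε := mul_nonneg hQ (le_of_lt hε₀)
  rcases hab.eq_or_lt with rfl | hlt
  · simpa using hQε
  obtain ⟨α, β, hfast⟩ := h.exists_isFastTrajectory hM hy hρ hlt
  have hba : 0 ≤ b - a := sub_nonneg.mpr hab
  rw [Prod.norm_def]
  refine max_le ((hε α β _ _ a b hab hfast).trans ?_) ((norm_z_sub_le hM hy hρ hab).trans ?_)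
  · exact add_le_add_left (mul_le_mul_of_nonneg_right (le_max_left c M) hba) _
  · exact le_add_of_le_of_nonneg (mul_le_mul_of_nonneg_right (le_max_right c M) hba) hQε

theorem AveragingAssumption.exists_norm_sub_smul_averageMap_le
    (h : S.AveragingAssumption δ T₁ T₂) (hC : IsClosed S.C)
    (hΦ : LocallyBoundedRel (fun θ : OscState n₁ n₂ => S.Φ θ.2) S.C) (ρ : ℝ) :
    ∃ Q, 0 ≤ Q ∧ ∀ η > 0, ∃ κ > 0, ∀ᶠ ε in 𝓝[>] 0, ∀ y a b, a ≤ b →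
      (S.original ε).IsFlowSegment y a b → (∀ s ∈ Icc a b, ‖(y s).1‖ ≤ ρ) →
      ∀ θ ∈ S.C ∩ Metric.closedBall 0 ρ, (∀ r ∈ Icc a b, dist (y r).1 θ < κ) →
        ‖(y b).1.1 - (y a).1.1 - (b - a) • S.averageMap T₁ T₂ θ‖ ≤ η * (b - a) + Q * ε := by
  have hK : IsCompact (S.C ∩ Metric.closedBall 0 ρ) := (isCompact_closedBall 0 ρ).inter_left hC
  have hKO : S.C ∩ Metric.closedBall 0 ρ ⊆ interior (euclideanInflation S.C δ) :=
    inter_subset_left.trans (subset_interior_euclideanInflation S.C h.δ_pos)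
  obtain ⟨M, hM₀, hM⟩ := hΦ.exists_norm_le hK inter_subset_left
  obtain ⟨Q, hQ, hav⟩ := h.isPeriodicField.exists_norm_sub_smul_fullAverage_le hK hKO hM₀
  refine ⟨Q, hQ, fun η hη => ?_⟩
  obtain ⟨κ, hκ, hev⟩ := hav η hη
  refine ⟨κ, hκ, ?_⟩
  filter_upwards [hev, self_mem_nhdsWithin] with ε hε hε₀ y a b hab hy hρ θ hθ hclose
  rcases hab.eq_or_lt with rfl | hlt
  · simpa using mul_nonneg hQ (le_of_lt hε₀)
  obtain ⟨α, β, hfast⟩ := h.exists_isFastTrajectory hM hy hρ hlt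
  rw [← h.fullAverage_extendPhases (hKO hθ)]
  exact hε α β _ _ a b hab hfast θ hθ hclose

end Segments

section LimitCurves

variable {ι : Type*} {U : Ultrafilter ι} {ε : ι → ℝ} {y : ι → ℝ → OscState n₁ n₂ × (ℝ × ℝ)}
  {a b : ι → ℝ} {a₀ b₀ : ℝ}

theorem AveragingAssumption.exists_isLimitCurve (h : S.AveragingAssumption δ T₁ T₂)
    (hC : IsClosed S.C) (hΦ : LocallyBoundedRel (fun θ : OscState n₁ n₂ => S.Φ θ.2) S.C)
    (hε : Tendsto ε U (𝓝[>] 0)) (ha : Tendsto a U (𝓝 a₀)) (hb : Tendsto b U (𝓝 b₀))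
    (hab : ∀ᶠ i in (U : Filter ι), a i ≤ b i)
    (hy : ∀ᶠ i in (U : Filter ι), (S.original (ε i)).IsFlowSegment (y i) (a i) (b i))
    (hρ : ∀ᶠ i in (U : Filter ι), ∀ s ∈ Icc (a i) (b i), ‖(y i s).1‖ ≤ ρ) :
    ∃ c e Θ, IsLimitCurve U (fun i s => (y i s).1) a b c e Θ a₀ b₀ := by
  obtain ⟨c, Q, hc, -, hle⟩ := h.exists_norm_sub_le hC hΦ ρ
  have herror : Tendsto (fun i => Q * ε i) U (𝓝 0) := by
    simpa using (tendsto_nhds_of_tendsto_nhdsWithin hε).const_mul Q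
  refine ⟨c, _, IsLimitCurve.exists_of_norm_le hc ha hb herror hab hρ ?_⟩
  filter_upwards [hε.eventually hle, hy, hρ] with i hi hyi hρi s hs t ht hst
  exact hi _ s t hst (hyi.mono hs.1 ht.2) fun r hr => hρi r ⟨hs.1.trans hr.1, hr.2.trans ht.2⟩

variable {c : ℝ} {e : ι → ℝ} {Θ : ℝ → OscState n₁ n₂} {t₀ : ℝ}

theorem mem_of_isLimitCurve (hC : IsClosed S.C)
    (hΘ : IsLimitCurve U (fun i s => (y i s).1) a b c e Θ a₀ b₀) (hab₀ : a₀ < b₀)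
    (hy : ∀ᶠ i in (U : Filter ι), (S.original (ε i)).IsFlowSegment (y i) (a i) (b i))
    (hρ : ∀ᶠ i in (U : Filter ι), ∀ s ∈ Icc (a i) (b i), ‖(y i s).1‖ ≤ ρ)
    (ht₀ : t₀ ∈ Icc a₀ b₀) : Θ t₀ ∈ S.C ∩ Metric.closedBall 0 ρ := by
  refine hΘ.mem_of_isClosed (hC.inter Metric.isClosed_closedBall) ?_ ht₀
  filter_upwards [hy, hρ, hΘ.tendsto_left.eventually_lt hΘ.tendsto_right hab₀] with i hyi hρi hi s
  exact mem_of_isFlowSegment hyi hi hρi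

theorem AveragingAssumption.hasDerivWithinAt_x_of_isLimitCurve (h : S.AveragingAssumption δ T₁ T₂)
    (hC : IsClosed S.C) (hΦ : LocallyBoundedRel (fun θ : OscState n₁ n₂ => S.Φ θ.2) S.C)
    (hε : Tendsto ε U (𝓝[>] 0)) (hΘ : IsLimitCurve U (fun i s => (y i s).1) a b c e Θ a₀ b₀)
    (hy : ∀ᶠ i in (U : Filter ι), (S.original (ε i)).IsFlowSegment (y i) (a i) (b i))
    (hρ : ∀ᶠ i in (U : Filter ι), ∀ s ∈ Icc (a i) (b i), ‖(y i s).1‖ ≤ ρ)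
    (ht₀ : t₀ ∈ Icc a₀ b₀) (hmem : Θ t₀ ∈ S.C ∩ Metric.closedBall 0 ρ) :
    HasDerivWithinAt (fun t => (Θ t).1) (S.averageMap T₁ T₂ (Θ t₀)) (Icc a₀ b₀) t₀ := by
  obtain ⟨Q, -, hav⟩ := h.exists_norm_sub_smul_averageMap_le hC hΦ ρ
  have herror : Tendsto (fun i => Q * ε i) U (𝓝 0) := by
    simpa using (tendsto_nhds_of_tendsto_nhdsWithin hε).const_mul Q
  refine hΘ.hasDerivWithinAt_comp ht₀ continuous_fst herror fun η hη => ?_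
  obtain ⟨κ, hκ, hle⟩ := hav η hη
  refine ⟨κ, hκ, ?_⟩
  filter_upwards [hε.eventually hle, hy, hρ] with i hi hyi hρi s hs t ht hst hclose
  exact hi _ s t hst (hyi.mono hs.1 ht.2) (fun r hr => hρi r ⟨hs.1.trans hr.1, hr.2.trans ht.2⟩)
    _ hmem hclose

theorem deriv_z_mem_of_isLimitCurve
    (hosc : OuterSemicontinuousRel (fun θ : OscState n₁ n₂ => S.Φ θ.2) S.C)
    (hΦ : LocallyBoundedRel (fun θ : OscState n₁ n₂ => S.Φ θ.2) S.C)
    (hconv : ∀ θ ∈ S.C, Convex ℝ (S.Φ θ.2))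
    (hΘ : IsLimitCurve U (fun i s => (y i s).1) a b c e Θ a₀ b₀) (hab₀ : a₀ < b₀)
    (hy : ∀ᶠ i in (U : Filter ι), (S.original (ε i)).IsFlowSegment (y i) (a i) (b i))
    (ht₀ : t₀ ∈ Icc a₀ b₀) (hmem : Θ t₀ ∈ S.C) {v : EuclideanSpace ℝ (Fin n₂)}
    (hd : HasDerivWithinAt (fun t => (Θ t).2) v (Icc a₀ b₀) t₀) : v ∈ S.Φ (Θ t₀).2 := by
  rw [← (hosc.isClosed hmem).closure_eq, Metric.closure_eq_iInter_cthickening, mem_iInter₂]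
  intro σ hσ
  obtain ⟨κ, hκ, hsub⟩ := Metric.mem_nhdsWithin_iff.mp
    (hosc.eventually_subset_thickening hΦ hmem hσ)
  refine hΘ.deriv_comp_mem hab₀ ht₀ continuous_snd Metric.isClosed_cthickening hd ⟨κ, hκ, ?_⟩
  filter_upwards [hy] with i hyi s hs t ht hst hclose
  exact slope_z_mem ((hconv _ hmem).cthickening σ) Metric.isClosed_cthickening
    (hyi.mono hs.1 ht.2) hst fun r hr hrC =>
      (hsub ⟨hclose r hr, hrC⟩).trans (Metric.thickening_subset_cthickening _ _)

theorem AveragingAssumption.isFlowSegment_of_isLimitCurve (h : S.AveragingAssumption δ T₁ T₂)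
    (hC : IsClosed S.C) (hosc : OuterSemicontinuousRel (fun θ : OscState n₁ n₂ => S.Φ θ.2) S.C)
    (hΦ : LocallyBoundedRel (fun θ : OscState n₁ n₂ => S.Φ θ.2) S.C)
    (hconv : ∀ θ ∈ S.C, Convex ℝ (S.Φ θ.2)) (hε : Tendsto ε U (𝓝[>] 0))
    (hΘ : IsLimitCurve U (fun i s => (y i s).1) a b c e Θ a₀ b₀)
    (hy : ∀ᶠ i in (U : Filter ι), (S.original (ε i)).IsFlowSegment (y i) (a i) (b i))
    (hρ : ∀ᶠ i in (U : Filter ι), ∀ s ∈ Icc (a i) (b i), ‖(y i s).1‖ ≤ ρ) :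
    (S.average T₁ T₂).IsFlowSegment Θ a₀ b₀ := by
  intro hab₀
  have hmem : ∀ t ∈ Icc a₀ b₀, Θ t ∈ S.C ∩ Metric.closedBall 0 ρ := fun t =>
    mem_of_isLimitCurve hC hΘ hab₀ hy hρ
  refine ⟨LipschitzOnWith.absolutelyContinuousOnInterval (K := c.toNNReal)
    (by simpa only [uIcc_of_le hab₀.le] using hΘ.lipschitzOnWith), fun t ht => (hmem t ht).1, ?_⟩
  have hdiff := (LipschitzWith.prod_snd.comp_lipschitzOnWith
    hΘ.lipschitzOnWith).ae_differentiableWithinAt_of_mem_real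
  filter_upwards [hdiff] with t hd ht
  have hdz := (hd ht).hasDerivWithinAt
  have hz := deriv_z_mem_of_isLimitCurve hosc hΦ hconv hΘ hab₀ hy ht (hmem t ht).1 hdz
  have hdx := h.hasDerivWithinAt_x_of_isLimitCurve hC hΦ hε hΘ hy hρ ht (hmem t ht)
  exact ⟨(S.averageMap T₁ T₂ (Θ t), derivWithin (Prod.snd ∘ Θ) (Icc a₀ b₀) t), ⟨rfl, hz⟩,
    hdx.prodMk hdz⟩

end LimitCurves

theorem jump_of_tendsto {ι : Type*} {l : Filter ι} [l.NeBot] {ε : ι → ℝ} (hD : IsClosed S.D)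
    (hosc : OuterSemicontinuousRel S.G S.D) {p q : ι → OscState n₁ n₂ × (ℝ × ℝ)}
    {p₀ q₀ : OscState n₁ n₂} (hp : Tendsto (fun i => (p i).1) l (𝓝 p₀))
    (hq : Tendsto (fun i => (q i).1) l (𝓝 q₀))
    (hpq : ∀ᶠ i in l, p i ∈ (S.original (ε i)).D ∧ q i ∈ (S.original (ε i)).G (p i)) :
    p₀ ∈ S.D ∧ q₀ ∈ S.G p₀ := by
  have hpD : ∀ᶠ i in l, (p i).1 ∈ S.D := hpq.mono fun i hi => hi.1.1
  have hp₀ := hD.mem_of_tendsto hp hpD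
  exact ⟨hp₀, hosc.mem_of_tendsto hp₀ hp hq hpD (hpq.mono fun i hi => hi.2.1)⟩

theorem exists_tendsto_of_isChain {ι E : Type*} [NormedAddCommGroup E] [NormedSpace ℝ E]
    {U : Ultrafilter ι} {H : ι → HybridSystem E} {J : ℕ} {t : ι → ℕ → ℝ} {x : ι → ℕ → ℝ → E}
    {T : ℝ} (h : ∀ᶠ i in (U : Filter ι), (H i).IsChain J (t i) (x i) ∧ t i (J + 1) ≤ T) :
    ∃ t' : ℕ → ℝ, ∀ k ≤ J + 1, Tendsto (fun i => t i k) U (𝓝 (t' k)) := by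
  have hlim : ∀ k ≤ J + 1, ∃ p, Tendsto (fun i => t i k) U (𝓝 p) := fun k hk =>
    exists_tendsto_ultrafilter_of_norm_le (c := T) (by
      filter_upwards [h] with i ⟨hch, hT⟩
      have hmono := monotoneOn_Iic_succ_of_le_succ hch.le
      have hnonneg : 0 ≤ t i k := hch.zero ▸ hmono (Nat.zero_le _) hk (Nat.zero_le k)
      rw [Real.norm_of_nonneg hnonneg]
      exact (hmono hk self_mem_Iic hk).trans hT)
  choose! t' ht' using hlim
  exact ⟨t', ht'⟩

theorem AveragingAssumption.hasChainLimits (h : S.AveragingAssumption δ T₁ T₂)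
    (hC : IsClosed S.C) (hD : IsClosed S.D)
    (hoscΦ : OuterSemicontinuousRel (fun θ : OscState n₁ n₂ => S.Φ θ.2) S.C)
    (hΦ : LocallyBoundedRel (fun θ : OscState n₁ n₂ => S.Φ θ.2) S.C)
    (hconv : ∀ θ ∈ S.C, Convex ℝ (S.Φ θ.2)) (hoscG : OuterSemicontinuousRel S.G S.D) :
    HasChainLimits S.original (S.average T₁ T₂) := by
  intro U ε J t x T ρ hpos hε hch
  have hε' : Tendsto ε U (𝓝[>] 0) := tendsto_nhdsWithin_iff.mpr ⟨hε, .of_forall hpos⟩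
  obtain ⟨t', ht'⟩ := exists_tendsto_of_isChain (hch.mono fun i hi => ⟨hi.1, hi.2.1⟩)
  have hle : ∀ k ≤ J, ∀ᶠ i in (U : Filter ℕ), t i k ≤ t i (k + 1) := fun k hk =>
    hch.mono fun i hi => hi.1.le k hk
  have hseg : ∀ k ≤ J, ∃ Θ, (S.average T₁ T₂).IsFlowSegment Θ (t' k) (t' (k + 1)) ∧
      Tendsto (fun i => (x i k (t i k)).1) U (𝓝 (Θ (t' k))) ∧
      Tendsto (fun i => (x i k (t i (k + 1))).1) U (𝓝 (Θ (t' (k + 1)))) := by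
    intro k hk
    have hflow := hch.mono fun i hi => hi.1.flow k hk
    have hρ := hch.mono fun i hi => hi.2.2 k hk
    obtain ⟨c, e, Θ, hΘ⟩ := h.exists_isLimitCurve hC hΦ hε' (ht' k (by omega))
      (ht' (k + 1) (by omega)) (hle k hk) hflow hρ
    exact ⟨Θ, h.isFlowSegment_of_isLimitCurve hC hoscΦ hΦ hconv hε' hΘ hflow hρ,
      hΘ.tendsto _ _ ((hle k hk).mono fun i => left_mem_Icc.mpr) hΘ.tendsto_left,
      hΘ.tendsto _ _ ((hle k hk).mono fun i => right_mem_Icc.mpr) hΘ.tendsto_right⟩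
  choose! x' hflow hleft hright using hseg
  have hzero : t' 0 = 0 := tendsto_nhds_unique (ht' 0 (Nat.zero_le _))
    (tendsto_const_nhds.congr' (hch.mono fun i hi => hi.1.zero.symm))
  have hstart : Tendsto (fun i => (x i 0 0).1) U (𝓝 (x' 0 0)) := by
    have hleft₀ := hleft 0 (Nat.zero_le J)
    rw [hzero] at hleft₀
    exact hleft₀.congr' (hch.mono fun i hi => by rw [hi.1.zero])
  refine ⟨t', x', ⟨hzero, ?_, fun k hk => ?_, hflow, fun k hk => ?_⟩, ht' (J + 1) le_rfl, hstart,
    hright J le_rfl⟩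
  · exact (hC.union hD).mem_of_tendsto hstart
      (hch.mono fun i hi => hi.1.start.imp And.left And.left)
  · exact le_of_tendsto_of_tendsto (ht' k (by omega)) (ht' (k + 1) (by omega)) (hle k hk)
  · exact jump_of_tendsto hD hoscG (hright k hk.le) (hleft (k + 1) hk)
      (hch.mono fun i hi => hi.1.jump k hk)

theorem hasBoundedJumps_original (hD : IsClosed S.D) (hG : LocallyBoundedRel S.G S.D) :
    HasBoundedJumps S.original := by
  intro ρ
  obtain ⟨c, -, hc⟩ := hG.exists_norm_le
    ((isCompact_closedBall (0 : OscState n₁ n₂) ρ).inter_left hD) inter_subset_left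
  exact ⟨c, fun ε p q hp hpρ hq => hc p.1 ⟨hp.1, by simpa using hpρ⟩ q.1 hq.1⟩

end OscillatoryData

theorem theorem2_general {n₁ n₂ : ℕ} {S : OscillatoryData n₁ n₂} {δ T₁ T₂ : ℝ}
    (hC : IsClosed S.C) (hD : IsClosed S.D)
    (hoscΦ : OuterSemicontinuousRel (fun θ : OscState n₁ n₂ => S.Φ θ.2) S.C)
    (hΦ : LocallyBoundedRel (fun θ : OscState n₁ n₂ => S.Φ θ.2) S.C)
    (hconv : ∀ θ ∈ S.C, Convex ℝ (S.Φ θ.2)) (hoscG : OuterSemicontinuousRel S.G S.D)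
    (hG : LocallyBoundedRel S.G S.D) (h : S.AveragingAssumption δ T₁ T₂)
    {A B : Set (OscState n₁ n₂)} (hUAS : (S.average T₁ T₂).IsUAS A B) :
    IsSGPAS S.original A B :=
  (h.hasChainLimits hC hD hoscΦ hΦ hconv hoscG).isSGPAS
    (OscillatoryData.hasBoundedJumps_original hD hG) hUAS

theorem theorem2 (n₁ n₂ : ℕ) (S : OscillatoryData n₁ n₂) (δ T₁ T₂ : ℝ)
    (hbasic : S.BasicAssumption) (hosc : S.OscillationAssumption δ T₁ T₂)
    (A B : Set (OscState n₁ n₂)) (hA : IsCompact A)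
    (hUAS : (S.average T₁ T₂).IsUAS A B) :
    IsSGPAS S.original A B :=
  theorem2_general hbasic.isClosed_C hbasic.isClosed_D hbasic.osc_Φ hbasic.locallyBounded_Φ
    hbasic.convex_Φ hbasic.osc_G hbasic.locallyBounded_G hosc.averagingAssumption hUAS
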